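/- Let $K$ be a number field and let $\pi : X\to\operatorname{Spec}K$ be an integral projective variety over $K$. The places of $K$ are the maximal ideals $\mathfrak p$ of $\mathcal O_K$ (with $|a|_{\mathfrak p}=p^{-v_{\mathfrak p}(a)}$, where $p$ is the residue characteristic, and $n_{\mathfrak p}=[\mathbb F_{\mathfrak p}:\mathbb Z/p\mathbb Z]$) and the embeddings $\sigma: K\to\mathbb C$ (with $n_\sigma=1$). Let $X_v^{\mathrm{an}}$ be the Berkovich analytic space of $X_{K_v}$ if $v$ is finite, and the space $X_\sigma(\mathbb C)$ of $\sigma$-linear complex points if $v=\sigma$. An adelic line bundle $\overline L$ on $X$ is a line bundle $L$ on $X$ with, for each place $v$, a continuous metric on the line bundle induced by $L$ on $X_v^{\mathrm{an}}$, the family being invariant under complex conjugation, such that over some non-empty open subscheme $Z$ of $\operatorname{Spec}\mathcal O_K$ there is a projective flat model of $(X,L)$ that induces the metrics at all finite places in $Z$. Let $\widehat{\mathrm{Pic}}(X)$ be the group of isometry classes of adelic line bundles, for the tensor product. For a place $v$ and a continuous real function $f$ on $X_v^{\mathrm{an}}$ (assumed invariant under complex conjugation if $v$ is a real embedding), let $\mathcal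 O_v(f)$ be the line bundle $\mathcal O_X$ with the metrics such that $\|1\|_v=(\#\mathbb F_{v})^{-f}$ if $v$ is finite, $\|1\|_v=e^{-f}$ (and, at $\overline v$, the conjugate function) if $v$ is an embedding, and $\|1\|_w=1$ at all other places $w$. Let $C_v(X)\subseteq \widehat{\mathrm{Pic}}(X)$ be the subgroup of the classes of the $\mathcal O_v(f)$, and for $\overline L\in\widehat{\mathrm{Pic}}(X)$ let $C_v(X,\overline L)=\{\overline L^{\otimes n}\otimes \overline M : n\ge 1,\ \overline M\in C_v(X)\}$. For $x\in X(\overline K)$, with field of definition $K(x)$, put $$\eta_{x,v}=\frac1{[K(x):K]}\sum_{\tau}\delta_{\tau(x)},\qquad h_{\overline L}(x)=-\frac1{[K(x):\mathbb Q]}\sum_{w}n_w\sum_{\tau}\log\|s\|_w(\tau(x)),$$ where in the first sum $\tau$ runs over the $K$-embeddings of $K(x)$ in $\mathbb C_v$, and in the second $w$ runs over all places of $K$ and $\tau$ over the $K$-embeddings of $K(x)$ in $\mathbb C_w$; $s$ is any non-zero vector of the fibre of $L$ at $x$. Let $H$ be a subgroup of an abelian group $G$, and let $C\subseteq G$ be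 a subset stable under addition which is open with respect to $H$: for all $x\in C$ and $w\in H$ there is $n\ge1$ with $nx+w\in C$. A function $f:C\to\mathbb R$ with $f(nx)=nf(x)$ for all $x\in C$ and $n\ge1$ is differentiable at $x\in C$ in the directions of $H$ if for all $w\in H$ the sequence $f(nx+w)-f(nx)$ (defined for $n$ large) converges in $\mathbb R$ and its limit is an additive function of $w\in H$. Let $v$ be a place of $K$, let $\underline x=(x_n)$ be a sequence of points of $X(\overline K)$, and let $\varphi_{\underline x}(\overline L)=\liminf_{n\to\infty}h_{\overline L}(x_n)\in\mathbb R\cup\{\pm\infty\}$. (1) If the measures $\eta_{x_n,v}$ converge weakly to a Borel probability measure on $X_v^{\mathrm{an}}$, then for every $\overline L\in\widehat{\mathrm{Pic}}(X)$ such that $\varphi_{\underline x}(\overline L)$ is finite, the function $\varphi_{\underline x}$ is finite on $C_v(X,\overline L)$ and, as a function on $C_v(X,\overline L)$, it is differentiable at $\overline L$ in the directions of $C_v(X)$. (2) Conversely, if there is $\overline L\in\widehat{\mathrm{Pic}}(X)$ such that the sequence $h_{\overline L}(x_n)$ converges in $\mathbb R$ and $\varphi_{\underline x}$, as a function on $C_v(X,\overline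 L)$, is differentiable at $\overline L$ in the directions of $C_v(X)$, then the measures $\eta_{x_n,v}$ converge weakly to a Borel probability measure on $X_v^{\mathrm{an}}$. -/

import Mathlib

open AlgebraicGeometry CategoryTheory NumberField IsDedekindDomain Filter Topology MeasureTheory
open scoped NNReal ENNReal

universe u

noncomputable section

namespace Arakelov

/-! ### Places of a number field -/

section Places

variable (K : Type u) [Field K] [NumberField K]

/-- The places of `K`: maximal ideals of `𝓞 K`, and embeddings of `K` in `ℂ`. -/
inductive Place : Type u
  | fin (𝔭 : HeightOneSpectrum (𝓞 K))
  | inf (σ : K →+* ℂ)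

variable {K}

/-- The residue characteristic `p` of `𝔭`. -/
def resChar (𝔭 : HeightOneSpectrum (𝓞 K)) : ℕ := ringChar (𝓞 K ⧸ 𝔭.asIdeal)

/-- The degree `n_𝔭 = [𝔽_𝔭 : ℤ/pℤ]`. -/
def resDegree (𝔭 : HeightOneSpectrum (𝓞 K)) : ℕ :=
  letI : Algebra (ZMod (resChar 𝔭)) (𝓞 K ⧸ 𝔭.asIdeal) :=
    haveI : CharP (𝓞 K ⧸ 𝔭.asIdeal) (resChar 𝔭) := ringChar.charP _
    ZMod.algebra _ (resChar 𝔭)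
  Module.finrank (ZMod (resChar 𝔭)) (𝓞 K ⧸ 𝔭.asIdeal)

/-- The integer `n_v`: equal to `[𝔽_𝔭 : ℤ/pℤ]` at a finite place, to `1` at an embedding. -/
def Place.n : Place K → ℕ
  | .fin 𝔭 => resDegree 𝔭
  | .inf _ => 1

lemma one_lt_resChar (𝔭 : HeightOneSpectrum (𝓞 K)) : (1 : ℝ≥0) < (resChar 𝔭 : ℝ≥0) := by
  have : Finite (𝓞 K ⧸ 𝔭.asIdeal) := 𝔭.asIdeal.finiteQuotientOfFreeOfNeBot 𝔭.ne_bot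
  have : 𝔭.asIdeal.IsMaximal := 𝔭.isMaximal
  let _ : Field (𝓞 K ⧸ 𝔭.asIdeal) := Ideal.Quotient.field _
  have : CharP (𝓞 K ⧸ 𝔭.asIdeal) (resChar 𝔭) := ringChar.charP _
  have h := CharP.char_is_prime_or_zero (𝓞 K ⧸ 𝔭.asIdeal) (resChar 𝔭)
  have h0 : resChar 𝔭 ≠ 0 := CharP.char_ne_zero_of_finite (𝓞 K ⧸ 𝔭.asIdeal) _
  rcases h with h | h
  · exact_mod_cast h.one_lt
  · exact absurd h h0

/-- The absolute value `|a|_𝔭 = p ^ (-v_𝔭(a))` on `K`. -/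
def absFin (𝔭 : HeightOneSpectrum (𝓞 K)) (a : K) : ℝ≥0 :=
  𝔭.adicAbvDef (one_lt_resChar 𝔭) a

/-- The completion `K_𝔭`, with the norm extending `|·|_𝔭`. -/
def LocalField (𝔭 : HeightOneSpectrum (𝓞 K)) : Type u := 𝔭.adicCompletion K

instance (𝔭 : HeightOneSpectrum (𝓞 K)) : NontriviallyNormedField (LocalField 𝔭) :=
  letI : (Valued.v : Valuation (𝔭.adicCompletion K) (WithZero (Multiplicative ℤ))).RankOne :=
    Valuation.IsRankOneDiscrete.rankOne _ (one_lt_resChar 𝔭)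
  Valued.toNontriviallyNormedField (𝔭.adicCompletion K) (WithZero (Multiplicative ℤ))

instance (𝔭 : HeightOneSpectrum (𝓞 K)) : IsUltrametricDist (LocalField 𝔭) :=
  letI : (Valued.v : Valuation (𝔭.adicCompletion K) (WithZero (Multiplicative ℤ))).RankOne :=
    Valuation.IsRankOneDiscrete.rankOne _ (one_lt_resChar 𝔭)
  letI := Valued.toNormedField (𝔭.adicCompletion K) (WithZero (Multiplicative ℤ))
  inferInstanceAs (IsUltrametricDist (𝔭.adicCompletion K))

instance (𝔭 : HeightOneSpectrum (𝓞 K)) : CompleteSpace (LocalField 𝔭) :=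
  inferInstanceAs (CompleteSpace (𝔭.adicCompletion K))

/-- The inclusion `K → K_𝔭`. -/
def toLocalField (𝔭 : HeightOneSpectrum (𝓞 K)) : K →+* LocalField 𝔭 :=
  FinitePlace.embedding 𝔭

lemma nnnorm_toLocalField (𝔭 : HeightOneSpectrum (𝓞 K)) (a : K) :
    ‖toLocalField 𝔭 a‖₊ = absFin 𝔭 a := by
  let _ : (Valued.v : Valuation (𝔭.adicCompletion K) (WithZero (Multiplicative ℤ))).RankOne :=
    Valuation.IsRankOneDiscrete.rankOne _ (one_lt_resChar 𝔭)
  ext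
  change ((WithZeroMulInt.toNNReal (ne_zero_of_lt (one_lt_resChar 𝔭))
    (Valuation.IsRankOneDiscrete.valueGroup₀_equiv_withZeroMulInt
      (Valued.v (R := 𝔭.adicCompletion K) (Γ₀ := WithZero (Multiplicative ℤ)))
      (Valuation.restrict _ (FinitePlace.embedding 𝔭 a))) : ℝ≥0) : ℝ) = _
  rw [Valuation.IsRankOneDiscrete.valueGroup₀_equiv_withZeroMulInt_restrict_apply_of_surjective
      (HeightOneSpectrum.valuedAdicCompletion_surjective K 𝔭)]
  simp [FinitePlace.embedding_apply, absFin, HeightOneSpectrum.adicAbvDef]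

/-- An algebraic closure of `K_𝔭`. -/
def LocalClosure (𝔭 : HeightOneSpectrum (𝓞 K)) : Type u := AlgebraicClosure (LocalField 𝔭)

instance (𝔭 : HeightOneSpectrum (𝓞 K)) : NormedField (LocalClosure 𝔭) :=
  spectralNorm.normedField (LocalField 𝔭) (AlgebraicClosure (LocalField 𝔭))

instance (𝔭 : HeightOneSpectrum (𝓞 K)) : IsUltrametricDist (LocalClosure 𝔭) :=
  IsUltrametricDist.isUltrametricDist_of_forall_norm_add_le_max_norm
    (fun x y => isNonarchimedean_spectralNorm (K := LocalField 𝔭)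
      (L := AlgebraicClosure (LocalField 𝔭)) x y)

/-- The inclusion of `K` in the algebraic closure of `K_𝔭`. -/
def toLocalClosure (𝔭 : HeightOneSpectrum (𝓞 K)) : K →+* LocalClosure 𝔭 :=
  (algebraMap (LocalField 𝔭) (AlgebraicClosure (LocalField 𝔭))).comp (toLocalField 𝔭)

lemma nnnorm_toLocalClosure (𝔭 : HeightOneSpectrum (𝓞 K)) (a : K) :
    ‖toLocalClosure 𝔭 a‖₊ = absFin 𝔭 a := by
  rw [← nnnorm_toLocalField]
  ext
  exact spectralNorm_extends (K := LocalField 𝔭)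
    (L := AlgebraicClosure (LocalField 𝔭)) (toLocalField 𝔭 a)

end Places

/-! ### Projective morphisms -/

section Projective

attribute [local instance] MvPolynomial.gradedAlgebra

/-- The projective space `ℙⁿ` over a scheme `S`. -/
def ProjSpace (n : ℕ) (S : Scheme.{u}) : Scheme.{u} :=
  Limits.pullback (Limits.terminal.from S)
    (Limits.terminal.from (Proj (MvPolynomial.homogeneousSubmodule (Fin (n + 1)) (ULift.{u} ℤ))))

/-- The structure morphism of `ℙⁿ` over `S`. -/
def ProjSpace.toBase (n : ℕ) (S : Scheme.{u}) : ProjSpace n S ⟶ S :=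
  Limits.pullback.fst _ _

/-- A morphism `Y → S` is projective if it factors through a closed immersion of `Y` in some
projective space over `S`. -/
def IsProjective {Y S : Scheme.{u}} (f : Y ⟶ S) : Prop :=
  ∃ (n : ℕ) (i : Y ⟶ ProjSpace n S), IsClosedImmersion i ∧ i ≫ ProjSpace.toBase n S = f

end Projective

/-! ### Analytic spaces attached to the places -/

section Analytic

variable {K : Type u} [Field K] [NumberField K] {X : Scheme.{u}} (π : X ⟶ Spec (.of K))

/-- The inclusion of `K` in the residue field `κ(x)` of a point of a `K`-scheme. -/
def baseHom (x : X) : K →+* X.residueField x :=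
  ((Scheme.ΓSpecIso (.of K)).inv ≫ π.appTop ≫ X.evaluation ⊤ x trivial).hom

/-- A point of the Berkovich analytic space `X_𝔭^an` over `K_𝔭`: a point `x` of `X` with a
multiplicative (ultrametric) absolute value on `κ(x)` that extends `|·|_𝔭`. (By density of `K` in
`K_𝔭` this is the same as a point of `X ⊗ K_𝔭` with an absolute value on its residue field
that extends the one of `K_𝔭`.) -/
structure FinPt (𝔭 : HeightOneSpectrum (𝓞 K)) : Type u where
  pt : X
  val : Valuation (X.residueField pt) ℝ≥0
  val_base : ∀ a : K, val (baseHom π pt a) = absFin 𝔭 a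

/-- A point of the complex analytic space `X_σ^an`: a `σ`-linear complex point of `X`, that is, a
point `x` of `X` with an embedding of `κ(x)` in `ℂ` that extends `σ`. -/
structure InfPt (σ : K →+* ℂ) : Type u where
  pt : X
  emb : X.residueField pt →+* ℂ
  emb_base : emb.comp (baseHom π pt) = σ

/-- The Berkovich topology: the coarsest one for which `pt` is continuous and the functions `|f|`
(`f` a section of `𝒪_X` on an open set `U`) are continuous on the points over `U`. -/
instance (𝔭 : HeightOneSpectrum (𝓞 K)) : TopologicalSpace (FinPt π 𝔭) :=
  TopologicalSpace.generateFrom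
    {s | ∃ (U : X.Opens) (f : Γ(X, U)) (W : Set ℝ≥0), IsOpen W ∧
      s = {y | ∃ h : y.pt ∈ U, y.val (X.evaluation U y.pt h f) ∈ W}}

/-- The classical topology: the coarsest one for which `pt` is continuous and the complex functions
`f` (`f` a section of `𝒪_X` on an open set `U`) are continuous on the points over `U`. -/
instance (σ : K →+* ℂ) : TopologicalSpace (InfPt π σ) :=
  TopologicalSpace.generateFrom
    {s | ∃ (U : X.Opens) (f : Γ(X, U)) (W : Set ℂ), IsOpen W ∧
      s = {y | ∃ h : y.pt ∈ U, y.emb (X.evaluation U y.pt h f) ∈ W}}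

/-- Complex conjugation `X_σ^an → X_σ̄^an`. -/
def InfPt.conj {σ : K →+* ℂ} (y : InfPt π σ) : InfPt π (ComplexEmbedding.conjugate σ) where
  pt := y.pt
  emb := (starRingEnd ℂ).comp y.emb
  emb_base := by rw [RingHom.comp_assoc, y.emb_base]; rfl

/-- Transport of points along an equality of places. -/
def FinPt.cast {𝔭 𝔮 : HeightOneSpectrum (𝓞 K)} (h : 𝔭 = 𝔮) (y : FinPt π 𝔭) : FinPt π 𝔮 :=
  ⟨y.pt, y.val, h ▸ y.val_base⟩

/-- Transport of points along an equality of places. -/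
def InfPt.cast {σ τ : K →+* ℂ} (h : σ = τ) (y : InfPt π σ) : InfPt π τ :=
  ⟨y.pt, y.emb, h ▸ y.emb_base⟩

/-- The analytic space `X_v^an`. -/
def An : Place K → Type u
  | .fin 𝔭 => FinPt π 𝔭
  | .inf σ => InfPt π σ

instance (v : Place K) : TopologicalSpace (An π v) :=
  match v with
  | .fin 𝔭 => inferInstanceAs (TopologicalSpace (FinPt π 𝔭))
  | .inf σ => inferInstanceAs (TopologicalSpace (InfPt π σ))

/-- The Borel `σ`-algebra of `X_v^an`. -/
instance (v : Place K) : MeasurableSpace (An π v) := borel _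

instance (v : Place K) : BorelSpace (An π v) := ⟨rfl⟩

variable {π}

/-- The point of `X` under a point of `X_v^an`. -/
def An.pt : {v : Place K} → An π v → X
  | .fin _, y => FinPt.pt y
  | .inf _, y => InfPt.pt y

/-- The absolute value on `κ(y.pt)` given by a point `y` of `X_v^an`. -/
def An.abs : {v : Place K} → (y : An π v) → X.residueField y.pt → ℝ
  | .fin _, y => fun a => (FinPt.val y a : ℝ)
  | .inf _, y => fun a => ‖InfPt.emb y a‖

/-- The absolute value `|f(y)|` of a section `f` of `𝒪_X` at a point `y` of `X_v^an`. -/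
def An.absAt {v : Place K} (y : An π v) {U : X.Opens} (h : y.pt ∈ U) (f : Γ(X, U)) : ℝ :=
  y.abs (X.evaluation U y.pt h f)

end Analytic

/-! ### Line bundles -/

section LineBundle

variable {X Y : Scheme.{u}}

/-- Restriction of sections. -/
def res {U V : X.Opens} (h : V ≤ U) : Γ(X, U) →+* Γ(X, V) := (X.presheaf.map (homOfLE h).op).hom

lemma res_res {U V W : X.Opens} (h : V ≤ U) (h' : W ≤ V) (f : Γ(X, U)) :
    res h' (res h f) = res (h'.trans h) f := by
  change ((X.presheaf.map _ ≫ X.presheaf.map _).hom f : Γ(X, W)) = _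
  rw [← X.presheaf.map_comp]
  rfl

lemma res_self {U : X.Opens} (h : U ≤ U) (f : Γ(X, U)) : res h f = f := by
  simp [res]

lemma app_res (i : X ⟶ Y) {U V : Y.Opens} (h : V ≤ U) (f : Γ(Y, U)) :
    i.app V (res h f) = res (i.preimage_mono h) (i.app U f) :=
  congrArg (fun φ => φ.hom f) (i.naturality (homOfLE h).op)

lemma eval_res {U V : X.Opens} (h : V ≤ U) (x : X) (hx : x ∈ V) (f : Γ(X, U)) :
    X.evaluation V x hx (res h f) = X.evaluation U x (h hx) f := by
  change (X.presheaf.map (homOfLE h).op ≫ X.presheaf.germ V x hx ≫ X.residue x).hom f = _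
  rw [← Category.assoc, X.presheaf.germ_res]
  rfl

lemma An.absAt_res {K : Type u} [Field K] [NumberField K] {π : X ⟶ Spec (.of K)} {v : Place K}
    (y : An π v) {U V : X.Opens} (h : V ≤ U) (hy : y.pt ∈ V) (f : Γ(X, U)) :
    y.absAt hy (res h f) = y.absAt (h hy) f :=
  congrArg y.abs (eval_res h _ hy f)

lemma An.abs_mul {K : Type u} [Field K] [NumberField K] {π : X ⟶ Spec (.of K)} {v : Place K}
    (y : An π v) (a b : X.residueField y.pt) : y.abs (a * b) = y.abs a * y.abs b := by
  cases v
  · exact congrArg NNReal.toReal (map_mul (FinPt.val y) a b)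
  · exact (congrArg norm (map_mul (InfPt.emb y) a b)).trans (norm_mul _ _)

lemma An.abs_one {K : Type u} [Field K] [NumberField K] {π : X ⟶ Spec (.of K)} {v : Place K}
    (y : An π v) : y.abs 1 = 1 := by
  cases v
  · exact congrArg NNReal.toReal (map_one (FinPt.val y))
  · exact (congrArg norm (map_one (InfPt.emb y))).trans norm_one

lemma An.absAt_mul {K : Type u} [Field K] [NumberField K] {π : X ⟶ Spec (.of K)} {v : Place K}
    (y : An π v) {U : X.Opens} (hy : y.pt ∈ U) (f f' : Γ(X, U)) :
    y.absAt hy (f * f') = y.absAt hy f * y.absAt hy f' :=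
  (congrArg y.abs (map_mul (X.evaluation U y.pt hy).hom f f')).trans (y.abs_mul _ _)

lemma An.absAt_one {K : Type u} [Field K] [NumberField K] {π : X ⟶ Spec (.of K)} {v : Place K}
    (y : An π v) {U : X.Opens} (hy : y.pt ∈ U) : y.absAt hy (1 : Γ(X, U)) = 1 :=
  (congrArg y.abs (map_one (X.evaluation U y.pt hy).hom)).trans y.abs_one

/-- An invertible sheaf, given by a trivialising open cover `(U x)`, indexed by the points of the
scheme, with `x ∈ U x`, and frames `e x` on `U x`, through the transition functions
`e y = g x y • e x` on `U x ∩ U y`. -/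
structure LineBundle (X : Scheme.{u}) : Type u where
  U : X → X.Opens
  mem : ∀ x, x ∈ U x
  g : ∀ x y, Γ(X, U x ⊓ U y)
  g_self : ∀ x, g x x = 1
  cocycle : ∀ x y z,
    res (V := U x ⊓ U y ⊓ U z) inf_le_left (g x y) *
      res (le_inf (inf_le_left.trans inf_le_right) inf_le_right) (g y z) =
    res (le_inf (inf_le_left.trans inf_le_left) inf_le_right) (g x z)

/-- An isomorphism of line bundles, given locally by `e x = h x • e' x` on neighbourhoods `V x` of
the points `x`, for invertible functions `h x`. -/
structure LineBundle.Iso (L L' : LineBundle X) : Type u where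
  V : X → X.Opens
  mem : ∀ x, x ∈ V x
  le : ∀ x, V x ≤ L.U x
  le' : ∀ x, V x ≤ L'.U x
  h : ∀ x, Γ(X, V x)
  isUnit : ∀ x, IsUnit (h x)
  comm : ∀ x y,
    res (V := V x ⊓ V y) (inf_le_inf (le x) (le y)) (L.g x y) * res inf_le_left (h x) =
      res inf_le_right (h y) * res (inf_le_inf (le' x) (le' y)) (L'.g x y)

/-- The pullback of a line bundle by a morphism `i`: the frame at `x` is the pullback of the frame
at `i x`. -/
def LineBundle.pullback (i : X ⟶ Y) (L : LineBundle Y) : LineBundle X where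
  U x := i ⁻¹ᵁ L.U (i x)
  mem x := L.mem (i x)
  g x y := i.app _ (L.g (i x) (i y))
  g_self x := by rw [L.g_self]; exact map_one _
  cocycle x y z := by
    have := congrArg (i.app _) (L.cocycle (i x) (i y) (i z))
    rw [map_mul, app_res, app_res, app_res] at this
    exact this

end LineBundle

section LineBundleGroup

variable {X : Scheme.{u}}

lemma LineBundle.cocycle_res (L : LineBundle X) (x y z : X) {W : X.Opens} (hx : W ≤ L.U x)
    (hy : W ≤ L.U y) (hz : W ≤ L.U z) :
    res (le_inf hx hy) (L.g x y) * res (le_inf hy hz) (L.g y z) =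
      res (le_inf hx hz) (L.g x z) := by
  have := congrArg (res (le_inf (le_inf hx hy) hz)) (L.cocycle x y z)
  simpa only [map_mul, res_res] using this

lemma LineBundle.g_mul_g (L : LineBundle X) (x y : X) {W : X.Opens} (hx : W ≤ L.U x)
    (hy : W ≤ L.U y) : res (le_inf hx hy) (L.g x y) * res (le_inf hy hx) (L.g y x) = 1 := by
  rw [L.cocycle_res x y x hx hy hx, L.g_self, map_one]

/-- The trivial line bundle `𝒪_X`. -/
def LineBundle.triv (X : Scheme.{u}) : LineBundle X where
  U _ := ⊤
  mem _ := trivial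
  g _ _ := 1
  g_self _ := rfl
  cocycle _ _ _ := by simp only [map_one, mul_one]

/-- The tensor product. -/
def LineBundle.tensor (L L' : LineBundle X) : LineBundle X where
  U x := L.U x ⊓ L'.U x
  mem x := ⟨L.mem x, L'.mem x⟩
  g x y := res (inf_le_inf inf_le_left inf_le_left) (L.g x y) *
    res (inf_le_inf inf_le_right inf_le_right) (L'.g x y)
  g_self x := by rw [L.g_self, L'.g_self, map_one, map_one, one_mul]
  cocycle x y z := by
    simp only [map_mul, res_res]
    rw [mul_mul_mul_comm]
    exact congrArg₂ (· * ·)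
      (L.cocycle_res x y z ((inf_le_left.trans inf_le_left).trans inf_le_left)
        ((inf_le_left.trans inf_le_right).trans inf_le_left) (inf_le_right.trans inf_le_left))
      (L'.cocycle_res x y z ((inf_le_left.trans inf_le_left).trans inf_le_right)
        ((inf_le_left.trans inf_le_right).trans inf_le_right) (inf_le_right.trans inf_le_right))

/-- The dual line bundle. -/
def LineBundle.dual (L : LineBundle X) : LineBundle X where
  U := L.U
  mem := L.mem
  g x y := res (le_inf inf_le_right inf_le_left) (L.g y x)
  g_self x := by rw [L.g_self, map_one]
  cocycle x y z := by
    simp only [res_res]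
    rw [mul_comm]
    exact L.cocycle_res z y x inf_le_right (inf_le_left.trans inf_le_right)
      (inf_le_left.trans inf_le_left)

lemma LineBundle.triv_g_res (x y : X) {W : X.Opens}
    (h : W ≤ (LineBundle.triv X).U x ⊓ (LineBundle.triv X).U y) :
    res h ((LineBundle.triv X).g x y) = 1 :=
  map_one (res h)

lemma LineBundle.tensor_g_res (L L' : LineBundle X) (x y : X) {W : X.Opens}
    (h : W ≤ (L.tensor L').U x ⊓ (L.tensor L').U y) :
    res h ((L.tensor L').g x y) =
      res (h.trans (inf_le_inf inf_le_left inf_le_left)) (L.g x y) *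
        res (h.trans (inf_le_inf inf_le_right inf_le_right)) (L'.g x y) :=
  (map_mul (res h) _ _).trans (congrArg₂ (· * ·) (res_res _ _ _) (res_res _ _ _))

lemma LineBundle.dual_g_res (L : LineBundle X) (x y : X) {W : X.Opens}
    (h : W ≤ L.dual.U x ⊓ L.dual.U y) :
    res h (L.dual.g x y) =
      res (h.trans (le_inf inf_le_right inf_le_left)) (L.g y x) :=
  res_res _ _ _

lemma aux_symm {R : Type*} [CommRing R] {g g' h₁ h₂ k₁ k₂ : R} (hx : h₁ * k₁ = 1)
    (hy : h₂ * k₂ = 1) (c : g * h₁ = h₂ * g') : g' * k₁ = k₂ * g := by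
  linear_combination (-k₁ * k₂) * c + (k₂ * g) * hx - (k₁ * g') * hy

lemma aux_trans {R : Type*} [CommRing R] {g g' g'' h₁ h₂ k₁ k₂ : R} (c : g * h₁ = h₂ * g')
    (c' : g' * k₁ = k₂ * g'') : g * (h₁ * k₁) = h₂ * k₂ * g'' := by
  linear_combination k₁ * c + h₂ * c'

lemma aux_tensor {R : Type*} [CommRing R] {g g' f f' h₁ h₂ k₁ k₂ : R} (c : g * h₁ = h₂ * g')
    (c' : f * k₁ = k₂ * f') : g * f * (h₁ * k₁) = h₂ * k₂ * (g' * f') := by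
  linear_combination f * k₁ * c + h₂ * g' * c'

end LineBundleGroup

/-! ### Metrised line bundles -/

section Metrized

variable {K : Type u} [Field K] [NumberField K] {X : Scheme.{u}}

/-- A line bundle on `X` with, for every place `v` of `K`, a continuous metric on the associated
line bundle on `X_v^an`, the family being invariant by complex conjugation. The metrics are given
by the norms `norm v x y = ‖e x‖_v(y)` of the frames: the norm of a vector `a • e x(y)` of the fibre
at `y` is then `|a|_y * ‖e x‖_v(y)`. (At a finite place, `X_v^an` is the analytic space over `K_v`, so
that a metric is invariant under the Galois group by construction.) -/
structure MetrizedLineBundle (π : X ⟶ Spec (.of K)) extends LineBundle X where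
  norm : ∀ (v : Place K) (x : X) (y : An π v), y.pt ∈ U x → ℝ
  norm_pos : ∀ v x y h, 0 < norm v x y h
  norm_continuous : ∀ v x, Continuous fun y : {y : An π v // y.pt ∈ U x} => norm v x y.1 y.2
  norm_frame : ∀ (v : Place K) (x x' : X) (y : An π v) (h : y.pt ∈ U x) (h' : y.pt ∈ U x'),
    norm v x' y h' = y.absAt (U := U x ⊓ U x') ⟨h, h'⟩ (g x x') * norm v x y h
  norm_conj : ∀ (σ : K →+* ℂ) (x : X) (y : InfPt π σ) (h : y.pt ∈ U x),
    norm (.inf (ComplexEmbedding.conjugate σ)) x (InfPt.conj π y) h = norm (.inf σ) x y h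

namespace MetrizedLineBundle

variable {π : X ⟶ Spec (.of K)}

/-- Isometric isomorphism of metrised line bundles. -/
def Isometric (L L' : MetrizedLineBundle π) : Prop :=
  ∃ φ : LineBundle.Iso L.toLineBundle L'.toLineBundle,
    ∀ (v : Place K) (x : X) (y : An π v) (hy : y.pt ∈ φ.V x),
      L.norm v x y (φ.le x hy) = y.absAt hy (φ.h x) * L'.norm v x y (φ.le' x hy)

/-- The tensor product: `‖e ⊗ e'‖ = ‖e‖ ‖e'‖`. -/
def tensor (L L' : MetrizedLineBundle π) : MetrizedLineBundle π where
  toLineBundle := L.toLineBundle.tensor L'.toLineBundle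
  norm v x y h := L.norm v x y h.1 * L'.norm v x y h.2
  norm_pos v x y h := mul_pos (L.norm_pos _ _ _ _) (L'.norm_pos _ _ _ _)
  norm_continuous v x :=
    ((L.norm_continuous v x).comp
        (continuous_subtype_val.subtype_mk fun y : {y : An π v // y.pt ∈ L.U x ⊓ L'.U x} => y.2.1)).mul
      ((L'.norm_continuous v x).comp
        (continuous_subtype_val.subtype_mk fun y : {y : An π v // y.pt ∈ L.U x ⊓ L'.U x} => y.2.2))
  norm_frame v x x' y h h' := by
    rw [L.norm_frame v x x' y h.1 h'.1, L'.norm_frame v x x' y h.2 h'.2, mul_mul_mul_comm]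
    refine congrArg (· * (L.norm v x y h.1 * L'.norm v x y h.2)) (Eq.symm ?_)
    refine (An.absAt_mul y (U := (L.U x ⊓ L'.U x) ⊓ (L.U x' ⊓ L'.U x')) ⟨h, h'⟩ _ _).trans ?_
    exact congrArg₂ (· * ·) (An.absAt_res y _ _ _) (An.absAt_res y _ _ _)
  norm_conj σ x y h := congrArg₂ (· * ·) (L.norm_conj σ x y h.1) (L'.norm_conj σ x y h.2)

/-- The trivial line bundle with the trivial metrics. -/
def triv (π : X ⟶ Spec (.of K)) : MetrizedLineBundle π where
  toLineBundle := LineBundle.triv X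
  norm _ _ _ _ := 1
  norm_pos _ _ _ _ := one_pos
  norm_continuous _ _ := continuous_const
  norm_frame _ _ _ y h h' :=
    ((mul_one _).trans (An.absAt_one y (U := ⊤ ⊓ ⊤) ⟨h, h'⟩)).symm
  norm_conj _ _ _ _ := rfl

/-- The dual. -/
def dual (L : MetrizedLineBundle π) : MetrizedLineBundle π where
  toLineBundle := L.toLineBundle.dual
  norm v x y h := (L.norm v x y h)⁻¹
  norm_pos v x y h := inv_pos.mpr (L.norm_pos _ _ _ _)
  norm_continuous v x := (L.norm_continuous v x).inv₀ fun y => (L.norm_pos _ _ _ _).ne'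
  norm_frame v x x' y h h' := by
    have h0 := L.norm_frame v x' x y h' h
    have h1 : y.absAt (U := L.U x ⊓ L.U x') ⟨h, h'⟩
        (res (le_inf inf_le_right inf_le_left) (L.g x' x)) =
        y.absAt (U := L.U x' ⊓ L.U x) ⟨h', h⟩ (L.g x' x) := An.absAt_res y _ _ _
    have h2 := (L.norm_pos v x y h).ne'
    have h3 := (L.norm_pos v x' y h').ne'
    change _ = y.absAt (U := L.U x ⊓ L.U x') ⟨h, h'⟩
        (res (le_inf inf_le_right inf_le_left) (L.g x' x)) * _
    rw [h1]
    field_simp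
    rw [mul_comm]
    exact h0
  norm_conj σ x y h := congrArg Inv.inv (L.norm_conj σ x y h)

lemma Isometric.mk' (L L' : MetrizedLineBundle π) (V : X → X.Opens) (mem : ∀ x, x ∈ V x)
    (le : ∀ x, V x ≤ L.U x) (le' : ∀ x, V x ≤ L'.U x) (h : ∀ x, Γ(X, V x))
    (isUnit : ∀ x, IsUnit (h x))
    (comm : ∀ x y, res (V := V x ⊓ V y) (inf_le_inf (le x) (le y)) (L.g x y) *
        res inf_le_left (h x) = res inf_le_right (h y) *
          res (inf_le_inf (le' x) (le' y)) (L'.g x y))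
    (isom : ∀ (v : Place K) (x : X) (y : An π v) (hy : y.pt ∈ V x),
      L.norm v x y (le x hy) = y.absAt hy (h x) * L'.norm v x y (le' x hy)) : Isometric L L' :=
  ⟨⟨V, mem, le, le', h, isUnit, comm⟩, isom⟩

/-- A frame-preserving identification gives an isometry. -/
lemma isometric_of_frames (L L' : MetrizedLineBundle π) (V : X → X.Opens) (mem : ∀ x, x ∈ V x)
    (le : ∀ x, V x ≤ L.U x) (le' : ∀ x, V x ≤ L'.U x)
    (comm : ∀ x y, res (V := V x ⊓ V y) (inf_le_inf (le x) (le y)) (L.g x y) =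
      res (inf_le_inf (le' x) (le' y)) (L'.g x y))
    (isom : ∀ (v : Place K) (x : X) (y : An π v) (hy : y.pt ∈ V x),
      L.norm v x y (le x hy) = L'.norm v x y (le' x hy)) : Isometric L L' :=
  Isometric.mk' L L' V mem le le' (fun _ => 1) (fun _ => isUnit_one)
    (fun x y => by rw [map_one, map_one, mul_one, one_mul, comm])
    fun v x y hy => by rw [An.absAt_one, one_mul, isom _ _ _ hy]

lemma Isometric.refl (L : MetrizedLineBundle π) : Isometric L L :=
  isometric_of_frames L L L.U L.mem (fun _ => le_rfl) (fun _ => le_rfl) (fun _ _ => rfl)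
    fun _ _ _ _ => rfl

lemma Isometric.symm {L L' : MetrizedLineBundle π} (h : Isometric L L') : Isometric L' L := by
  obtain ⟨φ, hφ⟩ := h
  choose k hk using fun x => (φ.isUnit x).exists_right_inv
  refine Isometric.mk' _ _ φ.V φ.mem φ.le' φ.le k
    (fun x => IsUnit.of_mul_eq_one_right _ (hk x)) (fun x y => ?_) fun v x y hy => ?_
  · have hx := congrArg (res (V := φ.V x ⊓ φ.V y) inf_le_left) (hk x)
    have hy := congrArg (res (V := φ.V x ⊓ φ.V y) inf_le_right) (hk y)
    rw [map_mul, map_one] at hx hy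
    exact aux_symm hx hy (φ.comm x y)
  · have h1 := congrArg (y.absAt hy) (hk x)
    rw [An.absAt_mul, An.absAt_one] at h1
    rw [hφ v x y hy, ← mul_assoc, mul_comm (y.absAt hy (k x)), h1, one_mul]

/-- Restriction to a smaller open set of the compatibility of an isomorphism with transition
functions. -/
lemma comm_res {L L' : LineBundle X} (φ : LineBundle.Iso L L') (x y : X) {W : X.Opens}
    (hx : W ≤ φ.V x) (hy : W ≤ φ.V y) :
    res (le_inf (hx.trans (φ.le x)) (hy.trans (φ.le y))) (L.g x y) * res hx (φ.h x) =
      res hy (φ.h y) * res (le_inf (hx.trans (φ.le' x)) (hy.trans (φ.le' y))) (L'.g x y) := by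
  have := congrArg (res (le_inf hx hy)) (φ.comm x y)
  rw [map_mul, map_mul, res_res, res_res, res_res, res_res] at this
  exact this

lemma Isometric.trans {L L' L'' : MetrizedLineBundle π} (h : Isometric L L')
    (h' : Isometric L' L'') : Isometric L L'' := by
  obtain ⟨φ, hφ⟩ := h
  obtain ⟨ψ, hψ⟩ := h'
  refine Isometric.mk' _ _ (fun x => φ.V x ⊓ ψ.V x) (fun x => ⟨φ.mem x, ψ.mem x⟩)
    (fun x => inf_le_left.trans (φ.le x)) (fun x => inf_le_right.trans (ψ.le' x))
    (fun x => res inf_le_left (φ.h x) * res inf_le_right (ψ.h x))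
    (fun x => ((φ.isUnit x).map _).mul ((ψ.isUnit x).map _)) (fun x y => ?_) fun v x y hy => ?_
  · rw [map_mul, map_mul, res_res, res_res, res_res, res_res]
    exact aux_trans (comm_res φ x y _ _) (comm_res ψ x y _ _)
  · rw [hφ v x y hy.1, hψ v x y hy.2, An.absAt_mul, An.absAt_res, An.absAt_res, mul_assoc]

lemma Isometric.tensor {L L' M M' : MetrizedLineBundle π} (h : Isometric L L')
    (h' : Isometric M M') : Isometric (L.tensor M) (L'.tensor M') := by
  obtain ⟨φ, hφ⟩ := h
  obtain ⟨ψ, hψ⟩ := h'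
  refine Isometric.mk' _ _ (fun x => φ.V x ⊓ ψ.V x) (fun x => ⟨φ.mem x, ψ.mem x⟩)
    (fun x => inf_le_inf (φ.le x) (ψ.le x)) (fun x => inf_le_inf (φ.le' x) (ψ.le' x))
    (fun x => res inf_le_left (φ.h x) * res inf_le_right (ψ.h x))
    (fun x => ((φ.isUnit x).map _).mul ((ψ.isUnit x).map _)) (fun x y => ?_) fun v x y hy => ?_
  · rw [map_mul, map_mul, res_res, res_res, res_res, res_res]
    refine (congrArg (· * _) (LineBundle.tensor_g_res _ _ x y _)).trans
      (Eq.trans ?_ (congrArg (_ * ·) (LineBundle.tensor_g_res _ _ x y _).symm))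
    exact aux_tensor (comm_res φ x y _ _) (comm_res ψ x y _ _)
  · change L.norm v x y _ * M.norm v x y _ = _ * (L'.norm v x y _ * M'.norm v x y _)
    rw [hφ v x y hy.1, hψ v x y hy.2, An.absAt_mul, An.absAt_res, An.absAt_res]
    ring

lemma Isometric.dual {L L' : MetrizedLineBundle π} (h : Isometric L L') :
    Isometric L.dual L'.dual := by
  obtain ⟨φ, hφ⟩ := h.symm
  refine Isometric.mk' _ _ φ.V φ.mem φ.le' φ.le φ.h φ.isUnit (fun x y => ?_) fun v x y hy => ?_
  · refine (congrArg (· * _) (LineBundle.dual_g_res _ x y _)).trans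
      (Eq.trans ?_ (congrArg (_ * ·) (LineBundle.dual_g_res _ x y _).symm))
    exact (mul_comm _ _).trans ((comm_res φ y x inf_le_right inf_le_left).symm.trans
      (mul_comm _ _))
  · change (L.norm v x y _)⁻¹ = _ * (L'.norm v x y _)⁻¹
    have h1 := hφ v x y hy
    have h2 := (L.norm_pos v x y (φ.le' x hy)).ne'
    have h3 := (L'.norm_pos v x y (φ.le x hy)).ne'
    field_simp
    linarith

instance setoid (π : X ⟶ Spec (.of K)) : Setoid (MetrizedLineBundle π) where
  r := Isometric
  iseqv := ⟨Isometric.refl, Isometric.symm, Isometric.trans⟩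

end MetrizedLineBundle

/-- The group (noted additively) of isometry classes of metrised line bundles on `X`, for the
tensor product. -/
def MetPic (π : X ⟶ Spec (.of K)) : Type u := Quotient (MetrizedLineBundle.setoid π)

/-- The isometry class of a metrised line bundle. -/
def MetrizedLineBundle.cls {π : X ⟶ Spec (.of K)} (L : MetrizedLineBundle π) : MetPic π :=
  Quotient.mk _ L

namespace MetPic

open MetrizedLineBundle

variable (π : X ⟶ Spec (.of K))

instance : Add (MetPic π) := ⟨Quotient.map₂ tensor fun _ _ h _ _ h' => h.tensor h'⟩

instance : Zero (MetPic π) := ⟨(triv π).cls⟩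

instance : Neg (MetPic π) := ⟨Quotient.map dual fun _ _ h => h.dual⟩

instance : AddCommGroup (MetPic π) where
  nsmul := nsmulRec
  zsmul := zsmulRec
  add_assoc := by
    rintro ⟨L⟩ ⟨M⟩ ⟨N⟩
    refine Quotient.sound (isometric_of_frames ((L.tensor M).tensor N) (L.tensor (M.tensor N))
      ((L.tensor M).tensor N).U ((L.tensor M).tensor N).mem (fun _ => le_rfl)
      (fun _ => inf_assoc _ _ _ |>.le) (fun x y => ?_) fun v x y hy => mul_assoc _ _ _)
    refine (LineBundle.tensor_g_res _ _ x y _).trans (Eq.trans ?_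
      (LineBundle.tensor_g_res _ _ x y _).symm)
    refine (congrArg (· * _) (LineBundle.tensor_g_res _ _ x y _)).trans
      (Eq.trans ?_ (congrArg (_ * ·) (LineBundle.tensor_g_res _ _ x y _).symm))
    exact mul_assoc _ _ _
  zero_add := by
    rintro ⟨L⟩
    refine Quotient.sound (isometric_of_frames ((triv π).tensor L) L
      ((triv π).tensor L).U ((triv π).tensor L).mem (fun _ => le_rfl)
      (fun _ => inf_le_right) (fun x y => ?_) fun v x y hy => one_mul _)
    refine (LineBundle.tensor_g_res _ _ x y _).trans ?_
    exact (congrArg (· * _) (LineBundle.triv_g_res x y _)).trans (one_mul _)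
  add_zero := by
    rintro ⟨L⟩
    refine Quotient.sound (isometric_of_frames (L.tensor (triv π)) L
      (L.tensor (triv π)).U (L.tensor (triv π)).mem (fun _ => le_rfl)
      (fun _ => inf_le_left) (fun x y => ?_) fun v x y hy => mul_one _)
    refine (LineBundle.tensor_g_res _ _ x y _).trans ?_
    exact (congrArg (_ * ·) (LineBundle.triv_g_res x y _)).trans (mul_one _)
  neg_add_cancel := by
    rintro ⟨L⟩
    refine Quotient.sound (isometric_of_frames (L.dual.tensor L) (triv π)
      (L.dual.tensor L).U (L.dual.tensor L).mem (fun _ => le_rfl)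
      (fun _ => le_top) (fun x y => ?_) fun v x y hy =>
        inv_mul_cancel₀ (L.norm_pos v x y hy.1).ne')
    refine (LineBundle.tensor_g_res _ _ x y _).trans (Eq.trans ?_
      (LineBundle.triv_g_res x y _).symm)
    refine (congrArg (· * _) (LineBundle.dual_g_res _ x y _)).trans ?_
    exact L.g_mul_g y x (inf_le_right.trans inf_le_left) (inf_le_left.trans inf_le_left)
  add_comm := by
    rintro ⟨L⟩ ⟨M⟩
    refine Quotient.sound (isometric_of_frames (L.tensor M) (M.tensor L)
      (L.tensor M).U (L.tensor M).mem (fun _ => le_rfl)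
      (fun _ => inf_comm _ _ |>.le) (fun x y => ?_) fun v x y hy => mul_comm _ _)
    refine (LineBundle.tensor_g_res _ _ x y _).trans (Eq.trans ?_
      (LineBundle.tensor_g_res _ _ x y _).symm)
    exact mul_comm _ _

end MetPic

end Metrized

/-! ### The subgroup `C_v(X)` -/

section Directions

variable {K : Type u} [Field K] [NumberField K] {X : Scheme.{u}} (π : X ⟶ Spec (.of K))

/-- The norm of the section `1` of `𝒪_v(f)` at the place `w`: it is `(#𝔽_𝔭) ^ (-f)` at `v` if `v = 𝔭`
is finite, `exp (-f)` at `v` if `v = σ` is an embedding (and the conjugate function at `σ̄`), and `1`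
at the other places. -/
def normOne : (v : Place K) → (An π v → ℝ) → (w : Place K) → An π w → ℝ
  | .fin 𝔭, f, .fin 𝔮, y =>
      open Classical in
      if h : 𝔮 = 𝔭 then (Nat.card (𝓞 K ⧸ 𝔭.asIdeal) : ℝ) ^ (-f (FinPt.cast π h y)) else 1
  | .inf σ, f, .inf τ, y =>
      open Classical in
      if h : τ = σ then Real.exp (-f (InfPt.cast π h y))
      else if h : ComplexEmbedding.conjugate τ = σ then
        Real.exp (-f (InfPt.cast π h (InfPt.conj π y)))
      else 1
  | .fin _, _, .inf _, _ => 1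
  | .inf _, _, .fin _, _ => 1

/-- Invariance of a function on `X_v^an` under complex conjugation, if `v` is a real embedding
(there is no condition at the other places). -/
def IsConjInvariant : (v : Place K) → (An π v → ℝ) → Prop
  | .fin _, _ => True
  | .inf σ, f => ∀ (h : ComplexEmbedding.conjugate σ = σ) (y : InfPt π σ),
      f (InfPt.cast π h (InfPt.conj π y)) = f y

/-- The continuous real functions `f` on `X_v^an` that define a line bundle `𝒪_v(f)`: those which are
invariant under complex conjugation, if `v` is a real embedding, and all of them otherwise. -/
def invariantFunctions (v : Place K) : AddSubgroup C(An π v, ℝ) where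
  carrier := {f | IsConjInvariant π v f}
  add_mem' {f g} hf hg := by
    cases v
    · trivial
    · exact fun h y => congrArg₂ (· + ·) (hf h y) (hg h y)
  zero_mem' := by
    cases v
    · trivial
    · exact fun h y => rfl
  neg_mem' {f} hf := by
    cases v
    · trivial
    · exact fun h y => congrArg Neg.neg (hf h y)

lemma normOne_pos (v : Place K) (f : An π v → ℝ) (w : Place K) (y : An π w) :
    0 < normOne π v f w y := by
  cases v <;> cases w <;> simp only [normOne]
  · split_ifs
    · refine Real.rpow_pos_of_pos (Nat.cast_pos.mpr ?_) _
      rename_i 𝔭 _ _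
      have : Finite (𝓞 K ⧸ 𝔭.asIdeal) := 𝔭.asIdeal.finiteQuotientOfFreeOfNeBot 𝔭.ne_bot
      exact Nat.card_pos
    · exact one_pos
  · exact one_pos
  · exact one_pos
  · split_ifs <;> positivity

lemma continuous_conj (σ : K →+* ℂ) : Continuous (InfPt.conj π : InfPt π σ → _) := by
  refine continuous_generateFrom_iff.mpr ?_
  rintro s ⟨U, f, W, hW, rfl⟩
  refine TopologicalSpace.isOpen_generateFrom_of_mem
    ⟨U, f, (starRingEnd ℂ) ⁻¹' W, hW.preimage Complex.continuous_conj, rfl⟩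

lemma continuous_normOne (v : Place K) (f : C(An π v, ℝ)) (w : Place K) :
    Continuous (normOne π v f w) := by
  rcases v with 𝔭 | σ <;> rcases w with 𝔮 | τ
  · by_cases h : 𝔮 = 𝔭
    · subst h
      have : normOne π (.fin 𝔮) f (.fin 𝔮) =
          fun y => (Nat.card (𝓞 K ⧸ 𝔮.asIdeal) : ℝ) ^ (-f y) := by
        funext y
        simp only [normOne, dif_pos]
        rfl
      rw [this]
      have : Finite (𝓞 K ⧸ 𝔮.asIdeal) := 𝔮.asIdeal.finiteQuotientOfFreeOfNeBot 𝔮.ne_bot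
      exact (continuous_const).rpow f.continuous.neg
        fun y => Or.inl (Nat.cast_ne_zero.mpr Nat.card_pos.ne')
    · have : normOne π (.fin 𝔭) f (.fin 𝔮) = fun _ => 1 := by
        funext y
        simp only [normOne, dif_neg h]
      rw [this]
      exact continuous_const
  · exact continuous_const
  · exact continuous_const
  · by_cases h : τ = σ
    · subst h
      have : normOne π (.inf τ) f (.inf τ) = fun y => Real.exp (-f y) := by
        funext y
        simp only [normOne, dif_pos]
        rfl
      rw [this]
      exact Real.continuous_exp.comp f.continuous.neg
    · by_cases h' : ComplexEmbedding.conjugate τ = σ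
      · subst h'
        have : normOne π (.inf (ComplexEmbedding.conjugate τ)) f (.inf τ) =
            fun y => Real.exp (-f (InfPt.conj π y)) := by
          funext y
          simp only [normOne, dif_neg h, dif_pos]
          rfl
        rw [this]
        exact Real.continuous_exp.comp (f.continuous.comp (continuous_conj π τ)).neg
      · have : normOne π (.inf σ) f (.inf τ) = fun _ => 1 := by
          funext y
          simp only [normOne, dif_neg h, dif_neg h']
        rw [this]
        exact continuous_const

lemma normOne_conj (v : Place K) (f : invariantFunctions π v) (τ : K →+* ℂ) (y : InfPt π τ) :
    normOne π v f.1 (.inf (ComplexEmbedding.conjugate τ)) (InfPt.conj π y) =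
      normOne π v f.1 (.inf τ) y := by
  have hcc : ∀ z : InfPt π τ, ∀ h, InfPt.cast π h (InfPt.conj π (InfPt.conj π z)) = z := by
    intro z h
    have : (starRingEnd ℂ).comp ((starRingEnd ℂ).comp z.emb) = z.emb := by
      ext a; simp
    cases z
    simp only [InfPt.cast, InfPt.conj] at this ⊢
    congr
  rcases v with 𝔭 | σ
  · rfl
  · have hf : IsConjInvariant π (.inf σ) f.1 := f.2
    simp only [normOne]
    by_cases h : τ = σ
    · subst h
      by_cases h' : ComplexEmbedding.conjugate τ = τ
      · rw [dif_pos h', dif_pos rfl, hf h' y]; rfl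
      · have h2 : ComplexEmbedding.conjugate (ComplexEmbedding.conjugate τ) = τ := by
          ext a; simp
        rw [dif_neg h', dif_pos h2, dif_pos rfl, hcc]; rfl
    · by_cases h' : ComplexEmbedding.conjugate τ = σ
      · rw [dif_pos h', dif_neg h, dif_pos h']
      · have h2 : ComplexEmbedding.conjugate (ComplexEmbedding.conjugate τ) = τ := by
          ext a; simp
        rw [dif_neg h', dif_neg h, dif_neg h', dif_neg (by rw [h2]; exact h)]

/-- The metrised line bundle `𝒪_v(f)`. -/
def trivTwist (v : Place K) (f : invariantFunctions π v) : MetrizedLineBundle π where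
  toLineBundle := LineBundle.triv X
  norm w _ y _ := normOne π v f.1 w y
  norm_pos w _ y _ := normOne_pos π v f.1 w y
  norm_continuous w _ := (continuous_normOne π v f.1 w).comp continuous_subtype_val
  norm_frame _ _ _ y h h' :=
    ((congrArg (· * _) (An.absAt_one y (U := ⊤ ⊓ ⊤) ⟨h, h'⟩)).trans (one_mul _)).symm
  norm_conj σ _ y _ := normOne_conj π v f σ y

lemma normOne_add (v : Place K) (f g : An π v → ℝ) (w : Place K) (y : An π w) :
    normOne π v (f + g) w y = normOne π v f w y * normOne π v g w y := by
  rcases v with 𝔭 | σ <;> rcases w with 𝔮 | τ <;> simp only [normOne, mul_one]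
  · split_ifs with h
    · have : Finite (𝓞 K ⧸ 𝔭.asIdeal) := 𝔭.asIdeal.finiteQuotientOfFreeOfNeBot 𝔭.ne_bot
      rw [← Real.rpow_add (Nat.cast_pos.mpr Nat.card_pos)]
      congr 1
      exact neg_add _ _
    · exact (mul_one _).symm
  · split_ifs with h h'
    · rw [← Real.exp_add]
      congr 1
      exact neg_add _ _
    · rw [← Real.exp_add]
      congr 1
      exact neg_add _ _
    · exact (mul_one _).symm

/-- The homomorphism `f ↦ 𝒪_v(f)`. -/
def twistHom (v : Place K) : invariantFunctions π v →+ MetPic π :=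
  AddMonoidHom.mk' (fun f => (trivTwist π v f).cls) fun f g => by
    refine Quotient.sound (MetrizedLineBundle.isometric_of_frames (trivTwist π v (f + g))
      ((trivTwist π v f).tensor (trivTwist π v g)) (fun _ => ⊤) (fun _ => trivial)
      (fun _ => le_rfl) (fun _ => le_inf le_top le_top) (fun x y => ?_)
      fun w x y hy => normOne_add π v f.1 g.1 w y)
    refine (LineBundle.triv_g_res x y _).trans (Eq.trans ?_
      (LineBundle.tensor_g_res _ _ x y _).symm)
    exact (mul_one (1 : Γ(X, ⊤ ⊓ ⊤))).symm.trans (congrArg₂ (· * ·)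
      (LineBundle.triv_g_res x y _).symm (LineBundle.triv_g_res x y _).symm)

/-- The group `C_v(X)` of the classes of the `𝒪_v(f)`. -/
def directions (v : Place K) : AddSubgroup (MetPic π) := (twistHom π v).range

end Directions

/-! ### Adelic line bundles -/

section AdelicLineBundle

variable {K : Type u} [Field K] [NumberField K] {X : Scheme.{u}} {π : X ⟶ Spec (.of K)}

/-- Let `i : X ⟶ 𝒳`, let `ℒ` be a line bundle on `𝒳` and `φ` an isomorphism from `i^* ℒ` to `L`.
This is the norm, at a point `y` of `X_v^an`, of the frame of `ℒ` at the point `z` of `𝒳`, viewed by `φ`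
as a local frame of `L`. -/
def MetrizedLineBundle.modelNorm (L : MetrizedLineBundle π) {𝒳 : Scheme.{u}} {i : X ⟶ 𝒳}
    {ℒ : LineBundle 𝒳} (φ : LineBundle.Iso (ℒ.pullback i) L.toLineBundle) {v : Place K}
    (y : An π v) (z : 𝒳) (hz : i y.pt ∈ ℒ.U z) : ℝ :=
  y.absAt (U := i ⁻¹ᵁ (ℒ.U (i y.pt) ⊓ ℒ.U z)) ⟨ℒ.mem _, hz⟩ (i.app _ (ℒ.g (i y.pt) z)) *
    (y.absAt (φ.mem y.pt) (φ.h y.pt) * L.norm v y.pt y (L.mem y.pt))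

/-- The metric of `L` at `𝔭` is induced by the model `(𝒳, ℒ)`: whenever a point `y` of `X_𝔭^an`, with
valuation ring `R ⊆ κ(y.pt)`, extends to `r : Spec R ⟶ 𝒳`, the local frames of `ℒ` which are defined at
the reduction of `y` (the image by `r` of the closed point) have norm `1` at `y`. In other words the
unit ball of the fibre of `L` at `y` is the lattice `r^* ℒ`. -/
def MetrizedLineBundle.IsInducedAt (L : MetrizedLineBundle π) {𝒳 : Scheme.{u}} {i : X ⟶ 𝒳}
    {ℒ : LineBundle 𝒳} (φ : LineBundle.Iso (ℒ.pullback i) L.toLineBundle)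
    (𝔭 : HeightOneSpectrum (𝓞 K)) : Prop :=
  ∀ (y : FinPt π 𝔭) (r : Spec (.of y.val.valuationSubring) ⟶ 𝒳),
    Spec.map (CommRingCat.ofHom y.val.valuationSubring.subtype) ≫ r =
        X.fromSpecResidueField y.pt ≫ i →
      ∀ (z : 𝒳) (hz : i y.pt ∈ ℒ.U z),
        r (IsLocalRing.closedPoint y.val.valuationSubring) ∈ ℒ.U z →
          L.modelNorm (v := .fin 𝔭) φ y z hz = 1

/-- A metrised line bundle is adelic if there are a non-empty open subscheme `Z` of `Spec 𝓞_K`, and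
a model `(𝒳, ℒ)` of `(X, L)`, projective and flat over `Z`, which induces the metrics at all the finite
places in `Z`. -/
def MetrizedLineBundle.IsAdelic (L : MetrizedLineBundle π) : Prop :=
  ∃ (Z : (Spec (.of (𝓞 K))).Opens) (𝒳 : Scheme.{u}) (p : 𝒳 ⟶ Z) (i : X ⟶ 𝒳) (ℒ : LineBundle 𝒳)
    (φ : LineBundle.Iso (ℒ.pullback i) L.toLineBundle),
    (Z : Set (Spec (.of (𝓞 K)))).Nonempty ∧ IsProjective p ∧ Flat p ∧
      IsPullback i π (p ≫ Z.ι) (Spec.map (CommRingCat.ofHom (algebraMap (𝓞 K) K))) ∧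
      ∀ 𝔭 : HeightOneSpectrum (𝓞 K),
        (⟨𝔭.asIdeal, 𝔭.isPrime⟩ : PrimeSpectrum (𝓞 K)) ∈ Z → L.IsInducedAt φ 𝔭

variable (π) in
/-- The set of the isometry classes of adelic line bundles on `X`. -/
def adelicPic : Set (MetPic π) := {c | ∃ L : MetrizedLineBundle π, L.cls = c ∧ L.IsAdelic}

end AdelicLineBundle

/-! ### Algebraic points, heights and measures -/

section Heights

variable {K : Type u} [Field K] [NumberField K] {X : Scheme.{u}} (π : X ⟶ Spec (.of K))

/-- The algebraic points of `X`, that is, the elements of `X(K̄)`. -/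
def AlgPoint : Type u :=
  {x : Spec (.of (AlgebraicClosure K)) ⟶ X //
    x ≫ π = Spec.map (CommRingCat.ofHom (algebraMap K (AlgebraicClosure K)))}

variable {π}

/-- The (closed) point of `X` under an algebraic point `x`; its residue field is `K(x)`. -/
def AlgPoint.pt (x : AlgPoint π) : X := x.1 (IsLocalRing.closedPoint (AlgebraicClosure K))

/-- The degree `[K(x) : K]`. -/
def AlgPoint.degree (x : AlgPoint π) : ℕ :=
  letI := (baseHom π x.pt).toAlgebra
  Module.finrank K (X.residueField x.pt)

/-- The set of the `K`-embeddings of `K(x)` in `ℂ_v`: the algebraic closure of `K_v` if `v` is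
finite (the images lie in it, so that its completion gives the same set), and `ℂ` if `v` is an
embedding of `K` in `ℂ`. -/
def AlgPoint.Emb (x : AlgPoint π) : Place K → Type u
  | .fin 𝔭 => {τ : X.residueField x.pt →+* LocalClosure 𝔭 //
      τ.comp (baseHom π x.pt) = toLocalClosure 𝔭}
  | .inf σ => {τ : X.residueField x.pt →+* ℂ // τ.comp (baseHom π x.pt) = σ}

/-- The point `τ(x)` of `X_v^an` defined by an embedding `τ` of `K(x)` in `ℂ_v`. -/
def AlgPoint.conjugate (x : AlgPoint π) : {v : Place K} → x.Emb v → An π v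
  | .fin 𝔭, τ => show FinPt π 𝔭 from
      { pt := x.pt
        val := NormedField.valuation.comap τ.1
        val_base := fun a => (congrArg nnnorm (DFunLike.congr_fun τ.2 a)).trans
          (nnnorm_toLocalClosure 𝔭 a) }
  | .inf σ, τ => show InfPt π σ from { pt := x.pt, emb := τ.1, emb_base := τ.2 }

lemma AlgPoint.conjugate_pt (x : AlgPoint π) {v : Place K} (τ : x.Emb v) :
    (x.conjugate τ).pt = x.pt := by
  cases v <;> rfl

/-- The probability measure `η_{x,v} = [K(x) : K]⁻¹ ∑_τ δ_{τ(x)}` on `X_v^an`, where `τ` runs over the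
embeddings of `K(x)` in `ℂ_v`. -/
def AlgPoint.eta (x : AlgPoint π) (v : Place K) : Measure (An π v) :=
  ((x.degree : ℝ≥0∞)⁻¹) • Measure.sum fun τ : x.Emb v => Measure.dirac (x.conjugate τ)

/-- The height `h_L(x)`, i.e. the normalised Arakelov degree of `x^* L`:
`h_L(x) = - [K(x) : ℚ]⁻¹ ∑_v n_v ∑_τ log ‖s‖_v(τ(x))`, where `τ` runs over the embeddings of `K(x)` in
`ℂ_v`. Here `s` is any non-zero vector of the fibre of `L` at `x` (by the product formula, the
choice does not matter), and it is the value at `x` of the frame of `L` at `x`. -/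
def MetrizedLineBundle.height (L : MetrizedLineBundle π) (x : AlgPoint π) : ℝ :=
  -((Module.finrank ℚ K * x.degree : ℕ) : ℝ)⁻¹ *
    ∑ᶠ v : Place K, (v.n : ℝ) * ∑ᶠ τ : x.Emb v,
      Real.log (L.norm v x.pt (x.conjugate τ) (by rw [x.conjugate_pt]; exact L.mem _))

/-- The height with respect to an isometry class: the height with respect to any representative
(isometric line bundles have the same heights). -/
def MetPic.height (c : MetPic π) (x : AlgPoint π) : ℝ :=
  MetrizedLineBundle.height (Quotient.out c) x

/-- The function `φ_x(L) = liminf h_L(x_n)`, with values in `ℝ ∪ {±∞}`. -/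
def liminfHeight (x : ℕ → AlgPoint π) (c : MetPic π) : EReal :=
  liminf (fun n => ((c.height (x n) : ℝ) : EReal)) atTop

/-- The equidistribution condition at `v`: the sequence of measures `η_{x_n,v}` converges weakly, to
some probability measure on `X_v^an`. -/
def IsEquidistributed (x : ℕ → AlgPoint π) (v : Place K) : Prop :=
  ∃ μ : Measure (An π v), IsProbabilityMeasure μ ∧
    ∀ f : C(An π v, ℝ),
      Tendsto (fun n => ∫ y, f y ∂((x n).eta v)) atTop (𝓝 (∫ y, f y ∂μ))

end Heights

/-! ### Differentiability on a semigroup -/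

section Differentiability

variable {G : Type u} [AddCommGroup G]

/-- The semigroup `C` is open with respect to the subgroup `H`. -/
def IsOpenRel (C : AddSubsemigroup G) (H : AddSubgroup G) : Prop :=
  ∀ x ∈ C, ∀ w ∈ H, ∃ n : ℕ, 1 ≤ n ∧ n • x + w ∈ C

/-- Let `H` be a subgroup of `G`, let `C` be a semigroup in `G` that is open with respect to `H`, and
let `f` be a positively homogeneous real function on `C`. The function `f` is differentiable at
`x ∈ C` in the directions of `H` if, for all `w ∈ H`, the sequence `f (n x + w) - f (n x)` converges in
`ℝ`, and if its limit is an additive function of `w`. (Only the values of `f` on `C` matter, since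
`n x + w` belongs to `C` for `n` large.) -/
structure IsDifferentiableAt (C : AddSubsemigroup G) (H : AddSubgroup G) (f : G → ℝ) (x : G) :
    Prop where
  isOpenRel : IsOpenRel C H
  posHomogeneous : ∀ c ∈ C, ∀ n : ℕ, 1 ≤ n → f (n • c) = n * f c
  mem : x ∈ C
  exists_differential : ∃ D : G → ℝ,
    (∀ w ∈ H, Tendsto (fun n : ℕ => f (n • x + w) - f (n • x)) atTop (𝓝 (D w))) ∧
      ∀ u ∈ H, ∀ w ∈ H, D (u + w) = D u + D w

/-- The semigroup `{n L + M | n ≥ 1, M ∈ H}`; for `H = C_v(X)` this is `C_v(X, L)`. -/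
def semigroupAt (H : AddSubgroup G) (L : G) : AddSubsemigroup G where
  carrier := {c | ∃ n : ℕ, 1 ≤ n ∧ ∃ M ∈ H, c = n • L + M}
  add_mem' := by
    rintro _ _ ⟨n, hn, M, hM, rfl⟩ ⟨m, hm, N, hN, rfl⟩
    exact ⟨n + m, by omega, M + N, H.add_mem hM hN, by rw [add_smul]; abel⟩

end Differentiability

end Arakelov

end

open Arakelov

/-! The height at a fixed algebraic point is an additive function of the adelic line bundle, and on
the directions `𝒪_v(f)` it is integration: the height of `𝒪_v(f)` at `x` is `C * ∫ f dη_{x,v}`, with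
a constant `C > 0` that depends only on `v` and `K` (`exists_height_twistHom`). Everything else
concerns a sequence of additive forms `a k` and a subgroup `H` of directions on which they are
integrals.

If the measures converge, `a k` converges on `H` to some `D`. A convergent summand comes out of a
lower limit, so `φ (m L + w) = m φ(L) + D w`, and the differences `φ (m L + w) - φ (m L)` are equal
to `D w` for all `m ≥ 1` (`isDifferentiableAt_of_tendsto`). Conversely, if `a k L` converges, the
same remark applied to `L` shows that the differential at `w` is `liminf a k w`. Its additivity
gives `liminf a k (-w) = -liminf a k w`, which says that the upper and lower limits of `a k w` agree
(`tendsto_of_isDifferentiableAt`). Thus the integrals of all invariant functions converge, hence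
those of all continuous functions, after averaging over conjugation at a real place. The Riesz
representation theorem gives the limit measure (`exists_weak_limit`).

Two facts need work. The Riesz argument requires `X_v^an` to be compact and Hausdorff
(`compactSpace_An`, `t2Space_An`); this is proved with ultrafilters on the standard charts of
projective space. The additivity of heights and their invariance under isometry require that only
finitely many places contribute, since a `finsum` with infinite support is `0`. For adelic line
bundles this comes from the integral model (`IsAdelic.hasFiniteSupport`), and the invariance from
the product formula (`finsum_n_mul_log_abs`). -/

namespace Arakelov

/-! ### Lower limits of sequences of additive forms, and differentiability. -/

section Analysis

/-- The lower limit of a sum lies between the sum of the lower limits and the sum of one upper and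
one lower limit; for a convergent summand the two bounds coincide. Since `b` is real, no `∞ - ∞` can
occur. -/
lemma liminf_add_of_tendsto {u v : ℕ → ℝ} {b : ℝ} (hv : Tendsto v atTop (𝓝 b)) :
    liminf (fun n => ((u n + v n : ℝ) : EReal)) atTop =
      liminf (fun n => (u n : EReal)) atTop + (b : EReal) := by
  have hv' : Tendsto (fun n => (v n : EReal)) atTop (𝓝 (b : EReal)) :=
    EReal.tendsto_coe.mpr hv
  have e : (fun n => ((u n + v n : ℝ) : EReal)) =
      (fun n => (u n : EReal)) + fun n => (v n : EReal) := by
    funext n; exact EReal.coe_add _ _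
  rw [e]
  apply le_antisymm
  · have := EReal.liminf_add_le (f := atTop) (u := fun n => (v n : EReal))
      (v := fun n => (u n : EReal)) (Or.inl (by rw [hv'.limsup_eq]; exact EReal.coe_ne_bot _))
      (Or.inl (by rw [hv'.limsup_eq]; exact EReal.coe_ne_top _))
    rw [hv'.limsup_eq] at this
    rwa [add_comm, add_comm _ (b : EReal)]
  · have := EReal.le_liminf_add (f := atTop) (u := fun n => (u n : EReal))
      (v := fun n => (v n : EReal))
    rwa [hv'.liminf_eq] at this

/-- Multiplication by a positive real is monotone and continuous on `EReal`, infinite values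
included, so it commutes with lower limits. -/
lemma liminf_natCast_mul (u : ℕ → ℝ) {m : ℕ} (hm : 1 ≤ m) :
    liminf (fun n => ((m * u n : ℝ) : EReal)) atTop =
      (m : ℝ) * liminf (fun n => (u n : EReal)) atTop := by
  have hm' : (0 : ℝ) < m := by exact_mod_cast hm
  have hmono : Monotone fun y : EReal => ((m : ℝ) : EReal) * y := fun a b h =>
    mul_le_mul_of_nonneg_left h (by exact_mod_cast hm'.le)
  have hc : Continuous fun y : EReal => ((m : ℝ) : EReal) * y := by
    refine continuous_iff_continuousAt.mpr fun y => ?_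
    exact (EReal.continuousAt_mul (p := (((m : ℝ) : EReal), y))
      (Or.inl (EReal.coe_pos.mpr hm').ne') (Or.inl (EReal.coe_pos.mpr hm').ne')
      (Or.inl (EReal.coe_ne_bot _)) (Or.inl (EReal.coe_ne_top _))).comp
      (Continuous.prodMk_right _).continuousAt
  have := hmono.map_liminf_of_continuousAt (F := (atTop : Filter ℕ)) (fun n => (u n : EReal))
    hc.continuousAt
  rw [this]
  congr 1

variable {G : Type u} [AddCommGroup G]

lemma isOpenRel_semigroupAt (H : AddSubgroup G) (L : G) : IsOpenRel (semigroupAt H L) H := by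
  rintro _ ⟨n, hn, M, hM, rfl⟩ w hw
  exact ⟨1, le_rfl, n, hn, M + w, H.add_mem hM hw, by rw [one_smul, add_assoc]⟩

lemma mem_semigroupAt_self (H : AddSubgroup G) (L : G) : L ∈ semigroupAt H L :=
  ⟨1, le_rfl, 0, H.zero_mem, by simp⟩

/-- If the linear forms `a k` converge on `H`, then `liminf a k` is differentiable in the directions
of `H`. -/
lemma isDifferentiableAt_of_tendsto {S H : AddSubgroup G} (hHS : H ≤ S) {a : ℕ → G → ℝ}
    (a' : ℕ → S →+ ℝ) (ha : ∀ k (c : S), a k c = a' k c) {L : G} (hL : L ∈ S)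
    (hH : ∀ w ∈ H, ∃ ℓ : ℝ, Tendsto (fun k => a k w) atTop (𝓝 ℓ))
    (htop : liminf (fun k => (a k L : EReal)) atTop ≠ ⊤)
    (hbot : liminf (fun k => (a k L : EReal)) atTop ≠ ⊥) :
    (∀ c ∈ semigroupAt H L, liminf (fun k => (a k c : EReal)) atTop ≠ ⊤ ∧
      liminf (fun k => (a k c : EReal)) atTop ≠ ⊥) ∧
    IsDifferentiableAt (semigroupAt H L) H
      (fun c => (liminf (fun k => (a k c : EReal)) atTop).toReal) L := by
  choose! D hD using hH
  obtain ⟨ℓ, hℓ⟩ : ∃ ℓ : ℝ, liminf (fun k => (a k L : EReal)) atTop = ℓ :=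
    ⟨_, (EReal.coe_toReal htop hbot).symm⟩
  have hadd : ∀ c ∈ S, ∀ d ∈ S, ∀ k, a k (c + d) = a k c + a k d := fun c hc d hd k =>
    (ha k (⟨c, hc⟩ + ⟨d, hd⟩)).trans ((map_add _ _ _).trans
      (congrArg₂ (· + ·) (ha k ⟨c, hc⟩).symm (ha k ⟨d, hd⟩).symm))
  have hsmul : ∀ c ∈ S, ∀ (m k : ℕ), a k (m • c) = m * a k c := fun c hc m k =>
    (ha k (m • ⟨c, hc⟩)).trans ((map_nsmul _ _ _).trans
      ((nsmul_eq_mul _ _).trans (congrArg _ (ha k ⟨c, hc⟩).symm)))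
  -- The lower limit is affine on the semigroup; finiteness and differentiability are both read off
  -- this formula.
  have key : ∀ (m : ℕ), 1 ≤ m → ∀ w ∈ H,
      liminf (fun k => (a k (m • L + w) : EReal)) atTop = ((m * ℓ + D w : ℝ) : EReal) := by
    intro m hm w hw
    simp_rw [hadd _ (S.nsmul_mem hL m) w (hHS hw), hsmul L hL m]
    rw [liminf_add_of_tendsto (hD w hw), liminf_natCast_mul _ hm, hℓ]
    push_cast
    rfl
  have hDadd : ∀ u ∈ H, ∀ w ∈ H, D (u + w) = D u + D w := fun u hu w hw =>
    tendsto_nhds_unique (hD _ (H.add_mem hu hw)) (((hD u hu).add (hD w hw)).congr fun k =>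
      (hadd u (hHS hu) w (hHS hw) k).symm)
  have hD0 : D 0 = 0 := by simpa using hDadd 0 H.zero_mem 0 H.zero_mem
  refine ⟨?_, isOpenRel_semigroupAt H L, ?_, mem_semigroupAt_self H L, D, ?_, hDadd⟩
  · rintro _ ⟨m, hm, w, hw, rfl⟩
    rw [key m hm w hw]
    exact ⟨EReal.coe_ne_top _, EReal.coe_ne_bot _⟩
  · rintro c ⟨m, hm, w, hw, rfl⟩ n hn
    simp_rw [hsmul _ (S.add_mem (S.nsmul_mem hL m) (hHS hw)) n]
    rw [liminf_natCast_mul _ hn, EReal.toReal_mul, EReal.toReal_coe]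
  · intro w hw
    -- The differences are equal to `D w` from `m = 1` on, and not only in the limit.
    refine tendsto_const_nhds.congr' ?_
    filter_upwards [eventually_ge_atTop 1] with m hm
    have h0 := key m hm 0 H.zero_mem
    rw [add_zero] at h0
    rw [key m hm w hw, h0, EReal.toReal_coe, EReal.toReal_coe, hD0]
    ring

/-- If `liminf a k` is differentiable at `L` in the directions of `H`, and `a k L` converges, then
the linear forms `a k` converge on `H`. -/
lemma tendsto_of_isDifferentiableAt {S H : AddSubgroup G} (hHS : H ≤ S) {a : ℕ → G → ℝ}
    (a' : ℕ → S →+ ℝ) (ha : ∀ k (c : S), a k c = a' k c) {L : G} (hL : L ∈ S)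
    (hbdd : ∀ w ∈ H, ∃ C : ℝ, ∀ k, |a k w| ≤ C)
    (hlim : ∃ ℓ : ℝ, Tendsto (fun k => a k L) atTop (𝓝 ℓ))
    (hdiff : IsDifferentiableAt (semigroupAt H L) H
      (fun c => (liminf (fun k => (a k c : EReal)) atTop).toReal) L) :
    ∀ w ∈ H, ∃ ℓ : ℝ, Tendsto (fun k => a k w) atTop (𝓝 ℓ) := by
  obtain ⟨ℓ, hℓ⟩ := hlim
  obtain ⟨D, hD, hDadd⟩ := hdiff.exists_differential
  have hadd : ∀ c ∈ S, ∀ d ∈ S, ∀ k, a k (c + d) = a k c + a k d := fun c hc d hd k =>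
    (ha k (⟨c, hc⟩ + ⟨d, hd⟩)).trans ((map_add _ _ _).trans
      (congrArg₂ (· + ·) (ha k ⟨c, hc⟩).symm (ha k ⟨d, hd⟩).symm))
  have hsmul : ∀ c ∈ S, ∀ (m k : ℕ), a k (m • c) = m * a k c := fun c hc m k =>
    (ha k (m • ⟨c, hc⟩)).trans ((map_nsmul _ _ _).trans
      ((nsmul_eq_mul _ _).trans (congrArg _ (ha k ⟨c, hc⟩).symm)))
  have hneg : ∀ c ∈ S, ∀ k, a k (-c) = -a k c := fun c hc k =>
    (ha k (-⟨c, hc⟩)).trans ((map_neg _ _).trans (congrArg _ (ha k ⟨c, hc⟩).symm))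
  -- the lower limits on `H` are finite, and compute the differential
  have hlow : ∀ w ∈ H, liminf (fun k => (a k w : EReal)) atTop = (D w : EReal) := by
    intro w hw
    obtain ⟨C, hC⟩ := hbdd w hw
    -- Boundedness makes the lower limit a real number `r`, so that it can be compared with `D w`.
    have h1 : ((-C : ℝ) : EReal) ≤ liminf (fun k => (a k w : EReal)) atTop :=
      le_liminf_of_le (by isBoundedDefault)
        (Eventually.of_forall fun k => EReal.coe_le_coe_iff.mpr (abs_le.mp (hC k)).1)
    have h2 : liminf (fun k => (a k w : EReal)) atTop ≤ (C : EReal) :=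
      (liminf_le_limsup).trans (limsup_le_of_le (by isBoundedDefault)
        (Eventually.of_forall fun k => EReal.coe_le_coe_iff.mpr (abs_le.mp (hC k)).2))
    obtain ⟨r, hr⟩ : ∃ r : ℝ, liminf (fun k => (a k w : EReal)) atTop = r :=
      ⟨_, (EReal.coe_toReal (fun h => by simp [h] at h2)
        (fun h => by simp [h] at h1)).symm⟩
    -- As `a k (m • L)` converges to `m * ℓ`, it comes out of the lower limit, and the difference
    -- does not depend on `m`.
    have key : ∀ m : ℕ, (fun c => (liminf (fun k => (a k c : EReal)) atTop).toReal) (m • L + w) -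
        (fun c => (liminf (fun k => (a k c : EReal)) atTop).toReal) (m • L) = r := by
      intro m
      have hm : Tendsto (fun k => a k (m • L)) atTop (𝓝 (m * ℓ)) := by
        simp_rw [hsmul L hL m]; exact hℓ.const_mul _
      have e1 : liminf (fun k => (a k (m • L + w) : EReal)) atTop = ((r + m * ℓ : ℝ) : EReal) := by
        simp_rw [hadd _ (S.nsmul_mem hL m) w (hHS hw), add_comm (a _ (m • L))]
        rw [liminf_add_of_tendsto hm, hr, EReal.coe_add]
      have e2 : liminf (fun k => (a k (m • L) : EReal)) atTop = ((m * ℓ : ℝ) : EReal) :=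
        (EReal.tendsto_coe.mpr hm).liminf_eq
      simp only [e1, e2, EReal.toReal_coe]
      ring
    have := tendsto_nhds_unique (hD w hw) ((tendsto_congr key).mpr tendsto_const_nhds)
    rw [hr, this]
  have hD0 : D 0 = 0 := by simpa using hDadd 0 H.zero_mem 0 H.zero_mem
  intro w hw
  refine ⟨D w, EReal.tendsto_coe.mp (tendsto_of_liminf_eq_limsup (hlow w hw) ?_)⟩
  -- The lower limit of `-a k w` is minus the upper limit of `a k w`; with `D (-w) = -D w` this
  -- shows that the upper limit is also `D w`.
  have h := hlow (-w) (H.neg_mem hw)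
  have hDn : D (-w) = -D w := by
    have := hDadd w hw (-w) (H.neg_mem hw)
    rw [add_neg_cancel, hD0] at this
    linarith
  have e : (fun k => (a k (-w) : EReal)) = -fun k => (a k w : EReal) := by
    funext k
    rw [hneg w (hHS hw)]
    exact EReal.coe_neg _
  rw [e, EReal.liminf_neg, hDn, EReal.coe_neg, neg_inj] at h
  exact h

end Analysis

/-! ### Existence of weak limits, by Riesz representation. -/

section Riesz

/-- If the integrals of all the continuous functions for a sequence of probability measures on a
compact space converge, then the sequence converges weakly to a probability measure. -/
lemma exists_weak_limit {Y : Type*} [TopologicalSpace Y] [CompactSpace Y] [T2Space Y]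
    [MeasurableSpace Y] [BorelSpace Y] (η : ℕ → Measure Y) [∀ n, IsProbabilityMeasure (η n)]
    (h : ∀ f : C(Y, ℝ), ∃ ℓ : ℝ, Tendsto (fun n => ∫ y, f y ∂(η n)) atTop (𝓝 ℓ)) :
    ∃ μ : Measure Y, IsProbabilityMeasure μ ∧
      ∀ f : C(Y, ℝ), Tendsto (fun n => ∫ y, f y ∂(η n)) atTop (𝓝 (∫ y, f y ∂μ)) := by
  choose I hI using h
  have hint : ∀ (f : C(Y, ℝ)) n, Integrable f (η n) := fun f n =>
    f.continuous.integrable_of_hasCompactSupport (HasCompactSupport.of_compactSpace _)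
  let Λ₀ : CompactlySupportedContinuousMap Y ℝ →ₗ[ℝ] ℝ :=
    { toFun := fun f => I f.toContinuousMap
      map_add' := fun f g => tendsto_nhds_unique (hI _) (((hI _).add (hI _)).congr fun n =>
        (integral_add (hint f.toContinuousMap n) (hint g.toContinuousMap n)).symm)
      map_smul' := fun c f => tendsto_nhds_unique (hI _) (((hI _).const_mul c).congr fun n =>
        (integral_const_mul c f.toContinuousMap).symm) }
  -- Linearity and positivity of integrals pass to the limit.
  let Λ : CompactlySupportedContinuousMap Y ℝ →ₚ[ℝ] ℝ :=
    PositiveLinearMap.mk₀ Λ₀ fun f hf =>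
      ge_of_tendsto' (hI f.toContinuousMap) fun n => integral_nonneg fun y => hf y
  have hΛ : ∀ f : C(Y, ℝ), ∫ y, f y ∂(RealRMK.rieszMeasure Λ) = I f := fun f =>
    RealRMK.integral_rieszMeasure Λ ⟨f, HasCompactSupport.of_compactSpace _⟩
  have h1 : I 1 = 1 := tendsto_nhds_unique (hI 1) (by simp)
  have huniv : (RealRMK.rieszMeasure Λ).real Set.univ = 1 := by
    have := hΛ 1
    simpa [h1] using this
  refine ⟨RealRMK.rieszMeasure Λ, ⟨?_⟩, fun f => by rw [hΛ]; exact hI f⟩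
  -- Real mass `1` excludes infinite mass, since `∞` is sent to `0` by `ENNReal.toReal`.
  rw [measureReal_def] at huniv
  exact (ENNReal.toReal_eq_one_iff _).mp huniv

end Riesz

end Arakelov

namespace Arakelov

/-! ### Standard charts of projective space over `ℤ`. -/

noncomputable section ProjCharts

attribute [local instance] MvPolynomial.gradedAlgebra

open HomogeneousLocalization

/-- The homogeneous coordinate ring of `ℙⁿ` over `ℤ`. -/
abbrev CoordRing (n : ℕ) : Type u := MvPolynomial (Fin (n + 1)) (ULift.{u} ℤ)

/-- The grading of the homogeneous coordinate ring of `ℙⁿ` over `ℤ`. -/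
abbrev coordGrading (n : ℕ) : ℕ → Submodule (ULift.{u} ℤ) (CoordRing.{u} n) :=
  MvPolynomial.homogeneousSubmodule (Fin (n + 1)) (ULift.{u} ℤ)

variable {n : ℕ}

lemma X_mem_coordGrading (i : Fin (n + 1)) : MvPolynomial.X i ∈ coordGrading.{u} n 1 :=
  MvPolynomial.isHomogeneous_X _ i

/-- The fraction `X j / X i`. -/
def coordFrac (i j : Fin (n + 1)) : Away (coordGrading.{u} n) (MvPolynomial.X i) :=
  Away.mk _ (X_mem_coordGrading i) 1 (MvPolynomial.X j)
    (by rw [one_smul]; exact X_mem_coordGrading j)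

lemma val_coordFrac_mul (i j : Fin (n + 1)) :
    (coordFrac.{u} i j).val * algebraMap (CoordRing.{u} n) _ (MvPolynomial.X i) =
      algebraMap (CoordRing.{u} n) (Localization.Away (MvPolynomial.X i)) (MvPolynomial.X j) := by
  rw [coordFrac, Away.val_mk, Localization.mk_eq_mk']
  have := IsLocalization.mk'_spec (Localization.Away (MvPolynomial.X i : CoordRing.{u} n)) (MvPolynomial.X j)
    (⟨MvPolynomial.X i ^ 1, by use 1⟩ : Submonoid.powers (MvPolynomial.X i : CoordRing.{u} n))
  simpa only [pow_one] using this

/-- Dehomogenisation. -/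
def dehomogenize (i : Fin (n + 1)) : CoordRing.{u} n →+*
    Away (coordGrading.{u} n) (MvPolynomial.X i) :=
  MvPolynomial.eval₂Hom ((Int.castRingHom (Away (coordGrading.{u} n) (MvPolynomial.X i))).comp
    (ULift.ringEquiv (R := ℤ)).toRingHom) (coordFrac i)

lemma dehomogenize_mem_closure (i : Fin (n + 1)) (p : CoordRing.{u} n) :
    dehomogenize i p ∈ Subring.closure (Set.range (coordFrac.{u} i)) := by
  induction p using MvPolynomial.induction_on with
  | C a => simp [dehomogenize]
  | add p q hp hq => rw [map_add]; exact add_mem hp hq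
  | mul_X p j hp =>
    rw [map_mul]
    refine mul_mem hp (Subring.subset_closure ⟨j, ?_⟩)
    simp [dehomogenize]

/-- Substituting `X j / X i` for each `X j` divides a monomial by `X i` to the power of its degree.
-/
lemma val_dehomogenize_monomial (i : Fin (n + 1)) (d : Fin (n + 1) →₀ ℕ) (c : ULift.{u} ℤ) :
    (dehomogenize i (MvPolynomial.monomial d c)).val *
        algebraMap (CoordRing.{u} n) _ (MvPolynomial.X i) ^ d.degree =
      algebraMap (CoordRing.{u} n) (Localization.Away (MvPolynomial.X i)) (MvPolynomial.monomial d c) := by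
  have hc : algebraMap (CoordRing.{u} n) (Localization.Away (MvPolynomial.X i)) (MvPolynomial.C c) =
      ((c.down : ℤ) : Localization.Away (MvPolynomial.X i : CoordRing.{u} n)) := by
    have : MvPolynomial.C (σ := Fin (n + 1)) c = ((c.down : ℤ) : MvPolynomial _ (ULift.{u} ℤ)) := by
      rw [← map_intCast (MvPolynomial.C (σ := Fin (n + 1)) (R := ULift.{u} ℤ))]
      rfl
    rw [this, map_intCast]
  rw [dehomogenize, MvPolynomial.coe_eval₂Hom, MvPolynomial.eval₂_monomial,
    MvPolynomial.monomial_eq, map_mul, hc, ← HomogeneousLocalization.algebraMap_apply, map_mul, Finsupp.prod,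
    Finsupp.prod, map_prod, map_prod, Finsupp.degree_apply, ← Finset.prod_pow_eq_pow_sum, mul_assoc,
    ← Finset.prod_mul_distrib]
  congr 1
  · simp; rfl
  · refine Finset.prod_congr rfl fun j _ => ?_
    rw [map_pow, map_pow, HomogeneousLocalization.algebraMap_apply, ← mul_pow, val_coordFrac_mul]

/-- An element of the ring of `D₊(X i)` is `p / X i ^ m` with `p` homogeneous of degree `m`, which
is `p` evaluated at the fractions `X j / X i`. Since the coefficients are integers, a subring
containing these fractions contains everything. -/
lemma closure_coordFrac (i : Fin (n + 1)) :
    Subring.closure (Set.range (coordFrac.{u} i)) = ⊤ := by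
  refine eq_top_iff.mpr fun z _ => ?_
  obtain ⟨m, p, hp, rfl⟩ := Away.mk_surjective _ (X_mem_coordGrading i) z
  have : Away.mk _ (X_mem_coordGrading i) m p hp = dehomogenize i p := by
    apply val_injective
    have hp' : p.IsHomogeneous m := by simpa using hp
    have hu : IsUnit (algebraMap (CoordRing.{u} n) (Localization.Away (MvPolynomial.X i : CoordRing.{u} n))
        (MvPolynomial.X i) ^ m) :=
      IsUnit.pow m (IsLocalization.Away.algebraMap_isUnit
        (S := Localization.Away (MvPolynomial.X i : CoordRing.{u} n)) _)
    refine hu.mul_left_injective ?_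
    change (Away.mk _ (X_mem_coordGrading i) m p hp).val * _ = (dehomogenize i p).val * _
    have h1 : (Away.mk _ (X_mem_coordGrading i) m p hp).val *
        algebraMap (CoordRing.{u} n) (Localization.Away (MvPolynomial.X i)) (MvPolynomial.X i) ^ m =
        algebraMap _ _ p := by
      rw [Away.val_mk, Localization.mk_eq_mk', ← map_pow]
      exact IsLocalization.mk'_spec _ _ (⟨MvPolynomial.X i ^ m, by use m⟩ : Submonoid.powers _)
    rw [h1]
    conv_lhs => rw [p.as_sum, map_sum]
    conv_rhs => rw [p.as_sum, map_sum, ← HomogeneousLocalization.algebraMap_apply, map_sum, Finset.sum_mul]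
    refine Finset.sum_congr rfl fun d hd => ?_
    rw [← val_dehomogenize_monomial, HomogeneousLocalization.algebraMap_apply]
    have := hp' (MvPolynomial.mem_support_iff.mp hd)
    rw [← this]
    exact congrArg (fun k => _ * _ ^ k) (DFunLike.congr_fun Finsupp.degree_eq_weight_one d)
  rw [this]
  exact dehomogenize_mem_closure i p

/-- The function `X j / X i` on `D₊(X i)`. -/
def projFrac (i j : Fin (n + 1)) :
    Γ(Proj (coordGrading.{u} n), Proj.basicOpen _ (MvPolynomial.X i)) :=
  (Proj.awayToSection _ _).hom (coordFrac i j)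

lemma closure_range_comp {A B : Type*} [CommRing A] [CommRing B] {ι : Type*} (φ : A →+* B)
    (hφ : Function.Surjective φ) (g : ι → A) (hg : Subring.closure (Set.range g) = ⊤) :
    Subring.closure (Set.range fun i => φ (g i)) = ⊤ := by
  have : (Set.range fun i => φ (g i)) = φ '' Set.range g := Set.range_comp φ g
  rw [this, ← RingHom.map_closure, hg]
  exact (RingHom.range_eq_map φ).symm.trans (RingHom.range_eq_top.mpr hφ)

lemma closure_projFrac (i : Fin (n + 1)) :
    Subring.closure (Set.range (projFrac.{u} i)) = ⊤ :=
  closure_range_comp _ (ConcreteCategory.bijective_of_isIso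
      (Proj.basicOpenIsoAway _ _ (X_mem_coordGrading.{u} i) one_pos).hom).2 _ (closure_coordFrac i)

lemma projFrac_self (i : Fin (n + 1)) : projFrac.{u} i i = 1 := by
  have : coordFrac.{u} i i = 1 := by
    apply val_injective
    rw [coordFrac, Away.val_mk, val_one]
    have h := Localization.mk_self (⟨MvPolynomial.X i ^ 1, by use 1⟩ :
      Submonoid.powers (MvPolynomial.X i : CoordRing.{u} n))
    simpa only [pow_one] using h
  rw [projFrac, this, map_one]

/-- This transfers identities between fractions with different denominators to the ring of the
common open set `D₊(f g)`. -/
lemma res_awayToSection {σ A : Type u} [CommRing A] [SetLike σ A] [AddSubgroupClass σ A] (𝒜 : ℕ → σ)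
    [GradedRing 𝒜] {f g x : A} {d : ℕ} (hg : g ∈ 𝒜 d) (hx : x = f * g) (a : Away 𝒜 f)
    {W : (Proj 𝒜).Opens} (hf : W ≤ Proj.basicOpen 𝒜 f) (hW : W ≤ Proj.basicOpen 𝒜 x) :
    res hf ((Proj.awayToSection 𝒜 f).hom a) =
      res hW ((Proj.awayToSection 𝒜 x).hom (awayMap 𝒜 hg hx a)) := by
  have h : ((Proj.awayToSection 𝒜 x).hom (awayMap 𝒜 hg hx a)) =
      res (Proj.basicOpen_mono _ _ _ ⟨_, hx⟩) ((Proj.awayToSection 𝒜 f).hom a) :=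
    congrArg (fun φ => φ.hom a) (Proj.awayMap_awayToSection 𝒜 (f := f) hg hx)
  rw [h, res_res]

lemma stalkIso'_germ_awayToSection {σ A : Type u} [CommRing A] [SetLike σ A]
    [AddSubgroupClass σ A] (𝒜 : ℕ → σ) [GradedRing 𝒜] (f : A) (x : Proj 𝒜)
    (hx : x ∈ Proj.basicOpen 𝒜 f) (a : Away 𝒜 f) :
    Proj.stalkIso' 𝒜 x ((Proj 𝒜).presheaf.germ _ x hx ((Proj.awayToSection 𝒜 f).hom a)) =
      mapId 𝒜 (Submonoid.powers_le.mpr hx) a :=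
  (congrArg (Proj.stalkIso' 𝒜 x) (congrArg (fun φ => φ.hom a)
    (ProjectiveSpectrum.Proj.awayToSection_germ 𝒜 f x hx))).trans
    ((Proj.stalkIso' 𝒜 x).apply_symm_apply (mapId 𝒜 (Submonoid.powers_le.mpr hx) a))

lemma awayMap_mk_mul {σ A : Type u} [CommRing A] [SetLike σ A] [AddSubgroupClass σ A] (𝒜 : ℕ → σ)
    [GradedRing 𝒜] {a b c : A} (ha : a ∈ 𝒜 1) (hb : b ∈ 𝒜 1) (hc : c ∈ 𝒜 (1 • 1))
    (hb' : b ∈ 𝒜 (1 • 1)) :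
    awayMap 𝒜 hb rfl (Away.mk 𝒜 ha 1 c hc) = awayMap 𝒜 hb rfl (Away.mk 𝒜 ha 1 b hb') *
        awayMap 𝒜 ha (mul_comm a b) (Away.mk 𝒜 hb 1 c hc) := by
  apply val_injective
  rw [val_mul]
  simp only [awayMap_mk, Away.val_mk, Localization.mk_mul, pow_one]
  rw [Localization.mk_eq_mk_iff, Localization.r_iff_exists]
  refine ⟨1, ?_⟩
  simp only [Submonoid.coe_mul, Submonoid.coe_one]
  ring

lemma awayMap_coordFrac (i j k : Fin (n + 1)) :
    awayMap (coordGrading.{u} n) (X_mem_coordGrading j) rfl (coordFrac i k) =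
      awayMap _ (X_mem_coordGrading j) rfl (coordFrac i j) *
        awayMap _ (X_mem_coordGrading i) (mul_comm _ _) (coordFrac j k) :=
  awayMap_mk_mul _ _ _ _ _

lemma projFrac_cocycle (i j k : Fin (n + 1)) {W : (Proj (coordGrading.{u} n)).Opens}
    (hi : W ≤ Proj.basicOpen _ (MvPolynomial.X i)) (hj : W ≤ Proj.basicOpen _ (MvPolynomial.X j)) :
    res hi (projFrac i k) = res hi (projFrac i j) * res hj (projFrac j k) := by
  have hW : W ≤ Proj.basicOpen (coordGrading.{u} n) (MvPolynomial.X i * MvPolynomial.X j) := by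
    rw [Proj.basicOpen_mul]; exact le_inf hi hj
  unfold projFrac
  rw [res_awayToSection _ (X_mem_coordGrading j) rfl _ hi hW,
    res_awayToSection _ (X_mem_coordGrading j) rfl _ hi hW,
    res_awayToSection _ (X_mem_coordGrading i) (mul_comm _ _) _ hj hW,
    awayMap_coordFrac, map_mul, map_mul]

lemma notMem_of_isUnit_mapId {i j : Fin (n + 1)} {I : Ideal (CoordRing.{u} n)} [I.IsPrime]
    (h : Submonoid.powers (MvPolynomial.X i) ≤ I.primeCompl)
    (hu : IsUnit (mapId (coordGrading.{u} n) h (coordFrac i j))) : MvPolynomial.X j ∉ I := by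
  rw [← isUnit_iff_isUnit_val] at hu
  have e : (mapId (coordGrading.{u} n) h (coordFrac i j)).val =
      IsLocalization.mk' (Localization I.primeCompl) (MvPolynomial.X j)
        (⟨MvPolynomial.X i ^ 1, h ⟨1, rfl⟩⟩ : I.primeCompl) := by
    rw [← Localization.mk_eq_mk']
    rfl
  rw [e] at hu
  exact (IsLocalization.AtPrime.isUnit_mk'_iff (Localization I.primeCompl) I _ _).mp hu

/-- If `X j / X i` is a unit in the stalk, a homogeneous localisation at a prime, then `X j` is
outside that prime. Conversely, `X i / X j` is an inverse on the overlap. -/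
lemma basicOpen_projFrac (i j : Fin (n + 1)) :
    (Proj (coordGrading.{u} n)).basicOpen (projFrac i j) =
      Proj.basicOpen _ (MvPolynomial.X i) ⊓ Proj.basicOpen _ (MvPolynomial.X j) := by
  apply le_antisymm
  · refine fun x hx => ⟨Scheme.basicOpen_le _ _ hx, ?_⟩
    have hxi : x ∈ Proj.basicOpen _ (MvPolynomial.X i) := Scheme.basicOpen_le _ _ hx
    have hu : IsUnit ((Proj (coordGrading.{u} n)).presheaf.germ _ x hxi (projFrac i j)) :=
      (Scheme.mem_basicOpen _ _ x hxi).mp hx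
    have hu' := hu.map (Proj.stalkIso' (coordGrading.{u} n) x)
    have := x.isPrime
    exact notMem_of_isUnit_mapId (I := x.asHomogeneousIdeal.toIdeal) _ ((congrArg IsUnit (stalkIso'_germ_awayToSection
      (coordGrading.{u} n) (MvPolynomial.X i) x hxi (coordFrac i j))).mp hu')
  · intro x hx
    -- The cocycle relation with third index `i` reads `1 = (X j / X i) * (X i / X j)`.
    have h := projFrac_cocycle.{u} (n := n) i j i inf_le_left inf_le_right
    rw [projFrac_self, map_one] at h
    have hunit : IsUnit (res (inf_le_left : Proj.basicOpen (coordGrading.{u} n) (MvPolynomial.X i) ⊓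
        Proj.basicOpen _ (MvPolynomial.X j) ≤ _) (projFrac i j)) :=
      IsUnit.of_mul_eq_one _ h.symm
    have := Scheme.basicOpen_of_isUnit (X := Proj (coordGrading.{u} n)) hunit
    have h2 := Scheme.basicOpen_res (X := Proj (coordGrading.{u} n)) (projFrac i j)
      (homOfLE (inf_le_left : Proj.basicOpen (coordGrading.{u} n) (MvPolynomial.X i) ⊓
        Proj.basicOpen _ (MvPolynomial.X j) ≤ _)).op
    have h3 := (h2.symm.trans this).ge hx
    exact h3.2

end ProjCharts

end Arakelov

namespace Arakelov

/-! ### Charts of a projective scheme over a field. -/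

noncomputable section Charts

attribute [local instance] MvPolynomial.gradedAlgebra

/-- Both maps to `P` land in the subring `S` that their images generate, so by the universal
property the identity of `P` factors through `S`. -/
lemma closure_eq_top_of_isPushout {Z A B P : CommRingCat.{u}} {f : Z ⟶ A} {g : Z ⟶ B} {inl : A ⟶ P}
    {inr : B ⟶ P} (h : IsPushout f g inl inr) :
    Subring.closure (Set.range inl.hom ∪ Set.range inr.hom) = ⊤ := by
  set S := Subring.closure (Set.range inl.hom ∪ Set.range inr.hom) with hS
  let a : A ⟶ CommRingCat.of S := CommRingCat.ofHom (inl.hom.codRestrict S fun x =>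
    Subring.subset_closure (Or.inl ⟨x, rfl⟩))
  let b : B ⟶ CommRingCat.of S := CommRingCat.ofHom (inr.hom.codRestrict S fun x =>
    Subring.subset_closure (Or.inr ⟨x, rfl⟩))
  have hab : f ≫ a = g ≫ b := by
    have hw : ∀ x, inl.hom (f.hom x) = inr.hom (g.hom x) := fun x =>
      congrArg (fun φ => φ.hom x) h.w
    exact CommRingCat.hom_ext (RingHom.ext fun x => Subtype.ext (hw x))
  have hid : h.desc a b hab ≫ CommRingCat.ofHom S.subtype = 𝟙 P := by
    apply h.hom_ext
    · rw [h.inl_desc_assoc]; rfl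
    · rw [h.inr_desc_assoc]; rfl
  refine eq_top_iff.mpr fun x _ => ?_
  have hx : ((h.desc a b hab).hom x : P) = x := congrArg (fun φ => φ.hom x) hid
  rw [← hx]
  exact Subtype.prop _

variable {K : Type u} [Field K] {X : Scheme.{u}}

/-- The constant functions on an open set of a `K`-scheme. -/
def constSection (π : X ⟶ Spec (.of K)) (U : X.Opens) : K →+* Γ(X, U) :=
  (res le_top).comp ((Scheme.ΓSpecIso (.of K)).inv ≫ π.appTop).hom

/-- An affine open cover `U i` of a `K`-scheme, such that the ring of `U i` is generated over `K` by
functions `t i j`, the quotients `T j / T i` of homogeneous coordinates. -/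
structure ProjCharts (π : X ⟶ Spec (.of K)) (n : ℕ) where
  U : Fin (n + 1) → X.Opens
  isAffineOpen : ∀ i, IsAffineOpen (U i)
  exists_mem : ∀ x, ∃ i, x ∈ U i
  t : ∀ i, Fin (n + 1) → Γ(X, U i)
  closure_eq_top : ∀ i, Subring.closure (Set.range (constSection π (U i)) ∪ Set.range (t i)) = ⊤
  t_self : ∀ i, t i i = 1
  cocycle : ∀ i j k, res (V := U i ⊓ U j) inf_le_left (t i k) =
    res inf_le_left (t i j) * res inf_le_right (t j k)
  basicOpen_t : ∀ i j, X.basicOpen (t i j) = U i ⊓ U j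

/-- Over affine schemes, the ring of the fibre product is the pushout of the rings. -/
lemma closure_sections_pullback {S P T : Scheme.{u}} [IsAffine S] [IsAffine T] (a : S ⟶ T)
    (b : P ⟶ T) {D : P.Opens} (hD : IsAffineOpen D) :
    Subring.closure (Set.range ((Limits.pullback.fst a b).appLE ⊤
        (Limits.pullback.snd a b ⁻¹ᵁ D) le_top).hom ∪
      Set.range ((Limits.pullback.snd a b).app D).hom) = ⊤ := by
  have H := IsPullback.of_hasPullback a b
  have h := (isIso_pushoutSection_iff H (US := ⊤) (UT := D) (UX := ⊤)
    (UY := Limits.pullback.snd a b ⁻¹ᵁ D) le_top le_top (by simp)).mp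
    (isIso_pushoutSection_of_isAffineOpen H _ _ _ (isAffineOpen_top T) hD (isAffineOpen_top S))
  have := closure_eq_top_of_isPushout h
  simpa only [Scheme.Hom.app_eq_appLE] using this

lemma isAffineOpen_preimage_of_isClosedImmersion {S P T X : Scheme.{u}} [IsAffine S] [IsAffine T]
    (a : S ⟶ T) (b : P ⟶ T) (c : X ⟶ Limits.pullback a b) [IsClosedImmersion c] {D : P.Opens}
    (hD : IsAffineOpen D) : IsAffineOpen ((c ≫ Limits.pullback.snd a b) ⁻¹ᵁ D) := by
  have : IsAffineHom (Limits.pullback.snd a b) :=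
    isAffineHom_isStableUnderBaseChange.of_isPullback (IsPullback.of_hasPullback a b) inferInstance
  exact hD.preimage _

/-- A closed immersion is surjective on the sections over affine open sets, so generators of the
fibre product restrict to generators of the closed subscheme. -/
lemma closure_sections_of_isClosedImmersion {S P T X : Scheme.{u}} [IsAffine S] [IsAffine T]
    (a : S ⟶ T) (b : P ⟶ T) (c : X ⟶ Limits.pullback a b) [IsClosedImmersion c] {D : P.Opens}
    (hD : IsAffineOpen D) {ι : Type*} (s : ι → Γ(P, D))
    (hs : Subring.closure (Set.range s) = ⊤) :
    Subring.closure (Set.range ((c ≫ Limits.pullback.fst a b).appLE ⊤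
        ((c ≫ Limits.pullback.snd a b) ⁻¹ᵁ D) le_top).hom ∪
      Set.range fun j => (c ≫ Limits.pullback.snd a b).app D (s j)) = ⊤ := by
  have : IsAffineHom (Limits.pullback.snd a b) :=
    isAffineHom_isStableUnderBaseChange.of_isPullback (IsPullback.of_hasPullback a b) inferInstance
  have h2 : (c.app (Limits.pullback.snd a b ⁻¹ᵁ D)).hom.range = ⊤ :=
    RingHom.range_eq_top.mpr (c.app_surjective _ (hD.preimage _))
  rw [RingHom.range_eq_map, ← closure_sections_pullback a b hD, RingHom.map_closure,
    Set.image_union] at h2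
  refine eq_top_iff.mpr (h2.ge.trans ?_)
  refine Subring.closure_le.mpr (Set.union_subset ?_ ?_)
  · rintro _ ⟨_, ⟨s, rfl⟩, rfl⟩
    refine Subring.subset_closure (Or.inl ⟨s, ?_⟩)
    have h : (c ≫ Limits.pullback.fst a b).appLE ⊤ ((c ≫ Limits.pullback.snd a b) ⁻¹ᵁ D) le_top =
        (Limits.pullback.fst a b).appLE ⊤ (Limits.pullback.snd a b ⁻¹ᵁ D) le_top ≫
          c.app (Limits.pullback.snd a b ⁻¹ᵁ D) := by
      rw [c.app_eq_appLE]
      exact (Scheme.Hom.appLE_comp_appLE _ _ _ _ _ _ _).symm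
    rw [h]; rfl
  · rintro _ ⟨_, ⟨r, rfl⟩, rfl⟩
    have hr : r ∈ Subring.closure (Set.range s) := hs ▸ trivial
    have h3 : _ ∈ (Subring.closure (Set.range s)).map ((c ≫ Limits.pullback.snd a b).app D).hom :=
      ⟨r, hr, rfl⟩
    rw [RingHom.map_closure] at h3
    refine Subring.closure_mono ?_ h3
    rintro _ ⟨_, ⟨j, rfl⟩, rfl⟩
    exact Or.inr ⟨j, rfl⟩

lemma exists_mem_basicOpen_X {n : ℕ} (x : Proj (coordGrading.{u} n)) :
    ∃ i, x ∈ Proj.basicOpen (coordGrading.{u} n) (MvPolynomial.X i) := by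
  refine TopologicalSpace.Opens.mem_iSup.mp ((Proj.iSup_basicOpen_eq_top' (coordGrading.{u} n)
    MvPolynomial.X (fun i => ⟨1, X_mem_coordGrading i⟩) ?_).ge (Set.mem_univ x))
  refine eq_top_iff.mpr fun p _ => ?_
  induction p using MvPolynomial.induction_on with
  | C a =>
    exact Subalgebra.algebraMap_mem (Algebra.adjoin (coordGrading.{u} n 0) _)
      (⟨MvPolynomial.C a, MvPolynomial.isHomogeneous_C _ a⟩ : coordGrading.{u} n 0)
  | add p q hp hq => exact add_mem (hp trivial) (hq trivial)
  | mul_X p j hp => exact mul_mem (hp trivial) (Algebra.subset_adjoin ⟨j, rfl⟩)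

/-- The charts are the preimages of the `D₊(X i)` under the map `q` from `X` to projective space
over `ℤ`, and the relations between coordinates are pulled back from there. -/
lemma exists_projCharts {π : X ⟶ Spec (.of K)} (hπ : IsProjective π) :
    ∃ n, Nonempty (ProjCharts π n) := by
  obtain ⟨n, c, hc, rfl⟩ := hπ
  let f := Limits.terminal.from (Spec (.of K))
  let g := Limits.terminal.from (Proj (coordGrading.{u} n))
  change X ⟶ Limits.pullback f g at c
  change IsClosedImmersion (Y := Limits.pullback f g) c at hc
  have hD := fun i => Proj.isAffineOpen_basicOpen (coordGrading.{u} n) (MvPolynomial.X i)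
    (X_mem_coordGrading i) one_pos
  let q : X ⟶ Proj (coordGrading.{u} n) := c ≫ Limits.pullback.snd f g
  refine ⟨n, ⟨fun i => q ⁻¹ᵁ Proj.basicOpen _ (MvPolynomial.X i),
    fun i => isAffineOpen_preimage_of_isClosedImmersion f g c (hD i),
    fun x => exists_mem_basicOpen_X (q x), fun i j => q.app _ (projFrac i j), fun i => ?_,
    fun i => ?_, fun i j k => ?_, fun i j => ?_⟩⟩
  · have h := closure_sections_of_isClosedImmersion f g c (hD i) _ (closure_projFrac i)
    refine eq_top_iff.mpr (h.ge.trans (Subring.closure_mono (Set.union_subset_union_left _ ?_)))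
    rintro _ ⟨s, rfl⟩
    refine ⟨(Scheme.ΓSpecIso (.of K)).hom.hom s, ?_⟩
    have e : (c ≫ Limits.pullback.fst f g).appLE ⊤ (q ⁻¹ᵁ Proj.basicOpen _ (MvPolynomial.X i)) le_top =
        (c ≫ Limits.pullback.fst f g).appTop ≫ X.presheaf.map (homOfLE le_top).op := rfl
    refine Eq.trans ?_ (congrArg (fun φ => φ.hom s) e).symm
    refine congrArg (fun r => (X.presheaf.map (homOfLE le_top).op).hom
      ((c ≫ Limits.pullback.fst f g).appTop.hom r)) ?_
    exact congrArg (fun φ => φ.hom s) (Scheme.ΓSpecIso (.of K)).hom_inv_id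
  · rw [projFrac_self, map_one]
  · have := congrArg (q.app _) (projFrac_cocycle.{u} (n := n) i j k inf_le_left inf_le_right)
    rw [map_mul, app_res, app_res, app_res] at this
    exact this
  · rw [← Scheme.preimage_basicOpen, basicOpen_projFrac]
    rfl

end Charts

end Arakelov

namespace Arakelov

/-! ### Topology of spaces of points with values, common to the finite and infinite places. -/

section EvalSpace

/-- A topological space `Y` over `X`, whose points `y` define multiplicative functions `f ↦ f(y)` on the
local ring of `X` at `pt y`, with the coarsest topology for which `pt` and these are continuous. -/
structure EvalSpace (X : Scheme.{u}) (T : Type*) [CommGroupWithZero T] [TopologicalSpace T]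
    (Y : Type*) [t : TopologicalSpace Y] where
  pt : Y → X
  ev : ∀ (y : Y) {U : X.Opens}, pt y ∈ U → Γ(X, U) → T
  topology_eq : t = TopologicalSpace.generateFrom
    {s | ∃ (U : X.Opens) (f : Γ(X, U)) (W : Set T), IsOpen W ∧
      s = {y | ∃ h : pt y ∈ U, ev y h f ∈ W}}
  ev_mul : ∀ (y : Y) {U : X.Opens} (h : pt y ∈ U) (f g : Γ(X, U)),
    ev y h (f * g) = ev y h f * ev y h g
  ev_one : ∀ (y : Y) {U : X.Opens} (h : pt y ∈ U), ev y h (1 : Γ(X, U)) = 1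
  ev_res : ∀ (y : Y) {U V : X.Opens} (h : V ≤ U) (hy : pt y ∈ V) (f : Γ(X, U)),
    ev y hy (res h f) = ev y (h hy) f
  ev_ne_zero : ∀ (y : Y) {U : X.Opens} (h : pt y ∈ U) (f : Γ(X, U)),
    ev y h f ≠ 0 ↔ pt y ∈ X.basicOpen f

namespace EvalSpace

variable {X : Scheme.{u}} {T : Type*} [CommGroupWithZero T] [TopologicalSpace T] {Y : Type*}
  [TopologicalSpace Y] (E : EvalSpace X T Y)

lemma ev_pow (y : Y) {U : X.Opens} (h : E.pt y ∈ U) (f : Γ(X, U)) (k : ℕ) :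
    E.ev y h (f ^ k) = E.ev y h f ^ k := by
  induction k with
  | zero => rw [pow_zero, pow_zero, E.ev_one]
  | succ k ih => rw [pow_succ, pow_succ, E.ev_mul, ih]

open Classical in
/-- The value of a function, extended by `0`. -/
noncomputable def value {U : X.Opens} (f : Γ(X, U)) (y : Y) : T :=
  if h : E.pt y ∈ U then E.ev y h f else 0

lemma value_eq {U : X.Opens} (f : Γ(X, U)) {y : Y} (h : E.pt y ∈ U) :
    E.value f y = E.ev y h f := dif_pos h

lemma isOpen_generator {U : X.Opens} (f : Γ(X, U)) {W : Set T} (hW : IsOpen W) :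
    IsOpen {y | ∃ h : E.pt y ∈ U, E.ev y h f ∈ W} := by
  have h : IsOpen[TopologicalSpace.generateFrom {s | ∃ (U : X.Opens) (f : Γ(X, U)) (W : Set T),
      IsOpen W ∧ s = {y | ∃ h : E.pt y ∈ U, E.ev y h f ∈ W}}]
      {y | ∃ h : E.pt y ∈ U, E.ev y h f ∈ W} :=
    TopologicalSpace.isOpen_generateFrom_of_mem ⟨U, f, W, hW, rfl⟩
  rwa [← E.topology_eq] at h

lemma eventually_mem {y : Y} {U : X.Opens} (h : E.pt y ∈ U) : ∀ᶠ z in 𝓝 y, E.pt z ∈ U := by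
  filter_upwards [(E.isOpen_generator (1 : Γ(X, U)) isOpen_univ).mem_nhds ⟨h, trivial⟩] with z hz
  exact hz.1

lemma tendsto_value {y : Y} {U : X.Opens} (h : E.pt y ∈ U) (f : Γ(X, U)) :
    Tendsto (E.value f) (𝓝 y) (𝓝 (E.value f y)) := by
  rw [tendsto_nhds]
  intro W hW hy
  rw [E.value_eq f h] at hy
  filter_upwards [(E.isOpen_generator f hW).mem_nhds ⟨h, hy⟩] with z hz
  obtain ⟨h', hz⟩ := hz
  rwa [Set.mem_preimage, E.value_eq f h']

variable [ContinuousMul T] [T2Space T]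

/-- Convergence can be tested on the sections over an affine open set. -/
lemma le_nhds_of_tendsto [ContinuousInv₀ T] {U : X.Opens} (hU : IsAffineOpen U) {y : Y} (hy : E.pt y ∈ U)
    {F : Filter Y} (hF : ∀ᶠ z in F, E.pt z ∈ U)
    (h : ∀ a : Γ(X, U), Tendsto (E.value a) F (𝓝 (E.ev y hy a))) : F ≤ 𝓝 y := by
  rw [E.topology_eq, TopologicalSpace.nhds_generateFrom]
  refine le_iInf₂ ?_
  rintro _ ⟨hys, V, f, W, hW, rfl⟩
  rw [le_principal_iff]
  obtain ⟨hyV, hyW⟩ := hys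
  -- Near `y`, a section `f` over any open set is a fraction `a / g ^ k` of sections over `U`, so
  -- its values are `a(z) / g(z) ^ k`.
  obtain ⟨g, hgV, hyg⟩ := hU.exists_basicOpen_le ⟨E.pt y, hyV⟩ hy
  have := hU.isLocalization_basicOpen g
  obtain ⟨⟨a, ⟨_, k, rfl⟩⟩, hk⟩ := IsLocalization.surj (Submonoid.powers g) (res hgV f)
  have hk' : res hgV f * res (X.basicOpen_le g) (g ^ k) = res (X.basicOpen_le g) a := hk
  have key : ∀ (z : Y) (hz : E.pt z ∈ X.basicOpen g), E.ev z (hgV hz) f =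
      E.value a z * (E.value g z ^ k)⁻¹ := by
    intro z hz
    have h0 := (E.ev_ne_zero z (X.basicOpen_le g hz) g).mpr hz
    have h1 := congrArg (E.ev z hz) hk'
    rw [E.ev_mul, E.ev_res, E.ev_res, E.ev_res, E.ev_pow] at h1
    rw [E.value_eq a (X.basicOpen_le g hz), E.value_eq g (X.basicOpen_le g hz), ← h1]
    field_simp
  have hg0 : E.ev y hy g ≠ 0 := (E.ev_ne_zero y hy g).mpr hyg
  have hlim : Tendsto (fun z => E.value a z * (E.value g z ^ k)⁻¹) F (𝓝 (E.ev y hyV f)) := by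
    have e := key y hyg
    rw [E.value_eq a hy, E.value_eq g hy] at e
    rw [e]
    exact (h a).mul (((h g).pow k).inv₀ (pow_ne_zero _ hg0))
  -- The nonvanishing of `g(z)` is what puts `z` over the open set where `f` is defined.
  filter_upwards [hF, (h g).eventually_ne hg0, hlim (hW.mem_nhds hyW)] with z hz hz0 hzW
  rw [E.value_eq g hz] at hz0
  have hzg := (E.ev_ne_zero z hz g).mp hz0
  exact ⟨hgV hzg, by rw [key z hzg]; exact hzW⟩

/-- Compactness: `Y` is covered by finitely many sets of points over affine open sets, on which the
functions are bounded, and limits of points define points. -/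
lemma compactSpace [ContinuousInv₀ T] {ι : Type*} [Finite ι] {U : ι → X.Opens} (hU : ∀ i, IsAffineOpen (U i))
    (B : ι → Set Y) (hcover : ∀ y, ∃ i, y ∈ B i) (hBU : ∀ i, ∀ y ∈ B i, E.pt y ∈ U i)
    (hbdd : ∀ i (a : Γ(X, U i)), ∃ C : Set T, IsCompact C ∧ ∀ y ∈ B i, E.value a y ∈ C)
    (hlim : ∀ i (F : Ultrafilter Y) (φ : Γ(X, U i) → T), (∀ᶠ y in F, E.pt y ∈ U i) →
      (∀ a, Tendsto (E.value a) F (𝓝 (φ a))) →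
      ∃ (y : Y) (h : E.pt y ∈ U i), ∀ a, E.ev y h a = φ a) : CompactSpace Y := by
  refine ⟨isCompact_iff_ultrafilter_le_nhds.mpr fun F _ => ?_⟩
  -- An ultrafilter contains one of the finitely many pieces; there each section takes values in a
  -- compact set, and so has a limit along it.
  obtain ⟨i, hi⟩ : ∃ i, B i ∈ F := by
    have : (⋃ i, B i) ∈ F := by
      rw [Set.iUnion_eq_univ_iff.mpr hcover]; exact univ_mem
    rw [← Set.biUnion_univ, Ultrafilter.finite_biUnion_mem_iff Set.finite_univ] at this
    exact this.imp fun i h => h.2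
  have hex : ∀ a : Γ(X, U i), ∃ c, Tendsto (E.value a) F (𝓝 c) := fun a => by
    obtain ⟨C, hC, hCy⟩ := hbdd i a
    obtain ⟨c, -, hc⟩ := hC.ultrafilter_le_nhds (F.map (E.value a)) (by
      rw [le_principal_iff]
      exact (mem_of_superset hi fun y hy => hCy y hy : E.value a ⁻¹' C ∈ F))
    exact ⟨c, hc⟩
  choose φ hφ using hex
  have hFU : ∀ᶠ y in (F : Filter Y), E.pt y ∈ U i := mem_of_superset hi (hBU i)
  obtain ⟨y, hy, hyφ⟩ := hlim i F φ hFU hφ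
  exact ⟨y, trivial, E.le_nhds_of_tendsto (hU i) hy hFU fun a => by rw [hyφ]; exact hφ a⟩

/-- Separation, for a space over a scheme with projective charts. -/
lemma t2Space {K : Type u} [Field K] {π : X ⟶ Spec (.of K)} {n : ℕ} (C : ProjCharts π n)
    (hext : ∀ (i) (y y' : Y) (h : E.pt y ∈ C.U i) (h' : E.pt y' ∈ C.U i),
      (∀ a : Γ(X, C.U i), E.ev y h a = E.ev y' h' a) → y = y') : T2Space Y := by
  refine t2_iff_ultrafilter.mpr fun {y y'} F hy hy' => ?_
  obtain ⟨i, hi⟩ := C.exists_mem (E.pt y)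
  obtain ⟨j, hj⟩ := C.exists_mem (E.pt y')
  have hFi := hy (E.eventually_mem hi)
  have hFj := hy' (E.eventually_mem hj)
  -- The relation `t i j * t j i = 1` on the overlap passes to the limits `y` and `y'`. Hence `t i
  -- j` does not vanish at `y`, so `y` lies over the chart of `y'`, where values separate points.
  have hone : ∀ᶠ z in (F : Filter Y), E.value (C.t i j) z * E.value (C.t j i) z = 1 := by
    filter_upwards [hFi, hFj] with z hzi hzj
    have h := C.cocycle i j i
    rw [C.t_self, map_one] at h
    have hz : E.pt z ∈ C.U i ⊓ C.U j := ⟨hzi, hzj⟩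
    have h' := (E.ev_one z hz).symm.trans ((congrArg (E.ev z hz) h).trans
      ((E.ev_mul z hz _ _).trans (congrArg₂ (· * ·) (E.ev_res z _ hz _) (E.ev_res z _ hz _))))
    rw [E.value_eq _ hzi, E.value_eq _ hzj, h']
  have hprod : E.value (C.t i j) y * E.value (C.t j i) y' = 1 :=
    tendsto_nhds_unique (((E.tendsto_value hi _).mono_left hy).mul
      ((E.tendsto_value hj _).mono_left hy')) (tendsto_const_nhds.congr' (hone.mono fun _ h => h.symm))
  have h0 : E.ev y hi (C.t i j) ≠ 0 := by
    rw [← E.value_eq]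
    exact left_ne_zero_of_mul_eq_one hprod
  have hyj : E.pt y ∈ C.U j := by
    have := (E.ev_ne_zero y hi _).mp h0
    rw [C.basicOpen_t] at this
    exact this.2
  refine hext j y y' hyj hj fun a => ?_
  rw [← E.value_eq, ← E.value_eq]
  exact tendsto_nhds_unique ((E.tendsto_value hyj a).mono_left hy)
    ((E.tendsto_value hj a).mono_left hy')

end EvalSpace

end EvalSpace

/-! ### Points of an affine open set in terms of its sections. -/

section AffinePoints

variable {X : Scheme.{u}} {U : X.Opens}

lemma exists_evaluation_eq_zero_iff (hU : IsAffineOpen U) (P : Ideal Γ(X, U)) [P.IsPrime] :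
    ∃ (x : X) (h : x ∈ U), ∀ a, X.evaluation U x h a = 0 ↔ a ∈ P := by
  refine ⟨hU.fromSpec ⟨P, inferInstance⟩, hU.range_fromSpec.le ⟨_, rfl⟩, fun a => ?_⟩
  rw [Scheme.evaluation_eq_zero_iff_notMem_basicOpen]
  have := congrArg (fun V : (Spec Γ(X, U)).Opens => (⟨P, inferInstance⟩ : PrimeSpectrum _) ∈ V)
    (hU.fromSpec_preimage_basicOpen a)
  have h2 : hU.fromSpec ⟨P, inferInstance⟩ ∈ X.basicOpen a ↔ a ∉ P := iff_of_eq this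
  rw [h2, not_not]

/-- Consequently an absolute value or an embedding of the residue field is determined by the
sections over `U`. -/
lemma exists_evaluation_div_eq (hU : IsAffineOpen U) {x : X} (hx : x ∈ U) (z : X.residueField x) :
    ∃ a b : Γ(X, U), X.evaluation U x hx b ≠ 0 ∧
      z = X.evaluation U x hx a / X.evaluation U x hx b := by
  obtain ⟨s, rfl⟩ := X.residue_surjective x z
  obtain ⟨V, hxV, f, rfl⟩ := X.presheaf.exists_germ_eq s
  obtain ⟨g, hgV, hxg⟩ := hU.exists_basicOpen_le ⟨x, hxV⟩ hx
  have := hU.isLocalization_basicOpen g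
  obtain ⟨⟨a, ⟨_, k, rfl⟩⟩, hk⟩ := IsLocalization.surj (Submonoid.powers g) (res hgV f)
  have hk' : res hgV f * res (X.basicOpen_le g) (g ^ k) = res (X.basicOpen_le g) a := hk
  have h0 : X.evaluation U x hx (g ^ k) ≠ 0 := by
    rw [map_pow]
    exact pow_ne_zero _ ((X.evaluation_ne_zero_iff_mem_basicOpen x hx g).mpr hxg)
  refine ⟨a, g ^ k, h0, ?_⟩
  have h1 := congrArg (X.evaluation (X.basicOpen g) x hxg) hk'
  rw [map_mul, eval_res, eval_res, eval_res] at h1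
  rw [eq_div_iff h0, ← h1]
  rfl

/-- The basic open sets of `U` separate points, because the underlying space of a scheme is `T0`. -/
lemma eq_of_evaluation_eq_zero_iff (hU : IsAffineOpen U) {x x' : X} (hx : x ∈ U) (hx' : x' ∈ U)
    (h : ∀ a, X.evaluation U x hx a = 0 ↔ X.evaluation U x' hx' a = 0) : x = x' := by
  have key : ∀ {x x' : X} (hx : x ∈ U) (hx' : x' ∈ U),
      (∀ a, X.evaluation U x hx a = 0 ↔ X.evaluation U x' hx' a = 0) →
      ∀ V : Set X, IsOpen V → x ∈ V → x' ∈ V := by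
    intro x x' hx hx' h V hV hxV
    obtain ⟨g, hgV, hxg⟩ := hU.exists_basicOpen_le (V := ⟨V, hV⟩) ⟨x, hxV⟩ hx
    exact hgV ((X.evaluation_ne_zero_iff_mem_basicOpen x' hx' g).mp
      ((h g).not.mp ((X.evaluation_ne_zero_iff_mem_basicOpen x hx g).mpr hxg)))
  exact (inseparable_iff_forall_isOpen.mpr fun V hV =>
    ⟨key hx hx' h V hV, key hx' hx (fun a => (h a).symm) V hV⟩).eq

end AffinePoints

end Arakelov

namespace Arakelov

/-! ### Extension of valuations and homomorphisms to residue fields. -/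

section Descent

variable {R κ : Type*} [CommRing R] [Field κ] (e : R →+* κ)

/-- The quotient by the kernel has field of fractions `κ`, if `κ` consists of fractions. -/
lemma isFractionRing_quotient_ker (he : ∀ z, ∃ a b, e b ≠ 0 ∧ z = e a / e b) :
    letI := (RingHom.kerLift e).toAlgebra
    IsFractionRing (R ⧸ RingHom.ker e) κ := by
  let _ := (RingHom.kerLift e).toAlgebra
  have : FaithfulSMul (R ⧸ RingHom.ker e) κ :=
    (faithfulSMul_iff_algebraMap_injective _ _).mpr (RingHom.kerLift_injective e)
  refine IsFractionRing.of_field _ _ fun z => ?_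
  obtain ⟨a, b, -, rfl⟩ := he z
  exact ⟨Ideal.Quotient.mk _ a, Ideal.Quotient.mk _ b, rfl⟩

/-- Since the support of `φ` is the kernel of `e`, the valuation descends to the quotient by this
kernel and extends to its field of fractions `κ`. The analogue for ring homomorphisms follows. -/
lemma exists_valuation_extending (he : ∀ z, ∃ a b, e b ≠ 0 ∧ z = e a / e b)
    {Γ₀ : Type*} [LinearOrderedCommGroupWithZero Γ₀] (φ : Valuation R Γ₀)
    (hker : ∀ a, e a = 0 ↔ φ a = 0) : ∃ w : Valuation κ Γ₀, ∀ a, w (e a) = φ a := by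
  let _ := (RingHom.kerLift e).toAlgebra
  have := isFractionRing_quotient_ker e he
  have hJ : RingHom.ker e ≤ φ.supp := fun a ha => (hker a).mp ha
  let ψ := φ.onQuot hJ
  have hS : nonZeroDivisors (R ⧸ RingHom.ker e) ≤ ψ.supp.primeCompl := by
    intro q hq hq'
    obtain ⟨a, rfl⟩ := Ideal.Quotient.mk_surjective q
    have h0 : φ a = 0 := hq'
    have : (Ideal.Quotient.mk (RingHom.ker e)) a = 0 :=
      Ideal.Quotient.eq_zero_iff_mem.mpr ((hker a).mpr h0)
    have hd : IsDomain (R ⧸ RingHom.ker e) := by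
      have := RingHom.ker_isPrime e
      infer_instance
    exact nonZeroDivisors.ne_zero hq this
  refine ⟨ψ.extendToLocalization hS κ, fun a => ?_⟩
  exact ψ.extendToLocalization_apply_map_apply hS κ (Ideal.Quotient.mk _ a)

lemma exists_ringHom_extending (he : ∀ z, ∃ a b, e b ≠ 0 ∧ z = e a / e b)
    {L : Type*} [Field L] (φ : R →+* L)
    (hker : ∀ a, e a = 0 ↔ φ a = 0) : ∃ w : κ →+* L, ∀ a, w (e a) = φ a := by
  let _ := (RingHom.kerLift e).toAlgebra
  have := isFractionRing_quotient_ker e he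
  let ψ : R ⧸ RingHom.ker e →+* L := Ideal.Quotient.lift _ φ fun a ha => (hker a).mp ha
  have hψ : Function.Injective ψ := by
    refine (injective_iff_map_eq_zero _).mpr fun q hq => ?_
    obtain ⟨a, rfl⟩ := Ideal.Quotient.mk_surjective q
    exact Ideal.Quotient.eq_zero_iff_mem.mpr ((hker a).mpr hq)
  exact ⟨IsFractionRing.lift hψ, fun a => IsFractionRing.lift_algebraMap hψ (Ideal.Quotient.mk _ a)⟩

end Descent

/-! ### Compactness and separation of the analytic spaces. -/

noncomputable section AnalyticSpaces

variable {K : Type u} [Field K] {X : Scheme.{u}} (π : X ⟶ Spec (.of K))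

lemma evaluation_constSection {U : X.Opens} {x : X} (h : x ∈ U) (a : K) :
    X.evaluation U x h (constSection π U a) = baseHom π x a :=
  eval_res le_top x h _

/-- Evaluation on the Berkovich space. -/
def finEvalSpace [NumberField K] (𝔭 : HeightOneSpectrum (𝓞 K)) : EvalSpace X ℝ≥0 (FinPt π 𝔭) where
  pt := FinPt.pt
  ev y U h f := y.val (X.evaluation U y.pt h f)
  topology_eq := rfl
  ev_mul y U h f g := by rw [map_mul, map_mul]
  ev_one y U h := by rw [map_one, map_one]
  ev_res y U V h hy f := congrArg y.val (eval_res h _ hy f)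
  ev_ne_zero y U h f := by
    rw [Valuation.ne_zero_iff]
    exact X.evaluation_ne_zero_iff_mem_basicOpen _ _ _

/-- Evaluation on the complex analytic space. -/
def infEvalSpace (σ : K →+* ℂ) : EvalSpace X ℂ (InfPt π σ) where
  pt := InfPt.pt
  ev y U h f := y.emb (X.evaluation U y.pt h f)
  topology_eq := rfl
  ev_mul y U h f g := by rw [map_mul, map_mul]
  ev_one y U h := by rw [map_one, map_one]
  ev_res y U V h hy f := congrArg y.emb (eval_res h _ hy f)
  ev_ne_zero y U h f := by
    rw [map_ne_zero]
    exact X.evaluation_ne_zero_iff_mem_basicOpen _ _ _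

variable {π}

lemma FinPt.ext_of_evaluation [NumberField K] {𝔭 : HeightOneSpectrum (𝓞 K)} {U : X.Opens} (hU : IsAffineOpen U)
    (y y' : FinPt π 𝔭) (h : y.pt ∈ U) (h' : y'.pt ∈ U)
    (e : ∀ a : Γ(X, U), y.val (X.evaluation U y.pt h a) = y'.val (X.evaluation U y'.pt h' a)) :
    y = y' := by
  have hpt : y.pt = y'.pt := eq_of_evaluation_eq_zero_iff hU h h' fun a => by
    rw [← map_eq_zero y.val, e, map_eq_zero]
  obtain ⟨x, w, hw⟩ := y
  obtain ⟨x', w', hw'⟩ := y'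
  obtain rfl : x = x' := hpt
  obtain rfl : w = w' := Valuation.ext fun z => by
    obtain ⟨a, b, -, rfl⟩ := exists_evaluation_div_eq hU h z
    rw [map_div₀, map_div₀]
    exact congrArg₂ (· / ·) (e a) (e b)
  rfl

lemma InfPt.ext_of_evaluation {σ : K →+* ℂ} {U : X.Opens} (hU : IsAffineOpen U)
    (y y' : InfPt π σ) (h : y.pt ∈ U) (h' : y'.pt ∈ U)
    (e : ∀ a : Γ(X, U), y.emb (X.evaluation U y.pt h a) = y'.emb (X.evaluation U y'.pt h' a)) :
    y = y' := by
  have hpt : y.pt = y'.pt := eq_of_evaluation_eq_zero_iff hU h h' fun a => by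
    rw [← map_eq_zero y.emb, e, map_eq_zero]
  obtain ⟨x, w, hw⟩ := y
  obtain ⟨x', w', hw'⟩ := y'
  obtain rfl : x = x' := hpt
  obtain rfl : w = w' := RingHom.ext fun z => by
    obtain ⟨a, b, -, rfl⟩ := exists_evaluation_div_eq hU h z
    rw [map_div₀, map_div₀]
    exact congrArg₂ (· / ·) (e a) (e b)
  rfl

/-- A limit of points of the Berkovich space over an affine open set defines a point. -/
lemma FinPt.exists_of_tendsto [NumberField K] {𝔭 : HeightOneSpectrum (𝓞 K)} {U : X.Opens} (hU : IsAffineOpen U)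
    (F : Ultrafilter (FinPt π 𝔭)) (φ : Γ(X, U) → ℝ≥0) (hF : ∀ᶠ y : FinPt π 𝔭 in F, y.pt ∈ U)
    (hφ : ∀ a, Tendsto ((finEvalSpace π 𝔭).value a) F (𝓝 (φ a))) :
    ∃ (y : FinPt π 𝔭) (h : y.pt ∈ U), ∀ a, y.val (X.evaluation U y.pt h a) = φ a := by
  have hval : ∀ᶠ y in (F : Filter (FinPt π 𝔭)), ∃ h : y.pt ∈ U, ∀ a : Γ(X, U),
      (finEvalSpace π 𝔭).value a y = y.val (X.evaluation U y.pt h a) :=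
    hF.mono fun y h => ⟨h, fun a => (finEvalSpace π 𝔭).value_eq a h⟩
  have hconst : ∀ a : K, φ (constSection π U a) = absFin 𝔭 a := fun a =>
    tendsto_nhds_unique (hφ _) (tendsto_const_nhds.congr' (hval.mono fun y ⟨h, hy⟩ => by
      rw [hy, evaluation_constSection, y.val_base]))
  -- The axioms of a valuation are closed conditions, so the limit satisfies them. Its support is a
  -- prime ideal, which gives the point of `X`.
  let Φ : Valuation Γ(X, U) ℝ≥0 :=
    { toFun := φ
      map_zero' := tendsto_nhds_unique (hφ 0) (tendsto_const_nhds.congr' (hval.mono fun y ⟨h, hy⟩ => by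
        rw [hy, map_zero, map_zero]))
      map_one' := tendsto_nhds_unique (hφ 1) (tendsto_const_nhds.congr' (hval.mono fun y ⟨h, hy⟩ => by
        rw [hy, map_one, map_one]))
      map_mul' := fun a b => tendsto_nhds_unique (hφ _) (((hφ a).mul (hφ b)).congr'
        (hval.mono fun y ⟨h, hy⟩ => by rw [hy, hy, hy, map_mul, map_mul]))
      map_add_le_max' := fun a b => le_of_tendsto_of_tendsto (hφ _) ((hφ a).max (hφ b))
        (hval.mono fun y ⟨h, hy⟩ => by
          beta_reduce
          rw [hy, hy, hy, map_add]
          exact y.val.map_add _ _) }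
  obtain ⟨x, hx, hxP⟩ := exists_evaluation_eq_zero_iff hU Φ.supp
  obtain ⟨w, hw⟩ := exists_valuation_extending (X.evaluation U x hx).hom
    (exists_evaluation_div_eq hU hx) Φ hxP
  refine ⟨⟨x, w, fun a => ?_⟩, hx, hw⟩
  rw [← evaluation_constSection π hx, ← hconst]
  exact hw _

/-- A pointwise limit of ring homomorphisms to `ℂ` is one; its kernel is the prime ideal of the
point sought. -/
lemma InfPt.exists_of_tendsto {σ : K →+* ℂ} {U : X.Opens} (hU : IsAffineOpen U)
    (F : Ultrafilter (InfPt π σ)) (φ : Γ(X, U) → ℂ) (hF : ∀ᶠ y : InfPt π σ in F, y.pt ∈ U)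
    (hφ : ∀ a, Tendsto ((infEvalSpace π σ).value a) F (𝓝 (φ a))) :
    ∃ (y : InfPt π σ) (h : y.pt ∈ U), ∀ a, y.emb (X.evaluation U y.pt h a) = φ a := by
  have hval : ∀ᶠ y in (F : Filter (InfPt π σ)), ∃ h : y.pt ∈ U, ∀ a : Γ(X, U),
      (infEvalSpace π σ).value a y = y.emb (X.evaluation U y.pt h a) :=
    hF.mono fun y h => ⟨h, fun a => (infEvalSpace π σ).value_eq a h⟩
  have hconst : ∀ a : K, φ (constSection π U a) = σ a := fun a =>
    tendsto_nhds_unique (hφ _) (tendsto_const_nhds.congr' (hval.mono fun y ⟨h, hy⟩ => by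
      rw [hy, evaluation_constSection]
      exact (DFunLike.congr_fun y.emb_base a).symm))
  let Φ : Γ(X, U) →+* ℂ :=
    { toFun := φ
      map_zero' := tendsto_nhds_unique (hφ 0) (tendsto_const_nhds.congr' (hval.mono fun y ⟨h, hy⟩ => by
        rw [hy, map_zero, map_zero]))
      map_one' := tendsto_nhds_unique (hφ 1) (tendsto_const_nhds.congr' (hval.mono fun y ⟨h, hy⟩ => by
        rw [hy, map_one, map_one]))
      map_mul' := fun a b => tendsto_nhds_unique (hφ _) (((hφ a).mul (hφ b)).congr'
        (hval.mono fun y ⟨h, hy⟩ => by rw [hy, hy, hy, map_mul, map_mul]))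
      map_add' := fun a b => tendsto_nhds_unique (hφ _) (((hφ a).add (hφ b)).congr'
        (hval.mono fun y ⟨h, hy⟩ => by rw [hy, hy, hy, map_add, map_add])) }
  have : (RingHom.ker Φ).IsPrime := RingHom.ker_isPrime Φ
  obtain ⟨x, hx, hxP⟩ := exists_evaluation_eq_zero_iff hU (RingHom.ker Φ)
  obtain ⟨w, hw⟩ := exists_ringHom_extending (X.evaluation U x hx).hom
    (exists_evaluation_div_eq hU hx) Φ hxP
  refine ⟨⟨x, w, RingHom.ext fun a => ?_⟩, hx, hw⟩
  rw [RingHom.comp_apply, ← evaluation_constSection π hx, ← hconst]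
  exact hw _

variable [NumberField K]

/-- The part of the chart `U i` where the coordinates `T j / T i` have absolute value `≤ 1`. -/
def ProjCharts.polydisc {n : ℕ} (C : ProjCharts π n) (v : Place K) (i : Fin (n + 1)) : Set (An π v) :=
  {y | ∃ h : y.pt ∈ C.U i, ∀ j, y.absAt h (C.t i j) ≤ 1}

lemma An.abs_nonneg {v : Place K} (y : An π v) (a : X.residueField y.pt) : 0 ≤ y.abs a := by
  cases v
  · exact NNReal.coe_nonneg _
  · exact norm_nonneg _

lemma An.abs_add_le {v : Place K} (y : An π v) (a b : X.residueField y.pt) :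
    y.abs (a + b) ≤ y.abs a + y.abs b := by
  cases v
  · refine le_trans (NNReal.coe_le_coe.mpr ((FinPt.val y).map_add a b)) ?_
    rw [NNReal.coe_max]
    exact max_le_add_of_nonneg (NNReal.coe_nonneg _) (NNReal.coe_nonneg _)
  · exact (congrArg norm (map_add (InfPt.emb y) a b)).le.trans (norm_add_le _ _)

lemma An.abs_neg {v : Place K} (y : An π v) (a : X.residueField y.pt) :
    y.abs (-a) = y.abs a := by
  cases v
  · exact congrArg NNReal.toReal ((FinPt.val y).map_neg a)
  · exact (congrArg norm (map_neg (InfPt.emb y) a)).trans (norm_neg _)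

lemma An.abs_zero {v : Place K} (y : An π v) : y.abs 0 = 0 := by
  cases v
  · exact congrArg NNReal.toReal (map_zero (FinPt.val y))
  · exact (congrArg norm (map_zero (InfPt.emb y))).trans norm_zero

lemma An.exists_abs_baseHom (v : Place K) (a : K) :
    ∃ c : ℝ, ∀ y : An π v, y.abs (baseHom π y.pt a) = c := by
  rcases v with 𝔭 | σ
  · exact ⟨absFin 𝔭 a, fun y => congrArg NNReal.toReal (FinPt.val_base y a)⟩
  · exact ⟨‖σ a‖, fun y => congrArg norm (DFunLike.congr_fun (InfPt.emb_base y) a)⟩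

/-- Dividing by the homogeneous coordinate of largest absolute value makes all the quotients at most
`1`. -/
lemma ProjCharts.exists_mem_polydisc {n : ℕ} (C : ProjCharts π n) (v : Place K) (y : An π v) :
    ∃ i, y ∈ C.polydisc v i := by
  obtain ⟨i₀, h₀⟩ := C.exists_mem y.pt
  obtain ⟨i, hi⟩ := Finite.exists_max fun i => y.absAt h₀ (C.t i₀ i)
  have hpos : 0 < y.absAt h₀ (C.t i₀ i) := by
    -- The maximum is at least the value `1` of `T i₀ / T i₀`; in particular the coordinate `T i`
    -- does not vanish at `y`.
    refine lt_of_lt_of_le ?_ (hi i₀)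
    rw [C.t_self, An.absAt_one]
    exact one_pos
  have hne : X.evaluation (C.U i₀) y.pt h₀ (C.t i₀ i) ≠ 0 := by
    intro h
    rw [An.absAt, h, An.abs_zero] at hpos
    exact lt_irrefl _ hpos
  have hmem : y.pt ∈ C.U i := by
    have := (X.evaluation_ne_zero_iff_mem_basicOpen _ _ _).mp hne
    rw [C.basicOpen_t] at this
    exact this.2
  refine ⟨i, hmem, fun j => ?_⟩
  have hm : y.pt ∈ C.U i₀ ⊓ C.U i := ⟨h₀, hmem⟩
  have h := (An.absAt_res y inf_le_left hm _).symm.trans ((congrArg (y.absAt hm)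
    (C.cocycle i₀ i j)).trans ((An.absAt_mul y hm _ _).trans (congrArg₂ (· * ·)
      (An.absAt_res y inf_le_left hm _) (An.absAt_res y inf_le_right hm _))))
  have hj := h.symm.trans_le (hi j)
  exact le_of_mul_le_mul_left (by rwa [mul_one]) hpos

/-- Constants have an absolute value that depends only on `v`, the coordinates are bounded by `1`,
and boundedness is preserved by the ring operations. -/
lemma ProjCharts.exists_bound {n : ℕ} (C : ProjCharts π n) (v : Place K) (i : Fin (n + 1))
    (a : Γ(X, C.U i)) :
    ∃ c : ℝ, ∀ y ∈ C.polydisc v i, ∀ h : y.pt ∈ C.U i, y.absAt h a ≤ c := by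
  have ha : a ∈ Subring.closure (Set.range (constSection π (C.U i)) ∪ Set.range (C.t i)) :=
    C.closure_eq_top i ▸ trivial
  induction ha using Subring.closure_induction with
  | mem a ha =>
    rcases ha with ⟨b, rfl⟩ | ⟨j, rfl⟩
    · obtain ⟨c, hc⟩ := An.exists_abs_baseHom (π := π) v b
      exact ⟨c, fun y _ h => by rw [An.absAt, evaluation_constSection, hc]⟩
    · exact ⟨1, fun y hy h => hy.2 j⟩
  | zero => exact ⟨0, fun y _ h => by rw [An.absAt, map_zero, An.abs_zero]⟩
  | one => exact ⟨1, fun y _ h => by rw [An.absAt_one]⟩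
  | add a b _ _ ha hb =>
    obtain ⟨c, hc⟩ := ha
    obtain ⟨d, hd⟩ := hb
    refine ⟨c + d, fun y hy h => ?_⟩
    rw [An.absAt, map_add]
    exact (y.abs_add_le _ _).trans (add_le_add (hc y hy h) (hd y hy h))
  | neg a _ ha =>
    obtain ⟨c, hc⟩ := ha
    refine ⟨c, fun y hy h => ?_⟩
    rw [An.absAt, map_neg, An.abs_neg]
    exact hc y hy h
  | mul a b _ _ ha hb =>
    obtain ⟨c, hc⟩ := ha
    obtain ⟨d, hd⟩ := hb
    refine ⟨c * d, fun y hy h => ?_⟩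
    rw [An.absAt_mul]
    exact mul_le_mul (hc y hy h) (hd y hy h) (y.abs_nonneg _) ((y.abs_nonneg _).trans (hc y hy h))

/-- The analytic spaces of a projective scheme are compact. -/
lemma compactSpace_An (hπ : IsProjective π) (v : Place K) : CompactSpace (An π v) := by
  obtain ⟨n, ⟨C⟩⟩ := exists_projCharts hπ
  rcases v with 𝔭 | σ
  · refine (finEvalSpace π 𝔭).compactSpace C.isAffineOpen (C.polydisc (.fin 𝔭))
      (C.exists_mem_polydisc (.fin 𝔭)) (fun i y hy => hy.1) (fun i a => ?_)
      fun i F φ hF hφ => FinPt.exists_of_tendsto (C.isAffineOpen i) F φ hF hφ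
    obtain ⟨c, hc⟩ := C.exists_bound (.fin 𝔭) i a
    refine ⟨Set.Icc 0 c.toNNReal, isCompact_Icc, fun y hy => ?_⟩
    rw [(finEvalSpace π 𝔭).value_eq a hy.1]
    exact ⟨zero_le, NNReal.le_toNNReal_of_coe_le (hc y hy hy.1)⟩
  · refine (infEvalSpace π σ).compactSpace C.isAffineOpen (C.polydisc (.inf σ))
      (C.exists_mem_polydisc (.inf σ)) (fun i y hy => hy.1) (fun i a => ?_)
      fun i F φ hF hφ => InfPt.exists_of_tendsto (C.isAffineOpen i) F φ hF hφ
    obtain ⟨c, hc⟩ := C.exists_bound (.inf σ) i a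
    refine ⟨Metric.closedBall 0 c, isCompact_closedBall _ _, fun y hy => ?_⟩
    rw [(infEvalSpace π σ).value_eq a hy.1, mem_closedBall_zero_iff]
    exact hc y hy hy.1

/-- The analytic spaces of a projective scheme are separated. -/
lemma t2Space_An (hπ : IsProjective π) (v : Place K) : T2Space (An π v) := by
  obtain ⟨n, ⟨C⟩⟩ := exists_projCharts hπ
  rcases v with 𝔭 | σ
  · exact (finEvalSpace π 𝔭).t2Space C fun i => FinPt.ext_of_evaluation (C.isAffineOpen i)
  · exact (infEvalSpace π σ).t2Space C fun i => InfPt.ext_of_evaluation (C.isAffineOpen i)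

end AnalyticSpaces

end Arakelov

namespace Arakelov

/-! ### Embeddings of finite extensions, and norms. -/

noncomputable section Embeddings

variable {F κ E : Type*} [Field F] [Field κ] [Field E]

/-- The extensions of `g : F →+* E` to an extension `κ` of `F`, as homomorphisms of `F`-algebras. -/
def extensionEquiv (f : F →+* κ) (g : F →+* E) :
    letI := f.toAlgebra
    letI := g.toAlgebra
    {τ : κ →+* E // τ.comp f = g} ≃ (κ →ₐ[F] E) :=
  letI := f.toAlgebra
  letI := g.toAlgebra
  { toFun := fun τ => { τ.1 with commutes' := fun a => DFunLike.congr_fun τ.2 a }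
    invFun := fun τ => ⟨τ.toRingHom, τ.comp_algebraMap⟩
    left_inv := fun _ => rfl
    right_inv := fun _ => rfl }

/-- The norm of a finite extension of fields. -/
def fieldNorm (f : F →+* κ) : κ →* F :=
  letI := f.toAlgebra
  Algebra.norm F

variable {f : F →+* κ} (g : F →+* E)

lemma finite_extensions (hf : f.Finite) : Finite {τ : κ →+* E // τ.comp f = g} := by
  let _ := f.toAlgebra
  let _ := g.toAlgebra
  have : Module.Finite F κ := hf
  exact Finite.of_equiv _ (extensionEquiv f g).symm

lemma natCard_extensions [CharZero F] [IsAlgClosed E] (hf : f.Finite) :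
    letI := f.toAlgebra
    Nat.card {τ : κ →+* E // τ.comp f = g} = Module.finrank F κ := by
  let _ := f.toAlgebra
  let _ := g.toAlgebra
  have : Module.Finite F κ := hf
  rw [Nat.card_congr (extensionEquiv f g), Nat.card_eq_fintype_card, AlgHom.card]

lemma map_fieldNorm [CharZero F] [IsAlgClosed E] (hf : f.Finite)
    [Fintype {τ : κ →+* E // τ.comp f = g}] (a : κ) :
    g (fieldNorm f a) = ∏ τ : {τ : κ →+* E // τ.comp f = g}, τ.1 a := by
  let _ := f.toAlgebra
  let _ := g.toAlgebra
  have : Module.Finite F κ := hf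
  exact (Algebra.norm_eq_prod_embeddings F E a).trans
    (Fintype.prod_equiv (extensionEquiv f g) _ _ fun _ => rfl).symm

lemma fieldNorm_ne_zero (hf : f.Finite) {a : κ} (ha : a ≠ 0) : fieldNorm f a ≠ 0 := by
  let _ := f.toAlgebra
  have : Module.Finite F κ := hf
  exact Algebra.norm_ne_zero_iff.mpr ha

/-- The norm is the product over the embeddings. This turns a sum over conjugates into the absolute
value of one element of the base field, the same for all places. -/
lemma finsum_log_norm_extension {E : Type*} [NormedField E] [CharZero F] [IsAlgClosed E]
    (g : F →+* E) (hf : f.Finite) {a : κ} (ha : a ≠ 0) :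
    ∑ᶠ τ : {τ : κ →+* E // τ.comp f = g}, Real.log ‖τ.1 a‖ = Real.log ‖g (fieldNorm f a)‖ := by
  have := finite_extensions g hf
  let _ := Fintype.ofFinite {τ : κ →+* E // τ.comp f = g}
  rw [finsum_eq_sum_of_fintype, map_fieldNorm g hf, norm_prod, Real.log_prod]
  exact fun τ _ => norm_ne_zero_iff.mpr ((map_ne_zero _).mpr ha)

end Embeddings

/-! ### The product formula. -/

noncomputable section ProductFormula

section Injective

variable {K : Type u} [Field K]

lemma Place.fin_injective : Function.Injective (Place.fin (K := K)) := fun _ _ h => by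
  injection h

lemma Place.inf_injective : Function.Injective (Place.inf (K := K)) := fun _ _ h => by
  injection h

end Injective

variable {K : Type u} [Field K] [NumberField K]

/-- The absolute value of `K` at a place. -/
def Place.abs : Place K → K → ℝ
  | .fin 𝔭, a => absFin 𝔭 a
  | .inf σ, a => ‖σ a‖

lemma absFin_eq_adicAbv (𝔭 : HeightOneSpectrum (𝓞 K)) (a : K) :
    (absFin 𝔭 a : ℝ) = HeightOneSpectrum.adicAbv 𝔭 (one_lt_resChar 𝔭) a := rfl

lemma absNorm_eq_resChar_pow (𝔭 : HeightOneSpectrum (𝓞 K)) :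
    Ideal.absNorm 𝔭.asIdeal = resChar 𝔭 ^ resDegree 𝔭 := by
  have : Finite (𝓞 K ⧸ 𝔭.asIdeal) := 𝔭.asIdeal.finiteQuotientOfFreeOfNeBot 𝔭.ne_bot
  have hp : (resChar 𝔭).Prime := by
    have : 𝔭.asIdeal.IsMaximal := 𝔭.isMaximal
    let _ : Field (𝓞 K ⧸ 𝔭.asIdeal) := Ideal.Quotient.field _
    have : CharP (𝓞 K ⧸ 𝔭.asIdeal) (resChar 𝔭) := ringChar.charP _
    exact (CharP.char_is_prime_or_zero (𝓞 K ⧸ 𝔭.asIdeal) (resChar 𝔭)).resolve_right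
      (CharP.char_ne_zero_of_finite (𝓞 K ⧸ 𝔭.asIdeal) _)
  have : Fact (resChar 𝔭).Prime := ⟨hp⟩
  have : CharP (𝓞 K ⧸ 𝔭.asIdeal) (resChar 𝔭) := ringChar.charP _
  let _ : Algebra (ZMod (resChar 𝔭)) (𝓞 K ⧸ 𝔭.asIdeal) := ZMod.algebra _ (resChar 𝔭)
  have h := Module.natCard_eq_pow_finrank (K := ZMod (resChar 𝔭)) (V := 𝓞 K ⧸ 𝔭.asIdeal)
  rw [Nat.card_zmod] at h
  exact h

/-- The left side is normalised by the residue characteristic `p`, the right side by the cardinality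
`p ^ n_𝔭` of the residue field; the weight `n_𝔭` compensates for this. For `a = 0` both logarithms
are `0`. -/
lemma resDegree_mul_log_absFin (𝔭 : HeightOneSpectrum (𝓞 K)) (a : K) :
    (resDegree 𝔭 : ℝ) * Real.log (absFin 𝔭 a) = Real.log ‖FinitePlace.embedding 𝔭 a‖ := by
  rw [FinitePlace.norm_embedding, HeightOneSpectrum.adicAbv_def]
  rw [absFin, HeightOneSpectrum.adicAbvDef]
  by_cases h : 𝔭.valuation K a = 0
  · simp [h]
  · rw [WithZeroMulInt.toNNReal_neg_apply _ h, WithZeroMulInt.toNNReal_neg_apply _ h]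
    rw [NNReal.coe_zpow, NNReal.coe_zpow, Real.log_zpow, Real.log_zpow, absNorm_eq_resChar_pow]
    push_cast
    rw [Real.log_pow]
    ring

lemma finite_setOf_mem_asIdeal {t : 𝓞 K} (ht : t ≠ 0) :
    {𝔭 : HeightOneSpectrum (𝓞 K) | t ∈ 𝔭.asIdeal}.Finite := by
  have h : Ideal.span {t} ≠ 0 := by simpa using ht
  refine (Ideal.finite_factors h).subset fun 𝔭 hp => ?_
  exact Ideal.dvd_span_singleton.mpr hp

/-- Only the primes that divide the numerator or the denominator of `b` contribute. -/
lemma finite_support_log_absFin {b : K} (hb : b ≠ 0) :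
    (Function.support fun 𝔭 : HeightOneSpectrum (𝓞 K) => Real.log (absFin 𝔭 b)).Finite := by
  obtain ⟨r, s, hs, rfl⟩ := IsFractionRing.div_surjective (𝓞 K) b
  have hs : s ≠ 0 := nonZeroDivisors.ne_zero hs
  have hr : r ≠ 0 := by
    rintro rfl
    simp at hb
  refine ((finite_setOf_mem_asIdeal hr).union (finite_setOf_mem_asIdeal hs)).subset fun 𝔭 h => ?_
  by_contra! h'
  simp only [Set.mem_union, Set.mem_ofPred_eq, not_or] at h'
  refine h ?_
  simp only [absFin_eq_adicAbv, map_div₀]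
  rw [HeightOneSpectrum.adicAbv_coe_eq_one_iff _ _ _ |>.mpr h'.1,
    HeightOneSpectrum.adicAbv_coe_eq_one_iff _ _ _ |>.mpr h'.2, div_one, Real.log_one]

/-- A function on the places has finite support if its restriction to the finite places has. -/
lemma Place.finite_support {f : Place K → ℝ}
    (hf : (Function.support fun 𝔭 => f (.fin 𝔭)).Finite) : (Function.support f).Finite := by
  refine ((hf.image Place.fin).union (Set.finite_range Place.inf)).subset fun v hv => ?_
  rcases v with 𝔭 | σ
  · exact Or.inl ⟨𝔭, hv, rfl⟩
  · exact Or.inr ⟨σ, rfl⟩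

lemma Place.finsum_eq {f : Place K → ℝ} (hf : (Function.support f).Finite) :
    ∑ᶠ v, f v = ∑ᶠ 𝔭, f (.fin 𝔭) + ∑ᶠ σ, f (.inf σ) := by
  have hu : (Set.univ : Set (Place K)) = Set.range Place.fin ∪ Set.range Place.inf := by
    ext v
    rcases v with 𝔭 | σ <;> simp
  have hd : Disjoint (Set.range (Place.fin (K := K))) (Set.range Place.inf) := by
    rw [Set.disjoint_left]
    rintro _ ⟨𝔭, rfl⟩ ⟨σ, h⟩
    cases h
  rw [← finsum_mem_univ, hu, finsum_mem_union' hd (hf.subset Set.inter_subset_right)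
    (hf.subset Set.inter_subset_right), finsum_mem_range Place.fin_injective,
    finsum_mem_range Place.inf_injective]

lemma finite_support_log_abs {b : K} (hb : b ≠ 0) :
    (Function.support fun v : Place K => Real.log (v.abs b)).Finite :=
  Place.finite_support (finite_support_log_absFin hb)

lemma finsum_log_absFin {b : K} (hb : b ≠ 0) :
    ∑ᶠ 𝔭 : HeightOneSpectrum (𝓞 K), (resDegree 𝔭 : ℝ) * Real.log (absFin 𝔭 b) =
      Real.log (|Algebra.norm ℚ b|⁻¹ : ℚ) := by
  rw [← FinitePlace.prod_eq_inv_abs_norm hb,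
    ← finprod_comp_equiv FinitePlace.equivHeightOneSpectrum.symm]
  have hpos : ∀ 𝔭 : HeightOneSpectrum (𝓞 K), ‖FinitePlace.embedding 𝔭 b‖ ≠ 0 := fun 𝔭 =>
    norm_ne_zero_iff.mpr ((map_ne_zero _).mpr hb)
  have hs := finite_support_log_absFin hb
  have hm : Function.mulSupport
      (fun 𝔭 => FinitePlace.equivHeightOneSpectrum.symm 𝔭 b) ⊆ hs.toFinset := by
    intro 𝔭 h𝔭
    rw [hs.coe_toFinset]
    refine fun h0 => h𝔭 ?_
    have h1 := resDegree_mul_log_absFin 𝔭 b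
    rw [show Real.log (absFin 𝔭 b) = 0 from h0, mul_zero] at h1
    refine (FinitePlace.equivHeightOneSpectrum_symm_apply 𝔭 b).trans ?_
    exact Real.eq_one_of_pos_of_log_eq_zero ((norm_nonneg _).lt_of_ne' (hpos 𝔭)) h1.symm
  rw [finprod_eq_prod_of_mulSupport_subset _ hm, Real.log_prod fun 𝔭 _ => by
    rw [FinitePlace.equivHeightOneSpectrum_symm_apply]; exact hpos 𝔭]
  rw [finsum_eq_sum_of_support_subset (s := hs.toFinset)]
  · refine Finset.sum_congr rfl fun 𝔭 _ => ?_
    rw [resDegree_mul_log_absFin, FinitePlace.equivHeightOneSpectrum_symm_apply]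
  · rw [hs.coe_toFinset]
    exact fun 𝔭 h h0 => h (mul_eq_zero_of_right _ h0)

/-- The sum runs over embeddings, so a complex place is counted by its two embeddings, and the
weight `n_σ = 1` is the right one. -/
lemma finsum_log_norm_embedding {b : K} (hb : b ≠ 0) :
    ∑ᶠ σ : K →+* ℂ, Real.log ‖σ b‖ = Real.log (|Algebra.norm ℚ b| : ℚ) := by
  have h := congrArg norm (Algebra.norm_eq_prod_embeddings ℚ ℂ b)
  rw [norm_prod, ← Fintype.prod_equiv (RingHom.equivRatAlgHom K ℂ) (fun f => ‖f b‖)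
      (fun φ => ‖φ b‖) fun _ => by simp [RingHom.equivRatAlgHom_apply]] at h
  rw [finsum_eq_sum_of_fintype, ← Real.log_prod fun σ _ => norm_ne_zero_iff.mpr ((map_ne_zero _).mpr hb),
    ← h, eq_ratCast, Rat.cast_abs, ← Real.norm_eq_abs, ← Complex.norm_real, Complex.ofReal_ratCast]

/-- The product formula. -/
lemma finsum_n_mul_log_abs {b : K} (hb : b ≠ 0) :
    ∑ᶠ v : Place K, (v.n : ℝ) * Real.log (v.abs b) = 0 := by
  rw [Place.finsum_eq ((finite_support_log_abs hb).subset fun v h h0 => h (mul_eq_zero_of_right _ h0))]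
  have h1 : ∑ᶠ σ : K →+* ℂ, (((Place.inf σ).n : ℕ) : ℝ) * Real.log ((Place.inf σ).abs b) =
      ∑ᶠ σ : K →+* ℂ, Real.log ‖σ b‖ :=
    finsum_congr fun σ => by simp [Place.n, Place.abs]
  refine (congrArg₂ (· + ·) (finsum_log_absFin hb) (h1.trans (finsum_log_norm_embedding hb))).trans ?_
  rw [Rat.cast_inv, Real.log_inv, neg_add_cancel]

end ProductFormula

/-! ### Residue fields of algebraic points. -/

noncomputable section ResidueField

variable {K : Type u} [Field K] {X : Scheme.{u}} (π : X ⟶ Spec (.of K))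

lemma fromSpecResidueField_appTop (x : X) :
    (X.fromSpecResidueField x).appTop =
      X.evaluation ⊤ x trivial ≫ (Scheme.ΓSpecIso (X.residueField x)).inv := by
  rw [Scheme.fromSpecResidueField, Scheme.Hom.comp_appTop, Scheme.fromSpecStalk_appTop]
  change _ = (X.presheaf.germ ⊤ x trivial ≫ X.residue x) ≫ _
  simp only [Category.assoc]
  rw [Scheme.ΓSpecIso_inv_naturality]
  rfl

lemma fromSpecResidueField_comp (x : X) :
    X.fromSpecResidueField x ≫ π = Spec.map (CommRingCat.ofHom (baseHom π x)) := by
  refine ext_of_isAffine ?_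
  rw [Scheme.Hom.comp_appTop, fromSpecResidueField_appTop, ← cancel_epi (Scheme.ΓSpecIso (.of K)).inv,
    ← Scheme.ΓSpecIso_inv_naturality]
  simp only [baseHom, ← Category.assoc]
  rfl

/-- An algebraic point defines an embedding of its residue field in the algebraic closure. -/
lemma AlgPoint.exists_comp_baseHom [NumberField K] {π : X ⟶ Spec (.of K)} (x : AlgPoint π) :
    ∃ d : X.residueField x.pt →+* AlgebraicClosure K,
      d.comp (baseHom π x.pt) = algebraMap K (AlgebraicClosure K) := by
  let d := Scheme.descResidueField (Scheme.stalkClosedPointTo x.1)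
  refine ⟨d.hom, ?_⟩
  have h := Scheme.descResidueField_stalkClosedPointTo_fromSpecResidueField _ X x.1
  have h2 := congrArg (· ≫ π) h
  dsimp only at h2
  rw [x.2, Category.assoc, fromSpecResidueField_comp, ← Spec.map_comp] at h2
  exact congrArg CommRingCat.Hom.hom (Spec.map_injective h2)

/-- The residue field embeds in the algebraic closure of `K`, and it is generated over `K` by the
finitely many values of the coordinates of a chart. Without finiteness, the degree, defined by
`finrank`, would be `0`. -/
lemma AlgPoint.finite_baseHom [NumberField K] {π : X ⟶ Spec (.of K)} (hπ : IsProjective π)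
    (x : AlgPoint π) : (baseHom π x.pt).Finite := by
  obtain ⟨n, ⟨C⟩⟩ := exists_projCharts hπ
  obtain ⟨i, hi⟩ := C.exists_mem x.pt
  obtain ⟨d, hd⟩ := x.exists_comp_baseHom
  let _ := (baseHom π x.pt).toAlgebra
  let e := (X.evaluation (C.U i) x.pt hi).hom
  have halg : ∀ z : X.residueField x.pt, IsIntegral K z := fun z => by
    let d' : X.residueField x.pt →ₐ[K] AlgebraicClosure K :=
      { d with commutes' := fun a => DFunLike.congr_fun hd a }
    exact (isIntegral_algHom_iff d' d.injective).mp (Algebra.IsIntegral.isIntegral (d z))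
  let S : Set (X.residueField x.pt) := Set.range fun j => e (C.t i j)
  have hmem : ∀ a : Γ(X, C.U i), e a ∈ IntermediateField.adjoin K S := fun a => by
    have ha : a ∈ Subring.closure (Set.range (constSection π (C.U i)) ∪ Set.range (C.t i)) :=
      C.closure_eq_top i ▸ trivial
    have hle : Subring.closure (Set.range (constSection π (C.U i)) ∪ Set.range (C.t i)) ≤
        (IntermediateField.adjoin K S).toSubring.comap e := by
      refine Subring.closure_le.mpr ?_
      rintro _ (⟨b, rfl⟩ | ⟨j, rfl⟩)
      · have h := (IntermediateField.adjoin K S).algebraMap_mem b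
        exact (congrArg (· ∈ IntermediateField.adjoin K S) (evaluation_constSection π hi b)).mpr h
      · exact IntermediateField.subset_adjoin K S ⟨j, rfl⟩
    exact hle ha
  have htop : IntermediateField.adjoin K S = ⊤ := by
    refine eq_top_iff.mpr fun z _ => ?_
    obtain ⟨a, b, -, rfl⟩ := exists_evaluation_div_eq (C.isAffineOpen i) hi z
    exact (IntermediateField.adjoin K S).div_mem (hmem a) (hmem b)
  have hfin := IntermediateField.finiteDimensional_adjoin (S := Set.range fun j => e (C.t i j))
    (K := K) fun z _ => halg z
  change FiniteDimensional K (IntermediateField.adjoin K S) at hfin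
  rw [htop] at hfin
  exact Module.Finite.equiv IntermediateField.topEquiv.toLinearEquiv

end ResidueField

end Arakelov

namespace Arakelov

lemma AlgPoint.degree_pos {K : Type u} [Field K] {X : Scheme.{u}} {π : X ⟶ Spec (.of K)}
    {x : AlgPoint π} (hx : (baseHom π x.pt).Finite) : 0 < x.degree := by
  let _ := (baseHom π x.pt).toAlgebra
  have : Module.Finite K (X.residueField x.pt) := hx
  exact Module.finrank_pos

/-! ### Local contributions to heights; additivity and invariance under isometry. -/

noncomputable section LocalSums

variable {K : Type u} [Field K] [NumberField K] {X : Scheme.{u}} {π : X ⟶ Spec (.of K)}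

instance (𝔭 : HeightOneSpectrum (𝓞 K)) : IsAlgClosed (LocalClosure 𝔭) :=
  inferInstanceAs (IsAlgClosed (AlgebraicClosure (LocalField 𝔭)))

lemma AlgPoint.finite_emb {x : AlgPoint π} (hx : (baseHom π x.pt).Finite) (v : Place K) :
    Finite (x.Emb v) := by
  rcases v with 𝔭 | σ
  · exact finite_extensions (toLocalClosure 𝔭) hx
  · exact finite_extensions σ hx

lemma AlgPoint.natCard_emb {x : AlgPoint π} (hx : (baseHom π x.pt).Finite) (v : Place K) :
    Nat.card (x.Emb v) = x.degree := by
  rcases v with 𝔭 | σ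
  · exact natCard_extensions (toLocalClosure 𝔭) hx
  · exact natCard_extensions σ hx

lemma AlgPoint.mem_conjugate (x : AlgPoint π) {v : Place K} (τ : x.Emb v) {U : X.Opens}
    (h : x.pt ∈ U) : (x.conjugate τ).pt ∈ U := by
  rwa [x.conjugate_pt]

lemma AlgPoint.finsum_log_absAt {x : AlgPoint π} (hx : (baseHom π x.pt).Finite) {U : X.Opens}
    (h : x.pt ∈ U) (f : Γ(X, U)) (hf : X.evaluation U x.pt h f ≠ 0) (v : Place K) :
    ∑ᶠ τ : x.Emb v, Real.log ((x.conjugate τ).absAt (x.mem_conjugate τ h) f) =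
      Real.log (v.abs (fieldNorm (baseHom π x.pt) (X.evaluation U x.pt h f))) := by
  rcases v with 𝔭 | σ
  · refine (finsum_log_norm_extension (toLocalClosure 𝔭) hx hf).trans ?_
    rw [← coe_nnnorm, nnnorm_toLocalClosure]
    rfl
  · exact finsum_log_norm_extension σ hx hf

/-- The contribution of the place `v` to the height. -/
def MetrizedLineBundle.localSum (L : MetrizedLineBundle π) (x : AlgPoint π) (v : Place K) : ℝ :=
  ∑ᶠ τ : x.Emb v, Real.log (L.norm v x.pt (x.conjugate τ) (x.mem_conjugate τ (L.mem _)))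

lemma Place.finite_support_n_mul {f : Place K → ℝ}
    (hf : (Function.support f).Finite) :
    (Function.support fun v => (v.n : ℝ) * f v).Finite :=
  hf.subset fun _ h h0 => h (mul_eq_zero_of_right _ h0)

/-- Only finitely many places contribute to the height. -/
def MetrizedLineBundle.HasFiniteSupport (L : MetrizedLineBundle π) (x : AlgPoint π) : Prop :=
  (Function.support (L.localSum x)).Finite

namespace MetrizedLineBundle

lemma height_eq (L : MetrizedLineBundle π) (x : AlgPoint π) :
    L.height x = -((Module.finrank ℚ K * x.degree : ℕ) : ℝ)⁻¹ *
      ∑ᶠ v : Place K, (v.n : ℝ) * L.localSum x v := rfl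

variable {x : AlgPoint π}

/-- A change of frame by `f` contributes the logarithm of the absolute value of the norm of `f(x)`.
-/
lemma localSum_eq_add_of_norm_eq (hx : (baseHom π x.pt).Finite) {L L' : MetrizedLineBundle π} {U : X.Opens} (h : x.pt ∈ U)
    (f : Γ(X, U)) (hf : X.evaluation U x.pt h f ≠ 0) (v : Place K)
    (hn : ∀ τ : x.Emb v, L.norm v x.pt (x.conjugate τ) (x.mem_conjugate τ (L.mem _)) =
      (x.conjugate τ).absAt (x.mem_conjugate τ h) f *
        L'.norm v x.pt (x.conjugate τ) (x.mem_conjugate τ (L'.mem _))) :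
    L.localSum x v = Real.log (v.abs (fieldNorm (baseHom π x.pt) (X.evaluation U x.pt h f))) +
      L'.localSum x v := by
  have := x.finite_emb hx v
  rw [localSum, ← AlgPoint.finsum_log_absAt hx h f hf, localSum,
    ← finsum_add_distrib (Set.toFinite _) (Set.toFinite _)]
  refine finsum_congr fun τ => ?_
  have h0 := L.norm_pos v x.pt (x.conjugate τ) (x.mem_conjugate τ (L.mem _))
  rw [hn] at h0 ⊢
  rw [Real.log_mul (left_ne_zero_of_mul h0.ne') (right_ne_zero_of_mul h0.ne')]

lemma Isometric.exists_localSum_eq (hx : (baseHom π x.pt).Finite) {L L' : MetrizedLineBundle π}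
    (h : Isometric L L') :
    ∃ b : K, b ≠ 0 ∧ ∀ v, L.localSum x v = Real.log (v.abs b) + L'.localSum x v := by
  obtain ⟨φ, hφ⟩ := h
  have hne : X.evaluation (φ.V x.pt) x.pt (φ.mem x.pt) (φ.h x.pt) ≠ 0 :=
    ((φ.isUnit x.pt).map (X.evaluation (φ.V x.pt) x.pt (φ.mem x.pt)).hom).ne_zero
  exact ⟨_, fieldNorm_ne_zero hx hne, fun v => localSum_eq_add_of_norm_eq hx (φ.mem x.pt)
    (φ.h x.pt) hne v fun τ => hφ v x.pt _ _⟩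

lemma Isometric.hasFiniteSupport (hx : (baseHom π x.pt).Finite) {L L' : MetrizedLineBundle π}
    (h : Isometric L L') (hL' : L'.HasFiniteSupport x) : L.HasFiniteSupport x := by
  obtain ⟨b, hb, hv⟩ := h.exists_localSum_eq hx
  refine ((finite_support_log_abs hb).union hL').subset fun v h0 => ?_
  by_contra! h1
  rw [Set.mem_union, not_or] at h1
  refine h0 ?_
  rw [hv, Function.notMem_support.mp h1.1, Function.notMem_support.mp h1.2, add_zero]

/-- The local sums differ by the `log |b|_v` of a single `b` in `K`, and the product formula makes
the total change `0`. Finite support is needed to split the sum over the places. -/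
lemma Isometric.height_eq (hx : (baseHom π x.pt).Finite) {L L' : MetrizedLineBundle π}
    (h : Isometric L L') (hL' : L'.HasFiniteSupport x) : L.height x = L'.height x := by
  obtain ⟨b, hb, hv⟩ := h.exists_localSum_eq hx
  rw [MetrizedLineBundle.height_eq, MetrizedLineBundle.height_eq]
  simp only [hv, mul_add]
  rw [finsum_add_distrib (Place.finite_support_n_mul (finite_support_log_abs hb))
    (Place.finite_support_n_mul hL'), finsum_n_mul_log_abs hb, zero_add]

lemma localSum_tensor (hx : (baseHom π x.pt).Finite) (L M : MetrizedLineBundle π) (v : Place K) :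
    (L.tensor M).localSum x v = L.localSum x v + M.localSum x v := by
  have := x.finite_emb hx v
  rw [localSum, localSum, localSum, ← finsum_add_distrib (Set.toFinite _) (Set.toFinite _)]
  exact finsum_congr fun τ => Real.log_mul (L.norm_pos v _ _ _).ne' (M.norm_pos v _ _ _).ne'

lemma localSum_dual (hx : (baseHom π x.pt).Finite) (L : MetrizedLineBundle π) (v : Place K) :
    L.dual.localSum x v = -L.localSum x v := by
  have := x.finite_emb hx v
  rw [localSum, localSum, ← finsum_neg_distrib]
  exact finsum_congr fun τ => Real.log_inv _

lemma localSum_triv (v : Place K) : (triv π).localSum x v = 0 :=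
  (finsum_congr fun _ => Real.log_one).trans finsum_zero

lemma HasFiniteSupport.tensor (hx : (baseHom π x.pt).Finite) {L M : MetrizedLineBundle π}
    (hL : L.HasFiniteSupport x) (hM : M.HasFiniteSupport x) : (L.tensor M).HasFiniteSupport x := by
  refine (hL.union hM).subset fun v h0 => ?_
  by_contra! h1
  rw [Set.mem_union, not_or] at h1
  refine h0 ?_
  rw [localSum_tensor hx, Function.notMem_support.mp h1.1, Function.notMem_support.mp h1.2, add_zero]

lemma HasFiniteSupport.dual (hx : (baseHom π x.pt).Finite) {L : MetrizedLineBundle π}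
    (hL : L.HasFiniteSupport x) : L.dual.HasFiniteSupport x :=
  hL.subset fun v h0 h1 => h0 (by rw [localSum_dual hx, h1, neg_zero])

lemma hasFiniteSupport_triv : (triv π).HasFiniteSupport x := by
  refine Set.finite_empty.subset fun v h0 => h0 (localSum_triv v)

lemma height_tensor (hx : (baseHom π x.pt).Finite) {L M : MetrizedLineBundle π}
    (hL : L.HasFiniteSupport x) (hM : M.HasFiniteSupport x) :
    (L.tensor M).height x = L.height x + M.height x := by
  rw [MetrizedLineBundle.height_eq, MetrizedLineBundle.height_eq, MetrizedLineBundle.height_eq]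
  simp only [localSum_tensor hx, mul_add]
  rw [finsum_add_distrib (Place.finite_support_n_mul hL) (Place.finite_support_n_mul hM), mul_add]

end MetrizedLineBundle

namespace MetPic

open MetrizedLineBundle

variable {x : AlgPoint π} (hx : (baseHom π x.pt).Finite)

lemma isometric_out_cls (L : MetrizedLineBundle π) : Isometric (Quotient.out L.cls) L :=
  Quotient.mk_out L

lemma hasFiniteSupport_out_cls_iff (hx : (baseHom π x.pt).Finite) (L : MetrizedLineBundle π) :
    (Quotient.out L.cls).HasFiniteSupport x ↔ L.HasFiniteSupport x :=
  ⟨(isometric_out_cls L).symm.hasFiniteSupport hx, (isometric_out_cls L).hasFiniteSupport hx⟩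

lemma height_cls (hx : (baseHom π x.pt).Finite) {L : MetrizedLineBundle π}
    (hL : L.HasFiniteSupport x) : L.cls.height x = L.height x :=
  (isometric_out_cls L).height_eq hx hL

lemma cls_out (c : MetPic π) : MetrizedLineBundle.cls (Quotient.out c) = c := Quotient.out_eq c

lemma tensor_out_cls (c d : MetPic π) :
    (MetrizedLineBundle.tensor (Quotient.out c) (Quotient.out d)).cls = c + d :=
  congrArg₂ (fun a b : MetPic π => a + b) (cls_out c) (cls_out d)

lemma dual_out_cls (c : MetPic π) : (MetrizedLineBundle.dual (Quotient.out c)).cls = -c :=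
  congrArg (fun a : MetPic π => -a) (cls_out c)

/-- The classes of metrised line bundles to whose height at `x` finitely many places contribute. -/
def finiteSupport (hx : (baseHom π x.pt).Finite) : AddSubgroup (MetPic π) where
  carrier := {c | MetrizedLineBundle.HasFiniteSupport (Quotient.out c) x}
  add_mem' {c d} hc hd := by
    have h := (hasFiniteSupport_out_cls_iff hx _).mpr (HasFiniteSupport.tensor hx hc hd)
    rwa [tensor_out_cls] at h
  zero_mem' := (hasFiniteSupport_out_cls_iff hx (triv π)).mpr hasFiniteSupport_triv
  neg_mem' {c} hc := by
    have h := (hasFiniteSupport_out_cls_iff hx _).mpr (HasFiniteSupport.dual hx hc)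
    rwa [dual_out_cls] at h

lemma cls_mem_finiteSupport {L : MetrizedLineBundle π} (hL : L.HasFiniteSupport x) :
    L.cls ∈ finiteSupport hx :=
  (hasFiniteSupport_out_cls_iff hx L).mpr hL

/-- The height at `x`, as a homomorphism. -/
def heightHom : finiteSupport hx →+ ℝ :=
  AddMonoidHom.mk' (fun c => c.1.height x) fun c d => by
    have h := height_cls hx (HasFiniteSupport.tensor hx c.2 d.2)
    rw [tensor_out_cls] at h
    exact h.trans (height_tensor hx c.2 d.2)

end MetPic

end LocalSums

/-! ### Heights with respect to `𝒪_v(f)` as integrals. -/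

noncomputable section Twists

variable {K : Type u} [Field K] [NumberField K] {X : Scheme.{u}} {π : X ⟶ Spec (.of K)}
  {x : AlgPoint π}

lemma integral_eta (hx : (baseHom π x.pt).Finite) (v : Place K) (f : C(An π v, ℝ)) :
    ∫ y, f y ∂x.eta v = (x.degree : ℝ)⁻¹ * ∑ᶠ τ : x.Emb v, f (x.conjugate τ) := by
  have := x.finite_emb hx v
  let _ := Fintype.ofFinite (x.Emb v)
  have hm : StronglyMeasurable f := f.continuous.stronglyMeasurable
  rw [AlgPoint.eta, integral_smul_measure, Measure.sum_fintype, integral_finsetSum_measure,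
    finsum_eq_sum_of_fintype]
  · simp only [integral_dirac' _ _ hm]
    rw [ENNReal.toReal_inv, ENNReal.toReal_natCast, smul_eq_mul]
  · exact fun τ _ => integrable_dirac' hm enorm_lt_top

/-- In characteristic zero, the number of embeddings in an algebraically closed field is the degree.
-/
lemma isProbabilityMeasure_eta (hx : (baseHom π x.pt).Finite) (v : Place K) :
    IsProbabilityMeasure (x.eta v) := by
  have := x.finite_emb hx v
  let _ := Fintype.ofFinite (x.Emb v)
  constructor
  rw [AlgPoint.eta, Measure.smul_apply, Measure.sum_fintype, Measure.finsetSum_apply]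
  simp only [measure_univ, Finset.sum_const, Finset.card_univ, smul_eq_mul, nsmul_eq_mul, mul_one]
  rw [← Nat.card_eq_fintype_card, AlgPoint.natCard_emb hx]
  exact ENNReal.inv_mul_cancel (Nat.cast_ne_zero.mpr (AlgPoint.degree_pos hx).ne')
    (ENNReal.natCast_ne_top _)

/-- The set of the conjugates of `x` at the conjugate place is the conjugate one. -/
lemma finsum_conj {σ τ : K →+* ℂ} (h : ComplexEmbedding.conjugate τ = σ)
    (f : InfPt π σ → ℝ) :
    ∑ᶠ ρ : x.Emb (.inf τ), f (InfPt.cast π h (InfPt.conj π (x.conjugate ρ))) =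
      ∑ᶠ ρ : x.Emb (.inf σ), f (x.conjugate ρ) := by
  subst h
  have hcc : ∀ ρ : X.residueField x.pt →+* ℂ, (starRingEnd ℂ).comp ((starRingEnd ℂ).comp ρ) = ρ :=
    fun ρ => by ext a; simp
  let e : x.Emb (.inf τ) ≃ x.Emb (.inf (ComplexEmbedding.conjugate τ)) :=
    { toFun := fun ρ => ⟨(starRingEnd ℂ).comp ρ.1, by rw [RingHom.comp_assoc, ρ.2]; rfl⟩
      invFun := fun ρ => ⟨(starRingEnd ℂ).comp ρ.1, by
        rw [RingHom.comp_assoc, ρ.2]; ext a; simp⟩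
      left_inv := fun ρ => Subtype.ext (hcc ρ.1)
      right_inv := fun ρ => Subtype.ext (hcc ρ.1) }
  exact finsum_comp_equiv e (f := fun ρ : x.Emb (.inf (ComplexEmbedding.conjugate τ)) =>
    f (x.conjugate ρ))

lemma one_lt_natCard_quotient (𝔭 : HeightOneSpectrum (𝓞 K)) : 1 < Nat.card (𝓞 K ⧸ 𝔭.asIdeal) :=
  HeightOneSpectrum.one_lt_absNorm 𝔭

lemma Place.n_pos (v : Place K) : 0 < v.n := by
  rcases v with 𝔭 | σ
  · refine Nat.pos_of_ne_zero fun h => ?_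
    have h1 := one_lt_natCard_quotient 𝔭
    have h2 := absNorm_eq_resChar_pow 𝔭
    rw [show resDegree 𝔭 = 0 from h, pow_zero] at h2
    exact h1.ne' h2
  · exact one_pos

/-- The local contributions to the heights with respect to `𝒪_v(f)`. -/
lemma exists_localSum_trivTwist (π : X ⟶ Spec (.of K)) (v : Place K) :
    ∃ m : Place K → ℝ, (Function.support m).Finite ∧ (∀ w, 0 ≤ m w) ∧ 0 < m v ∧
      ∀ (x : AlgPoint π) (f : invariantFunctions π v) (w : Place K),
        (trivTwist π v f).localSum x w = -(m w * ∑ᶠ τ : x.Emb v, f.1 (x.conjugate τ)) := by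
  classical
  rcases v with 𝔭 | σ
  · have h1 : (1 : ℝ) < Nat.card (𝓞 K ⧸ 𝔭.asIdeal) := by exact_mod_cast one_lt_natCard_quotient 𝔭
    have hl := Real.log_pos h1
    -- The weight is the logarithm of the base used in `𝒪_𝔭(f)`.
    refine ⟨Pi.single (.fin 𝔭) (Real.log (Nat.card (𝓞 K ⧸ 𝔭.asIdeal))),
      (Set.finite_singleton _).subset Pi.support_single_subset, fun w => ?_, ?_,
      fun x f w => ?_⟩
    · rw [Pi.single_apply]
      split_ifs
      exacts [hl.le, le_rfl]
    · rwa [Pi.single_eq_same]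
    · by_cases hw : w = .fin 𝔭
      · subst hw
        rw [Pi.single_eq_same, mul_finsum, ← finsum_neg_distrib]
        refine finsum_congr fun τ => ?_
        have : normOne π (.fin 𝔭) f.1 (.fin 𝔭) (x.conjugate τ) =
            (Nat.card (𝓞 K ⧸ 𝔭.asIdeal) : ℝ) ^ (-f.1 (x.conjugate τ)) := by
          simp only [normOne, dif_pos]
          rfl
        refine (congrArg Real.log this).trans ?_
        rw [Real.log_rpow (one_pos.trans h1), neg_mul, mul_comm]
      · rw [Pi.single_eq_of_ne hw, zero_mul, neg_zero]
        refine (finsum_congr fun τ => ?_).trans finsum_zero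
        have : normOne π (.fin 𝔭) f.1 w (x.conjugate τ) = 1 := by
          rcases w with 𝔮 | σ
          · have h : 𝔮 ≠ 𝔭 := fun h => hw (congrArg _ h)
            simp only [normOne, dif_neg h]
          · rfl
        exact (congrArg Real.log this).trans Real.log_one
  -- A real embedding is its own conjugate and is counted once; otherwise the function and its
  -- conjugate contribute at two places.
  · let m : Place K → ℝ := fun w =>
      if w = .inf σ ∨ w = .inf (ComplexEmbedding.conjugate σ) then 1 else 0
    refine ⟨m, (Set.toFinite {.inf σ, .inf (ComplexEmbedding.conjugate σ)}).subset fun w hw => ?_,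
      fun w => ?_, ?_, fun x f w => ?_⟩
    · by_contra h
      exact hw (if_neg h)
    · dsimp only [m]
      split_ifs <;> norm_num
    · simp [m]
    · rcases w with 𝔮 | τ
      · have : m (.fin 𝔮) = 0 := by simp [m]
        rw [this, zero_mul, neg_zero]
        exact (finsum_congr fun ρ => Real.log_one).trans finsum_zero
      · by_cases h : τ = σ
        · subst h
          have : m (.inf τ) = 1 := by simp [m]
          rw [this, one_mul, ← finsum_neg_distrib]
          refine finsum_congr fun ρ => ?_
          have : normOne π (.inf τ) f.1 (.inf τ) (x.conjugate ρ) =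
              Real.exp (-f.1 (x.conjugate ρ)) := by
            simp only [normOne, dif_pos]
            rfl
          exact (congrArg Real.log this).trans (Real.log_exp _)
        · by_cases h' : ComplexEmbedding.conjugate τ = σ
          · have : m (.inf τ) = 1 := by simp [m, ← h']
            -- At the conjugate place, conjugation of embeddings brings the sum back to the one at
            -- `σ`.
            have hc := finsum_conj (x := x) h' f.1
            rw [this, one_mul]
            refine Eq.trans ?_ (congrArg Neg.neg hc)
            rw [← finsum_neg_distrib]
            refine finsum_congr fun ρ => ?_
            have : normOne π (.inf σ) f.1 (.inf τ) (x.conjugate ρ) =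
                Real.exp (-f.1 (InfPt.cast π h' (InfPt.conj π (x.conjugate ρ)))) := by
              simp only [normOne, dif_neg h, dif_pos h']
            exact (congrArg Real.log this).trans (Real.log_exp _)
          · have h2 : τ ≠ ComplexEmbedding.conjugate σ := fun h2 => h' (by rw [h2]; ext a; simp)
            have : m (.inf τ) = 0 := by
              refine if_neg ?_
              rintro (h3 | h3)
              · exact h (Place.inf_injective h3)
              · exact h2 (Place.inf_injective h3)
            rw [this, zero_mul, neg_zero]
            refine (finsum_congr fun ρ => ?_).trans finsum_zero
            have : normOne π (.inf σ) f.1 (.inf τ) (x.conjugate ρ) = 1 := by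
              simp only [normOne, dif_neg h, dif_neg h']
            exact (congrArg Real.log this).trans Real.log_one

/-- This links heights to measures: the factor `[K(x) : K]⁻¹` of the height is the one that
normalises `η_{x,v}`. What remains is `n_𝔭 log #𝔽_𝔭 / [K : ℚ]` at a finite place, and `1 / [K : ℚ]`
or `2 / [K : ℚ]` at a real or a complex embedding. -/
lemma exists_height_twistHom (π : X ⟶ Spec (.of K)) (v : Place K) :
    ∃ C : ℝ, 0 < C ∧ ∀ (x : AlgPoint π) (hx : (baseHom π x.pt).Finite)
      (f : invariantFunctions π v), twistHom π v f ∈ MetPic.finiteSupport hx ∧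
        (twistHom π v f).height x = C * ∫ y, f.1 y ∂x.eta v := by
  obtain ⟨m, hm, hm0, hmv, hf⟩ := exists_localSum_trivTwist π v
  have hpos : 0 < ∑ᶠ w : Place K, (w.n : ℝ) * m w := by
    refine finsum_pos (fun w => mul_nonneg (Nat.cast_nonneg _) (hm0 w))
      ⟨v, mul_pos (Nat.cast_pos.mpr v.n_pos) hmv⟩ (Place.finite_support_n_mul hm)
  have hK : (0 : ℝ) < Module.finrank ℚ K := Nat.cast_pos.mpr Module.finrank_pos
  refine ⟨(Module.finrank ℚ K : ℝ)⁻¹ * ∑ᶠ w : Place K, (w.n : ℝ) * m w,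
    mul_pos (inv_pos.mpr hK) hpos, fun x hx f => ?_⟩
  have hfs : (trivTwist π v f).HasFiniteSupport x := hm.subset fun w h0 h1 => h0 (by
    rw [hf, h1, zero_mul, neg_zero])
  refine ⟨MetPic.cls_mem_finiteSupport hx hfs, (MetPic.height_cls hx hfs).trans ?_⟩
  rw [MetrizedLineBundle.height_eq, integral_eta hx]
  have : ∀ w : Place K, (w.n : ℝ) * (trivTwist π v f).localSum x w =
      ((w.n : ℝ) * m w) * -∑ᶠ τ : x.Emb v, f.1 (x.conjugate τ) := fun w => by
    rw [hf]; ring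
  rw [finsum_congr this, ← finsum_mul, Nat.cast_mul, mul_inv]
  ring

end Twists

end Arakelov

namespace Arakelov

/-! ### Integrality at almost all places. -/

section Integrality

/-- Valuation rings are integrally closed. -/
lemma valuation_le_one_of_isIntegralElem {A F Γ₀ : Type*} [CommRing A] [Field F]
    [LinearOrderedCommGroupWithZero Γ₀] (j : A →+* F) (w : Valuation F Γ₀)
    (hj : ∀ a, w (j a) ≤ 1) {z : F} (hz : j.IsIntegralElem z) : w z ≤ 1 := by
  obtain ⟨p, hp, h⟩ := hz
  let j' : A →+* w.integer := j.codRestrict w.integer hj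
  refine (Valuation.integer.integers w).mem_of_integral ⟨p.map j', hp.map _, ?_⟩
  rw [Polynomial.eval₂_map]
  exact h

/-- The functions in a finitely generated `𝓞_K`-algebra are integral at a point that is finite over
`K`, for almost all places. -/
lemma exists_forall_valuation_le_one {K κ A : Type*} [Field K] [NumberField K] [Field κ] [CommRing A]
    {f : K →+* κ} (hf : f.Finite) (e : A →+* κ) (c : 𝓞 K →+* A) (hc : c.FiniteType)
    (hec : e.comp c = f.comp (algebraMap (𝓞 K) K)) :
    ∃ d : 𝓞 K, d ≠ 0 ∧ ∀ w : Valuation κ ℝ≥0, (∀ a : 𝓞 K, w (f a) ≤ 1) → w (f d) = 1 →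
      ∀ a, w (e a) ≤ 1 := by
  classical
  let _ := f.toAlgebra
  let _ : Algebra (𝓞 K) κ := (f.comp (algebraMap (𝓞 K) K)).toAlgebra
  have : IsScalarTower (𝓞 K) K κ := IsScalarTower.of_algebraMap_eq fun _ => rfl
  have : Module.Finite K κ := hf
  have halg : Algebra.IsAlgebraic (𝓞 K) κ :=
    ⟨fun z => (IsFractionRing.isAlgebraic_iff (𝓞 K) K κ).mpr (Algebra.IsAlgebraic.isAlgebraic z)⟩
  let _ := c.toAlgebra
  obtain ⟨⟨s, hs⟩⟩ := hc
  -- The element `d` is a common denominator of the values of finitely many generators; where `w (f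
  -- d) = 1`, clearing it changes no absolute value.
  obtain ⟨d, hd, hint⟩ := Algebra.IsAlgebraic.exists_integral_multiples (𝓞 K) (s.image e)
  refine ⟨d, hd, fun w hw hwd a => ?_⟩
  have ha : a ∈ Algebra.adjoin (𝓞 K) (s : Set A) := hs ▸ trivial
  induction ha using Algebra.adjoin_induction with
  | mem a ha =>
    have h := valuation_le_one_of_isIntegralElem (algebraMap (𝓞 K) κ) w hw
      (hint (e a) (Finset.mem_image_of_mem e ha))
    rw [Algebra.smul_def, map_mul] at h
    change w (f d) * _ ≤ 1 at h
    rwa [hwd, one_mul] at h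
  | algebraMap r =>
    have h := DFunLike.congr_fun hec r
    exact (congrArg w h).trans_le (hw r)
  | add a b _ _ ha hb =>
    rw [map_add]
    exact (w.map_add _ _).trans (max_le ha hb)
  | mul a b _ _ ha hb =>
    rw [map_mul, map_mul]
    exact mul_le_one' ha hb

end Integrality

/-! ### Projective morphisms are locally of finite type. -/

section FiniteType

attribute [local instance] MvPolynomial.gradedAlgebra

lemma finiteType_of_closure_range_eq_top {A B ι : Type*} [CommRing A] [CommRing B] [Finite ι]
    (ψ : A →+* B) (s : ι → B) (hs : Subring.closure (Set.range s) = ⊤) : ψ.FiniteType := by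
  let _ := ψ.toAlgebra
  refine ⟨⟨(Set.finite_range s).toFinset, eq_top_iff.mpr fun a _ => ?_⟩⟩
  have ha : a ∈ Subring.closure (Set.range s) := hs ▸ trivial
  have hle : Subring.closure (Set.range s) ≤
      (Algebra.adjoin A ((Set.finite_range s).toFinset : Set B)).toSubring := by
    refine Subring.closure_le.mpr ?_
    rw [Set.Finite.coe_toFinset]
    exact Algebra.subset_adjoin
  exact hle ha

lemma locallyOfFiniteType_terminal_from_Proj (n : ℕ) :
    LocallyOfFiniteType (Limits.terminal.from (Proj (coordGrading.{u} n))) := by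
  refine HasRingHomProperty.of_iSup_eq_top (P := @LocallyOfFiniteType)
    (fun i : Fin (n + 1) => ⟨Proj.basicOpen (coordGrading.{u} n) (MvPolynomial.X i),
      Proj.isAffineOpen_basicOpen (coordGrading.{u} n) (MvPolynomial.X i)
        (X_mem_coordGrading i) one_pos⟩) ?_ fun i => ?_
  · exact eq_top_iff.mpr fun x _ => TopologicalSpace.Opens.mem_iSup.mpr (exists_mem_basicOpen_X x)
  · exact finiteType_of_closure_range_eq_top _ _ (closure_projFrac i)

lemma IsProjective.locallyOfFiniteType {Y S : Scheme.{u}} {p : Y ⟶ S} (hp : IsProjective p) :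
    LocallyOfFiniteType p := by
  obtain ⟨n, i, hi, rfl⟩ := hp
  have := locallyOfFiniteType_terminal_from_Proj.{u} n
  have h : LocallyOfFiniteType (ProjSpace.toBase n S) :=
    inferInstanceAs (LocallyOfFiniteType (Limits.pullback.fst (Limits.terminal.from S)
      (Limits.terminal.from (Proj (coordGrading.{u} n)))))
  infer_instance

end FiniteType

/-! ### Models, and finiteness of the set of contributing places. -/

noncomputable section Models

/-- A point of a scheme of finite type with values in a ring, through an affine open set. -/
lemma exists_factorization {𝒳 : Scheme.{u}} {A κ : CommRingCat.{u}} (q : 𝒳 ⟶ Spec A)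
    [LocallyOfFiniteType q] (f : Spec κ ⟶ 𝒳) {W : 𝒳.Opens} (hW : IsAffineOpen W)
    (hf : ⊤ ≤ f ⁻¹ᵁ W) (g : A ⟶ κ) (hg : f ≫ q = Spec.map g) :
    ∃ (c : A ⟶ Γ(𝒳, W)) (e : Γ(𝒳, W) ⟶ κ), c.hom.FiniteType ∧ c ≫ e = g ∧
      Spec.map e ≫ hW.fromSpec = f := by
  have hq : W ≤ q ⁻¹ᵁ ⊤ := le_top
  refine ⟨(Scheme.ΓSpecIso A).inv ≫ q.appLE ⊤ W hq,
    f.appLE W ⊤ hf ≫ (Scheme.ΓSpecIso κ).hom, ?_, ?_, ?_⟩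
  · have h1 : (q.appLE ⊤ W hq).hom.FiniteType :=
      HasRingHomProperty.appLE @LocallyOfFiniteType q inferInstance ⟨⊤, isAffineOpen_top _⟩
        ⟨W, hW⟩ hq
    exact h1.comp (RingHom.FiniteType.of_surjective _
      (ConcreteCategory.bijective_of_isIso (Scheme.ΓSpecIso A).inv).2)
  · have h : q.appLE ⊤ W hq ≫ f.appLE W ⊤ hf = (f ≫ q).appTop := by
      rw [Scheme.Hom.appLE_comp_appLE, Scheme.Hom.appTop, Scheme.Hom.app_eq_appLE]
      rfl
    rw [Category.assoc, ← Category.assoc (q.appLE _ _ _), h, hg, ← Category.assoc,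
      ← Scheme.ΓSpecIso_inv_naturality, Category.assoc, Iso.inv_hom_id, Category.comp_id]
  · rw [Spec.map_comp, Category.assoc, hW.SpecMap_appLE_fromSpec f (isAffineOpen_top _),
      IsAffineOpen.fromSpec_top, Scheme.isoSpec_Spec_inv, ← Category.assoc, ← Spec.map_comp]
    simp

variable {K : Type u} [Field K] [NumberField K] {X : Scheme.{u}} {π : X ⟶ Spec (.of K)}

/-- The complement of a non-empty open set lies in the zero locus of a nonzero element of `𝓞 K`,
which has finitely many prime divisors. -/
lemma finite_setOf_notMem {Z : (Spec (.of (𝓞 K))).Opens}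
    (hZ : (Z : Set (Spec (.of (𝓞 K)))).Nonempty) :
    {𝔭 : HeightOneSpectrum (𝓞 K) |
      (⟨𝔭.asIdeal, 𝔭.isPrime⟩ : PrimeSpectrum (𝓞 K)) ∉ Z}.Finite := by
  obtain ⟨s, hs⟩ := (PrimeSpectrum.isOpen_iff Z.1).mp Z.2
  obtain ⟨𝔮, h𝔮⟩ := hZ
  have h1 : ¬s ⊆ (𝔮.asIdeal : Set (𝓞 K)) := fun h => hs.ge h h𝔮
  rw [Set.not_subset] at h1
  obtain ⟨a, ha, ha'⟩ := h1
  have ha0 : a ≠ 0 := by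
    rintro rfl
    exact ha' (zero_mem 𝔮.asIdeal)
  refine (finite_setOf_mem_asIdeal ha0).subset fun 𝔭 h𝔭 => ?_
  exact (hs.le h𝔭 : _ ∈ PrimeSpectrum.zeroLocus s) ha

lemma absFin_le_one (𝔭 : HeightOneSpectrum (𝓞 K)) (a : 𝓞 K) : absFin 𝔭 (a : K) ≤ 1 :=
  HeightOneSpectrum.adicAbv_coe_le_one 𝔭 (one_lt_resChar 𝔭) a

lemma absFin_eq_one {𝔭 : HeightOneSpectrum (𝓞 K)} {a : 𝓞 K} (h : a ∉ 𝔭.asIdeal) :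
    absFin 𝔭 (a : K) = 1 :=
  NNReal.coe_injective ((HeightOneSpectrum.adicAbv_coe_eq_one_iff 𝔭 (one_lt_resChar 𝔭) a).mpr h)

namespace MetrizedLineBundle

lemma modelNorm_self (L : MetrizedLineBundle π) {𝒳 : Scheme.{u}} {i : X ⟶ 𝒳}
    {ℒ : LineBundle 𝒳} (φ : LineBundle.Iso (ℒ.pullback i) L.toLineBundle) {v : Place K}
    (y : An π v) :
    L.modelNorm φ y (i y.pt) (ℒ.mem _) =
      y.absAt (φ.mem y.pt) (φ.h y.pt) * L.norm v y.pt y (L.mem y.pt) := by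
  have h : i.app _ (ℒ.g (i y.pt) (i y.pt)) = 1 := by rw [LineBundle.g_self, map_one]
  exact (congrArg (· * _) ((congrArg (y.absAt _) h).trans (An.absAt_one y _))).trans (one_mul _)

/-- The metric at a point that extends to an integral point of an affine open set of the model. -/
lemma IsInducedAt.absAt_mul_norm_eq_one {L : MetrizedLineBundle π} {𝒳 : Scheme.{u}} {i : X ⟶ 𝒳}
    {ℒ : LineBundle 𝒳} {φ : LineBundle.Iso (ℒ.pullback i) L.toLineBundle}
    {𝔭 : HeightOneSpectrum (𝓞 K)} (h : L.IsInducedAt φ 𝔭) (y : FinPt π 𝔭) {W : 𝒳.Opens}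
    (hW : IsAffineOpen W) (hWU : W ≤ ℒ.U (i y.pt)) (e : Γ(𝒳, W) ⟶ X.residueField y.pt)
    (he : Spec.map e ≫ hW.fromSpec = X.fromSpecResidueField y.pt ≫ i)
    (hle : ∀ a, y.val (e a) ≤ 1) :
    An.absAt (v := .fin 𝔭) y (φ.mem y.pt) (φ.h y.pt) *
      L.norm (.fin 𝔭) y.pt y (L.mem y.pt) = 1 := by
  -- Integral values give an extension of the point to its valuation ring inside `W`, so the
  -- reduction lies where the frame is defined.
  let e' : Γ(𝒳, W) →+* y.val.valuationSubring := e.hom.codRestrict y.val.valuationSubring hle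
  refine (modelNorm_self L φ (v := .fin 𝔭) y).symm.trans
    (h y (Spec.map (CommRingCat.ofHom e') ≫ hW.fromSpec) ?_ _ _ ?_)
  · rw [← Category.assoc, ← Spec.map_comp, ← he]
    rfl
  · refine hWU ?_
    exact hW.range_fromSpec.le ⟨Spec.map (CommRingCat.ofHom e')
      (IsLocalRing.closedPoint y.val.valuationSubring), rfl⟩

/-- Almost all places do not contribute to the height with respect to an adelic line bundle. -/
lemma IsAdelic.hasFiniteSupport {x : AlgPoint π} (hx : (baseHom π x.pt).Finite)
    {L : MetrizedLineBundle π} (hL : L.IsAdelic) : L.HasFiniteSupport x := by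
  obtain ⟨Z, 𝒳, p, i, ℒ, φ, hZ, hp, -, hsq, hind⟩ := hL
  have := hp.locallyOfFiniteType
  obtain ⟨_, ⟨W, hW, rfl⟩, hξ, hWU⟩ :=
    𝒳.isBasis_affineOpens.exists_subset_of_mem_open (ℒ.mem (i x.pt)) (ℒ.U (i x.pt)).2
  have hf : ⊤ ≤ (X.fromSpecResidueField x.pt ≫ i) ⁻¹ᵁ W := fun s _ => by
    change (X.fromSpecResidueField x.pt ≫ i) s ∈ W
    rw [Scheme.Hom.comp_apply, Scheme.fromSpecResidueField_apply]
    exact hξ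
  obtain ⟨c, e, hc, hce, he⟩ := exists_factorization (p ≫ Z.ι) (X.fromSpecResidueField x.pt ≫ i)
    hW hf (CommRingCat.ofHom ((baseHom π x.pt).comp (algebraMap (𝓞 K) K))) (by
      rw [Category.assoc, hsq.w, ← Category.assoc, fromSpecResidueField_comp, ← Spec.map_comp]
      rfl)
  -- Away from the primes dividing `d`, all the conjugates of `x` extend to integral points of the
  -- same affine open set `W`.
  obtain ⟨d, hd, hval⟩ := exists_forall_valuation_le_one hx e.hom c.hom hc
    (congrArg CommRingCat.Hom.hom hce)
  have hne : X.evaluation (φ.V x.pt) x.pt (φ.mem x.pt) (φ.h x.pt) ≠ 0 :=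
    ((φ.isUnit x.pt).map (X.evaluation (φ.V x.pt) x.pt (φ.mem x.pt)).hom).ne_zero
  -- The exceptional primes divide `d`, lie outside `Z`, or are those where the norm of the function
  -- comparing the frame of the model with that of `L` is not of absolute value `1`.
  refine Place.finite_support ((((finite_setOf_mem_asIdeal hd).union (finite_setOf_notMem hZ)).union
    (finite_support_log_absFin (fieldNorm_ne_zero hx hne))).subset fun 𝔭 h𝔭 => ?_)
  by_contra! h
  simp only [Set.mem_union, Set.mem_ofPred_eq, not_or, not_not, Function.notMem_support] at h
  obtain ⟨⟨h1, h2⟩, h3⟩ := h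
  refine h𝔭 ?_
  have key : ∀ τ : x.Emb (.fin 𝔭),
      (x.conjugate τ).absAt (x.mem_conjugate τ (φ.mem x.pt)) (φ.h x.pt) *
        L.norm (.fin 𝔭) x.pt (x.conjugate τ) (x.mem_conjugate τ (L.mem _)) = 1 := fun τ => by
    let y : FinPt π 𝔭 := x.conjugate τ
    refine (hind 𝔭 h2).absAt_mul_norm_eq_one y hW hWU e he (hval y.val (fun a => ?_) ?_)
    · exact (y.val_base a).trans_le (absFin_le_one 𝔭 a)
    · exact (y.val_base d).trans (absFin_eq_one h1)
  -- The frame of the model has norm `1` at each conjugate, so only the comparison function is left,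
  -- and its conjugates multiply to an element of `K`.
  have hs : L.localSum x (.fin 𝔭) = -∑ᶠ τ : x.Emb (.fin 𝔭),
      Real.log ((x.conjugate τ).absAt (x.mem_conjugate τ (φ.mem x.pt)) (φ.h x.pt)) := by
    rw [← finsum_neg_distrib]
    refine finsum_congr fun τ => ?_
    rw [← Real.log_inv, eq_inv_of_mul_eq_one_right (key τ)]
  refine hs.trans ?_
  rw [AlgPoint.finsum_log_absAt hx _ _ hne]
  exact (congrArg Neg.neg h3).trans neg_zero

end MetrizedLineBundle

end Models

end Arakelov

namespace Arakelov

/-! ### Reduction to conjugation-invariant functions. -/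

section RealPlaces

variable {K : Type u} [Field K] {X : Scheme.{u}} {π : X ⟶ Spec (.of K)}

lemma InfPt.continuous_cast_conj [NumberField K] {σ τ : K →+* ℂ} (h : ComplexEmbedding.conjugate τ = σ) :
    Continuous fun y : InfPt π τ => InfPt.cast π h (InfPt.conj π y) := by
  subst h
  exact continuous_conj π τ

lemma InfPt.cast_conj_cast_conj {σ : K →+* ℂ} (h : ComplexEmbedding.conjugate σ = σ)
    (y : InfPt π σ) : InfPt.cast π h (InfPt.conj π (InfPt.cast π h (InfPt.conj π y))) = y := by
  have : (starRingEnd ℂ).comp ((starRingEnd ℂ).comp y.emb) = y.emb := by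
    ext a; simp
  cases y
  simp only [InfPt.cast, InfPt.conj] at this ⊢
  congr

/-- The integral of a function against the measures `η_{x,v}` is, up to a factor, that of an
invariant one. -/
lemma exists_invariantFunctions_integral_eq [NumberField K] (v : Place K) (f : C(An π v, ℝ)) :
    ∃ (g : invariantFunctions π v) (c : ℝ), ∀ x : AlgPoint π, (baseHom π x.pt).Finite →
      ∫ y, f y ∂x.eta v = c * ∫ y, g.1 y ∂x.eta v := by
  rcases v with 𝔭 | σ
  · exact ⟨⟨f, trivial⟩, 1, fun x _ => (one_mul _).symm⟩
  by_cases h : ComplexEmbedding.conjugate σ = σ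
  · let T : C(An π (.inf σ), An π (.inf σ)) :=
      ⟨fun y => InfPt.cast π h (InfPt.conj π y), InfPt.continuous_cast_conj h⟩
    have hT : ∀ y, T (T y) = y := InfPt.cast_conj_cast_conj h
    -- At a real place the conjugates of `x` are permuted by `T`, so `f` and `f ∘ T` have the same
    -- integral, half of that of their sum.
    refine ⟨⟨f + f.comp T, fun _ y => ?_⟩, 2⁻¹, fun x hx => ?_⟩
    · change f (T y) + f (T (T y)) = f y + f (T y)
      exact (congrArg (f (T y) + f ·) (hT y)).trans (add_comm _ _)
    · have := x.finite_emb hx (.inf σ)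
      have hc : ∑ᶠ ρ : x.Emb (.inf σ), f (T (x.conjugate ρ)) = ∑ᶠ ρ : x.Emb (.inf σ), f (x.conjugate ρ) :=
        finsum_conj (x := x) h f
      rw [integral_eta hx, integral_eta hx]
      have hs : ∑ᶠ ρ : x.Emb (.inf σ), (f + f.comp T) (x.conjugate ρ) =
          2 * ∑ᶠ ρ : x.Emb (.inf σ), f (x.conjugate ρ) := by
        refine (finsum_add_distrib (Set.toFinite _) (Set.toFinite _)).trans ?_
        rw [two_mul]
        exact congrArg (_ + ·) hc
      rw [hs]
      ring
  · exact ⟨⟨f, fun h' => absurd h' h⟩, 1, fun x _ => (one_mul _).symm⟩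

end RealPlaces

end Arakelov

/-! ### The theorem. -/

theorem mainTheorem1 {K : Type u} [Field K] [NumberField K] {X : Scheme.{u}} [IsIntegral X]
    (π : X ⟶ Spec (.of K)) (hπ : IsProjective π) (v : Place K) (x : ℕ → AlgPoint π) :
    (IsEquidistributed x v →
      ∀ L ∈ adelicPic π, liminfHeight x L ≠ ⊤ → liminfHeight x L ≠ ⊥ →
        (∀ c ∈ semigroupAt (directions π v) L, liminfHeight x c ≠ ⊤ ∧ liminfHeight x c ≠ ⊥) ∧
        IsDifferentiableAt (semigroupAt (directions π v) L) (directions π v)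
          (fun c => (liminfHeight x c).toReal) L) ∧
    ((∃ L ∈ adelicPic π,
        (∃ ℓ : ℝ, Tendsto (fun n => L.height (x n)) atTop (𝓝 ℓ)) ∧
        IsDifferentiableAt (semigroupAt (directions π v) L) (directions π v)
          (fun c => (liminfHeight x c).toReal) L) →
      IsEquidistributed x v) := by
  have hx : ∀ n, (baseHom π (x n).pt).Finite := fun n => (x n).finite_baseHom hπ
  obtain ⟨C, hC, hdir⟩ := exists_height_twistHom π v
  -- On this subgroup the heights at all the points of the sequence are additive; it contains the
  -- adelic classes and the directions `𝒪_v(f)`.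
  let S : AddSubgroup (MetPic π) := ⨅ n, MetPic.finiteSupport (hx n)
  have hHS : directions π v ≤ S := by
    rintro _ ⟨f, rfl⟩
    exact AddSubgroup.mem_iInf.mpr fun n => (hdir (x n) (hx n) f).1
  have hLS : ∀ L ∈ adelicPic π, L ∈ S := by
    rintro _ ⟨L, rfl, hL⟩
    exact AddSubgroup.mem_iInf.mpr fun n =>
      MetPic.cls_mem_finiteSupport (hx n) (hL.hasFiniteSupport (hx n))
  let a' : ℕ → S →+ ℝ := fun n =>
    (MetPic.heightHom (hx n)).comp (AddSubgroup.inclusion (iInf_le _ n))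
  have ha : ∀ n (c : S), (c : MetPic π).height (x n) = a' n c := fun _ _ => rfl
  refine ⟨fun ⟨μ, hμ, hlim⟩ L hL htop hbot => ?_, fun ⟨L, hL, hconv, hdiff⟩ => ?_⟩
  · refine isDifferentiableAt_of_tendsto hHS a' ha (hLS L hL) ?_ htop hbot
    rintro _ ⟨f, rfl⟩
    refine ⟨C * ∫ y, f.1 y ∂μ, ((hlim f.1).const_mul C).congr fun n => ?_⟩
    exact (hdir (x n) (hx n) f).2.symm
  · have := compactSpace_An hπ v
    have := t2Space_An hπ v
    have hprob : ∀ n, IsProbabilityMeasure ((x n).eta v) := fun n => isProbabilityMeasure_eta (hx n) v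
    have hconv' := tendsto_of_isDifferentiableAt hHS a' ha (hLS L hL) (fun w hw => ?_) hconv hdiff
    · refine exists_weak_limit _ fun f => ?_
      obtain ⟨g, c, hg⟩ := exists_invariantFunctions_integral_eq v f
      obtain ⟨ℓ, hℓ⟩ := hconv' (twistHom π v g) ⟨g, rfl⟩
      -- Dividing by `C` recovers the integral of the invariant function `g`, and `c` that of `f`.
      refine ⟨c * (C⁻¹ * ℓ), ((hℓ.const_mul C⁻¹).const_mul c).congr fun n => ?_⟩
      rw [hg (x n) (hx n), (hdir (x n) (hx n) g).2, inv_mul_cancel_left₀ hC.ne']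
    · obtain ⟨f, rfl⟩ := hw
      -- The bound is uniform in `n` because the `η` are probability measures and `f` is bounded on
      -- the compact space.
      refine ⟨C * ‖f.1‖, fun n => ?_⟩
      rw [(hdir (x n) (hx n) f).2, abs_mul, abs_of_pos hC]
      refine mul_le_mul_of_nonneg_left ?_ hC.le
      have h := norm_integral_le_of_norm_le_const (μ := (x n).eta v)
        (Eventually.of_forall f.1.norm_coe_le_norm)
      rwa [probReal_univ, mul_one] at h
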